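/- Conventions. $\mathrm{negl}(k)$ denotes a function that is $O(k^{-c})$ for every $c>0$. A non-uniform PPT algorithm is a probabilistic polynomial-time machine that receives $1^k$ and an advice string of length polynomial in $k$. $|C|$ is the length of the description of a circuit $C$. A witness encryption scheme for an NP language $L$ with witness relation $R_L$ is a pair of (uniform) PPT algorithms $(\mathsf{Enc},\mathsf{Dec})$ such that for every polynomial $q$: (correctness) there is a function $\nu=\mathrm{negl}(k)$ with $\Pr[\mathsf{Dec}(\mathsf{Enc}_x(1^k,b),w)=b]\ge 1-\nu(k)$ for all $k$, all $b\in\{0,1\}$ and all $(x,w)\in R_L$ with $|x|\le q(k)$; (security) for every non-uniform PPT $A$ there is $\nu=\mathrm{negl}(k)$ with $|\Pr[A(\mathsf{Enc}_x(1^k,0))=1]-\Pr[A(\mathsf{Enc}_x(1^k,1))=1]|\le\nu(k)$ for all $k$ and all $x\notin L$ with $|x|\le q(k)$. $L$ (with $R_L$) is NP-complete if every NP witness relation reduces to it by a polynomial-time many-one reduction that comes with a polynomial-time map of witnesses for $x$ to witnesses for the image of $x$ (Levin reduction). Let $\mathcal F=\{f_s\}_{s\in\{0,1\}^k,\,k\in\mathbb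 N}$ be a family of polynomial-size circuits, $f_s:\{0,1\}^{\ell(k)}\to\{0,1\}^{\ell'(k)}$ for $s\in\{0,1\}^k$. For polynomial-size sets $I_k\subseteq\{0,1\}^{\ell(k)}$, $\mathcal F$ has pseudo-entropy at least $p=p(k)$ on $(I_k)$ if there are random variables $Y^s\in(\{0,1\}^{\ell'(k)})^{I_k}$, $s\in\{0,1\}^k$, such that for all sufficiently large $k$ every value of each $Y^s$ has probability at most $2^{-p(k)}$, and for every non-uniform PPT $D$, $|\Pr[D^{f_s}(1^k)=1]-\Pr[D^{f_s\circ Y^s}(1^k)=1]|=\mathrm{negl}(k)$, where $s$ is uniform in $\{0,1\}^k$ and $f_s\circ Y^s$ is $f_s$ with its values on $I_k$ replaced by $Y^s$. $\mathcal F$ has super-polynomial pseudo-entropy if for every polynomial $p$ there are such sets on which it has pseudo-entropy at least $p$. A candidate obfuscator $\mathcal O$ of $\mathcal F$ is a (not necessarily efficient) probabilistic map from circuits to circuits such that $\mathcal O(f_s)$ always computes the same function as $f_s$ and $|\mathcal O(f_s)|\le p(|f_s|)$ for a fixed polynomial $p$. It is an average-case VBB obfuscator with dependent auxiliary input if moreover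 for every non-uniform PPT $A$ there is a non-uniform PPT $S$ such that for every predicate $\pi$ and every auxiliary input $\mathsf{aux}(s)$ of length $\mathrm{poly}(k)$, $|\Pr[A(\mathcal O(f_s),\mathsf{aux}(s))=\pi(s,\mathsf{aux}(s))]-\Pr[S^{f_s}(\mathsf{aux}(s))=\pi(s,\mathsf{aux}(s))]|=\mathrm{negl}(k)$, where $s$ is uniform in $\{0,1\}^k$. **Theorem.** Assume that there is a witness encryption scheme for an NP-complete language. 1. No circuit family with super-polynomial pseudo-entropy has an average-case VBB obfuscator with dependent auxiliary input. 2. There is a witness encryption scheme for the language of statements "some circuit of size at most $B$ maps $i$ to $y_i$ for all $i\in I$" (given $B$, the input and output lengths, and the list of pairs $(i,y_i)$), whose witnesses are such circuits. 3. Let $(\mathsf{Enc},\mathsf{Dec})$ be any scheme as in 2, let $\mathcal O$ be a candidate obfuscator of a family $\mathcal F$, let $B$ be a polynomial with $|\mathcal O(f_s)|\le B(k)$ for all $k$ and all $s\in\{0,1\}^k$, and let $\mathcal F$ have pseudo-entropy at least $B(k)+k$ on $(I_k)$ (if $\mathcal F$ has super-polynomial pseudo-entropy, such $B$ and $I_k$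 exist). Let $x_s$ be the statement "some circuit of size at most $B(k)$ agrees with $f_s$ on $I_k$". There is a non-uniform PPT algorithm $A$ such that: (a) for a uniform random bit $b$, $\Pr[A(\mathcal O(f_s),\mathsf{Enc}_{x_s}(1^k,b))=b]\ge1-\mathrm{negl}(k)$, whereas every non-uniform PPT $S$ satisfies $\Pr[S^{f_s}(\mathsf{Enc}_{x_s}(1^k,b))=b]\le\frac12+\mathrm{negl}(k)$; (b) for every predicate $\pi(s)$ and every function $\delta(k)$ (for instance $\delta=\frac12$): if $\pi$ is not learnable from black-box access beyond $\delta$, i.e. $\Pr[L^{f_s}(1^k)=\pi(s)]\le\delta(k)+\mathrm{negl}(k)$ for every non-uniform PPT $L$, then $\Pr[A(\mathcal O(f_s),\mathsf{Enc}_{x_s}(1^k,\pi(s)))=\pi(s)]\ge1-\mathrm{negl}(k)$, whereas every non-uniform PPT $S$ satisfies $\Pr[S^{f_s}(\mathsf{Enc}_{x_s}(1^k,\pi(s)))=\pi(s)]\le\delta(k)+\mathrm{negl}(k)$. Here $s$ is uniform in $\{0,1\}^k$, and the probabilities are also over $b$ and all coins. -/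

import Mathlib

open Filter Asymptotics

noncomputable section

namespace VBBObf

/-! ### Bit strings, negligible functions -/

/-- `{0,1}^n`. -/
abbrev Bits (n : ℕ) : Type := Fin n → Bool

/-- `ν(k) = O(k^{-c})` for every `c`. -/
def Negligible (ν : ℕ → ℝ) : Prop :=
  SuperpolynomialDecay atTop (fun k : ℕ => (k : ℝ)) ν

/-- Uniform distribution on `{0,1}^k`. -/
def unif (k : ℕ) : PMF (Bits k) := PMF.uniformOfFintype (Bits k)

/-- A fair coin. -/
def coin : PMF Bool := PMF.uniformOfFintype Bool

/-- Probability, as a real number, that a random bit equals `true`. -/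
def pr (μ : PMF Bool) : ℝ := (μ true).toReal

/-- Self-delimiting unary code `1^i 0`. -/
def unary (i : ℕ) : List Bool := List.replicate i true ++ [false]

/-! ### Boolean circuits -/

/-- A Boolean circuit with `n` inputs and `m` outputs over the complete basis NAND, as a
straight-line program. The wires form a list, initially the inputs; each gate `(i, j)` puts the
NAND of wires `i` and `j` in front of it. So wires are numbered starting from the most recent one
at the moment they are referred to; a number beyond the existing wires denotes the constant 0. -/
structure Circuit (n m : ℕ) where
  gates : List (ℕ × ℕ)
  outs : Fin m → ℕ

/-- The list of all wire values after running the gates on the wire values `w`. -/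
def wires (gates : List (ℕ × ℕ)) (w : List Bool) : List Bool :=
  gates.foldl (fun v g => (!(v.getD g.1 false && v.getD g.2 false)) :: v) w

/-- The function computed by a circuit. -/
def Circuit.eval {n m : ℕ} (C : Circuit n m) (x : Bits n) : Bits m :=
  fun j => (wires C.gates (List.ofFn x)).getD (C.outs j) false

/-- The description of a circuit as a bit string. -/
def Circuit.encode {n m : ℕ} (C : Circuit n m) : List Bool :=
  unary n ++ C.gates.flatMap (fun g => true :: (unary g.1 ++ unary g.2)) ++ [false]
    ++ (List.ofFn C.outs).flatMap (fun o => true :: unary o) ++ [false]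

/-- The size `|C|`: the length of the description of `C`. -/
def Circuit.size {n m : ℕ} (C : Circuit n m) : ℕ := C.encode.length

/-! ### Probabilistic oracle machines with a step count

The machines are multi-stack machines: finitely many (those named in the program) registers, each
holding a stack of bits, with a structured control. Every instruction takes one step and touches
only the top of a stack, except for an oracle query, which replaces a register by the answer. -/

/-- Programs. A test looks at the top symbol of a register (`none` if the register is empty). -/
inductive Prog : Type
  | skip : Prog
  | push (r : ℕ) (b : Bool) : Prog
  | pop (r : ℕ) : Prog
  | flip (r : ℕ) : Prog
  | query (q a : ℕ) : Prog
  | seq (P Q : Prog) : Prog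
  | ite (r : ℕ) (t : Option Bool → Bool) (P Q : Prog) : Prog
  | loop (r : ℕ) (t : Option Bool → Bool) (P : Prog) : Prog

/-- The program never tosses a coin. -/
def Prog.CoinFree : Prog → Prop
  | .flip _ => False
  | .seq P Q => P.CoinFree ∧ Q.CoinFree
  | .ite _ _ P Q => P.CoinFree ∧ Q.CoinFree
  | .loop _ _ P => P.CoinFree
  | _ => True

/-- Contents of the registers. -/
abbrev Regs : Type := ℕ → List Bool

/-- A configuration: the programs still to be run, in order, and the registers. -/
abbrev Config : Type := List Prog × Regs

/-- One step, with oracle `g`. A configuration with nothing left to run has halted. -/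
def step (g : List Bool → List Bool) : Config → PMF Config
  | ([], σ) => PMF.pure ([], σ)
  | (.skip :: K, σ) => PMF.pure (K, σ)
  | (.push r b :: K, σ) => PMF.pure (K, Function.update σ r (b :: σ r))
  | (.pop r :: K, σ) => PMF.pure (K, Function.update σ r (σ r).tail)
  | (.flip r :: K, σ) => coin.map fun b => (K, Function.update σ r (b :: σ r))
  | (.query q a :: K, σ) => PMF.pure (K, Function.update σ a (g (σ q)))
  | (.seq P Q :: K, σ) => PMF.pure (P :: Q :: K, σ)
  | (.ite r t P Q :: K, σ) => PMF.pure ((if t (σ r).head? then P else Q) :: K, σ)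
  | (.loop r t P :: K, σ) =>
      PMF.pure (if t (σ r).head? then P :: .loop r t P :: K else K, σ)

/-- The distribution of the configuration after `T` steps of `P`, started with `ins` in registers
`0, 1, 2, …` and all other registers empty. -/
def runFor (g : List Bool → List Bool) (P : Prog) (ins : List (List Bool)) (T : ℕ) : PMF Config :=
  (fun μ : PMF Config => μ.bind (step g))^[T] (PMF.pure ([P], fun i => ins.getD i []))

/-- For every outcome of the coins, `P` halts on `ins` within `T` steps. -/
def HaltsWithin (g : List Bool → List Bool) (P : Prog) (ins : List (List Bool)) (T : ℕ) : Prop :=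
  ∀ c ∈ (runFor g P ins T).support, c.1 = []

/-- Total length of a list of inputs. -/
def totalLen (ins : List (List Bool)) : ℕ := (ins.map List.length).sum

/-- The oracle that answers every query with the empty string. -/
def noOracle : List Bool → List Bool := fun _ => []

/-- Access to a function `{0,1}^n → {0,1}^m` as an oracle; queries of a wrong length are answered
with the empty string. -/
def asOracle {n m : ℕ} (g : Bits n → Bits m) (q : List Bool) : List Bool :=
  if h : q.length = n then List.ofFn (g fun i => q.get (i.cast h.symm)) else []

/-- A (uniform) probabilistic polynomial-time algorithm with `a` inputs. -/
structure PPT (a : ℕ) where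
  prog : Prog
  time : Polynomial ℕ
  halts : ∀ ins : List (List Bool), ins.length = a →
    HaltsWithin noOracle prog ins (time.eval (totalLen ins))

/-- The output string is what register `0` holds in the end. -/
def PPT.run {a : ℕ} (M : PPT a) (ins : List (List Bool)) : PMF (List Bool) :=
  (runFor noOracle M.prog ins (M.time.eval (totalLen ins))).map fun c => c.2 0

/-- The output bit is the first symbol of the output string. -/
def PPT.runBit {a : ℕ} (M : PPT a) (ins : List (List Bool)) : PMF Bool :=
  (M.run ins).map fun o => o.headD false

/-- A non-uniform probabilistic polynomial-time oracle algorithm with `a` inputs. For security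
parameter `k` it receives `1^k`, an advice string of length polynomial in `k`, and its inputs, and
has oracle access to a function `{0,1}^{n(k)} → {0,1}^{m(k)}`. -/
structure OraclePPT (n m : ℕ → ℕ) (a : ℕ) where
  prog : Prog
  advice : ℕ → List Bool
  advice_poly : ∃ p : Polynomial ℕ, ∀ k, (advice k).length ≤ p.eval k
  time : Polynomial ℕ
  halts : ∀ (k : ℕ) (g : Bits (n k) → Bits (m k)) (ins : List (List Bool)), ins.length = a →
    HaltsWithin (asOracle g) prog (List.replicate k true :: advice k :: ins)
      (time.eval (k + totalLen ins))

/-- The output bit of a non-uniform algorithm: the first symbol of register `0` in the end. -/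
def OraclePPT.run {n m : ℕ → ℕ} {a : ℕ} (M : OraclePPT n m a) (k : ℕ)
    (g : Bits (n k) → Bits (m k)) (ins : List (List Bool)) : PMF Bool :=
  (runFor (asOracle g) M.prog (List.replicate k true :: M.advice k :: ins)
    (M.time.eval (k + totalLen ins))).map fun c => (c.2 0).headD false

/-- A non-uniform probabilistic polynomial-time algorithm without oracle (the only function
`{0,1}^0 → {0,1}^0` gives no information: every query is answered with the empty string). -/
abbrev NonuniformPPT (a : ℕ) : Type := OraclePPT (fun _ => 0) (fun _ => 0) a

/-- The output bit of a non-uniform algorithm without oracle. -/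
def NonuniformPPT.exec {a : ℕ} (M : NonuniformPPT a) (k : ℕ) (ins : List (List Bool)) : PMF Bool :=
  OraclePPT.run M k (fun z => z) ins

/-! ### NP relations, NP-completeness, witness encryption -/

/-- `f`, a function of `a` strings, is computable in deterministic polynomial time. -/
def PolyTimeComputable (a : ℕ) (f : List (List Bool) → List Bool) : Prop :=
  ∃ M : PPT a, M.prog.CoinFree ∧ ∀ ins, ins.length = a → M.run ins = PMF.pure (f ins)

/-- `R` is a witness relation of an NP language: witnesses have polynomial length and `R` is
decidable in polynomial time. The language is `{x | ∃ w, R x w}`. -/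
def IsNPRelation (R : List Bool → List Bool → Prop) : Prop :=
  (∃ p : Polynomial ℕ, ∀ x w, R x w → w.length ≤ p.eval x.length) ∧
  ∃ v : List (List Bool) → List Bool, PolyTimeComputable 2 v ∧
    ∀ x w, R x w ↔ v [x, w] = [true]

/-- Polynomial-time many-one reduction of the language of `R'` to the language of `R`, together
with a polynomial-time map of witnesses (Levin reduction). -/
def Reduces (R' R : List Bool → List Bool → Prop) : Prop :=
  ∃ f g : List (List Bool) → List Bool, PolyTimeComputable 1 f ∧ PolyTimeComputable 2 g ∧
    (∀ x, (∃ w, R' x w) ↔ ∃ w, R (f [x]) w) ∧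
    ∀ x w, R' x w → R (f [x]) (g [x, w])

/-- The language with witness relation `R` is NP-complete. -/
def NPComplete (R : List Bool → List Bool → Prop) : Prop :=
  IsNPRelation R ∧ ∀ R', IsNPRelation R' → Reduces R' R

/-- The distribution of `Enc_x(1^k, b)`. -/
def encrypt (Enc : PPT 3) (k : ℕ) (x : List Bool) (b : Bool) : PMF (List Bool) :=
  Enc.run [List.replicate k true, x, [b]]

/-- `(Enc, Dec)` is a witness encryption scheme for the language with witness relation `R`. The
negligible errors are uniform over all statements of length polynomial in `k`. -/
def IsWitnessEncryption (R : List Bool → List Bool → Prop) (Enc : PPT 3) (Dec : PPT 2) : Prop :=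
  (∀ q : Polynomial ℕ, ∃ ν, Negligible ν ∧ ∀ k x w b, R x w → x.length ≤ q.eval k →
    1 - ν k ≤ pr ((encrypt Enc k x b).bind fun c => (Dec.runBit [c, w]).map fun d => d == b)) ∧
  (∀ (A : NonuniformPPT 1) (q : Polynomial ℕ), ∃ ν, Negligible ν ∧
    ∀ k x, (¬ ∃ w, R x w) → x.length ≤ q.eval k →
      |pr ((encrypt Enc k x false).bind fun c => A.exec k [c]) -
        pr ((encrypt Enc k x true).bind fun c => A.exec k [c])| ≤ ν k)

/-! ### Circuit families and pseudo-entropy -/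

/-- A family of polynomial-size circuits `f_s`, `s ∈ {0,1}^k`, where `f_s` computes a function
`{0,1}^{inLen k} → {0,1}^{outLen k}`. -/
structure CircuitFamily where
  inLen : ℕ → ℕ
  outLen : ℕ → ℕ
  circ : ∀ k, Bits k → Circuit (inLen k) (outLen k)
  poly_size : ∃ p : Polynomial ℕ, ∀ k s, (circ k s).size ≤ p.eval k

/-- The function `f_s`. -/
def CircuitFamily.fn (F : CircuitFamily) (k : ℕ) (s : Bits k) :
    Bits (F.inLen k) → Bits (F.outLen k) := (F.circ k s).eval

/-- `g ∘ y`: the values of `g` on `I` are replaced by `y`. -/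
def patch {n m : ℕ} (g : Bits n → Bits m) (I : Finset (Bits n)) (y : I → Bits m) :
    Bits n → Bits m := fun x => if h : x ∈ I then y ⟨x, h⟩ else g x

/-- Non-uniform PPT algorithms with oracle access to members of `F`. -/
abbrev CircuitFamily.Alg (F : CircuitFamily) (a : ℕ) : Type := OraclePPT F.inLen F.outLen a

/-- `F` has pseudo-entropy at least `p` on the polynomial-size sets `I k` of inputs. -/
def CircuitFamily.HasPseudoEntropyOn (F : CircuitFamily) (I : ∀ k, Finset (Bits (F.inLen k)))
    (p : ℕ → ℕ) : Prop :=
  (∃ t : Polynomial ℕ, ∀ k, (I k).card ≤ t.eval k) ∧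
  ∃ Y : ∀ k, Bits k → PMF (I k → Bits (F.outLen k)),
    (∀ᶠ k in atTop, ∀ s y, (Y k s y).toReal ≤ (1 / 2 : ℝ) ^ p k) ∧
    ∀ D : F.Alg 0, Negligible fun k =>
      |pr ((unif k).bind fun s => D.run k (F.fn k s) []) -
        pr ((unif k).bind fun s => (Y k s).bind fun y => D.run k (patch (F.fn k s) (I k) y) [])|

/-- `F` has pseudo-entropy at least `p` for every polynomial `p`. -/
def CircuitFamily.SuperPolyPseudoEntropy (F : CircuitFamily) : Prop :=
  ∀ p : Polynomial ℕ, ∃ I, F.HasPseudoEntropyOn I fun k => p.eval k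

/-! ### Obfuscation -/

/-- A (not necessarily efficient) probabilistic map from circuits to circuits, which may also
depend on the security parameter. -/
abbrev CircuitFamily.Obf (F : CircuitFamily) : Type :=
  ∀ k, Circuit (F.inLen k) (F.outLen k) → PMF (Circuit (F.inLen k) (F.outLen k))

/-- Correctness and polynomial slowdown. -/
def CircuitFamily.IsCandidate (F : CircuitFamily) (Obf : F.Obf) : Prop :=
  (∀ k s, ∀ C ∈ (Obf k (F.circ k s)).support, ∀ x, C.eval x = F.fn k s x) ∧
  ∃ p : Polynomial ℕ, ∀ k s, ∀ C ∈ (Obf k (F.circ k s)).support,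
    C.size ≤ p.eval (F.circ k s).size

/-- `Pr[A(Obf(f_s), aux) = target]`, where `s` is uniform in `{0,1}^k` and the pair
`(aux, target)` is drawn from `Z s`. -/
def CircuitFamily.prAdv (F : CircuitFamily) (Obf : F.Obf) (A : NonuniformPPT 2) (k : ℕ)
    (Z : Bits k → PMF (List Bool × Bool)) : ℝ :=
  pr ((unif k).bind fun s => (Z s).bind fun z => (Obf k (F.circ k s)).bind fun C =>
    (A.exec k [C.encode, z.1]).map fun o => o == z.2)

/-- `Pr[S^{f_s}(aux) = target]`, where `s` is uniform in `{0,1}^k` and the pair `(aux, target)` is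
drawn from `Z s`. -/
def CircuitFamily.prSim (F : CircuitFamily) (S : F.Alg 1) (k : ℕ)
    (Z : Bits k → PMF (List Bool × Bool)) : ℝ :=
  pr ((unif k).bind fun s => (Z s).bind fun z =>
    (S.run k (F.fn k s) [z.1]).map fun o => o == z.2)

/-- `Obf` is an average-case VBB obfuscator of `F` with dependent auxiliary input. -/
def CircuitFamily.IsAvgVBBDepAux (F : CircuitFamily) (Obf : F.Obf) : Prop :=
  F.IsCandidate Obf ∧
  ∀ A : NonuniformPPT 2, ∃ S : F.Alg 1,
    ∀ (π : ∀ k, Bits k → List Bool → Bool) (aux : ∀ k, Bits k → List Bool),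
      (∃ p : Polynomial ℕ, ∀ k s, (aux k s).length ≤ p.eval k) →
      Negligible fun k =>
        |F.prAdv Obf A k (fun s => PMF.pure (aux k s, π k s (aux k s))) -
          F.prSim S k (fun s => PMF.pure (aux k s, π k s (aux k s)))|

/-- No non-uniform PPT algorithm with black-box access to `f_s`, `s` uniform, predicts `π(s)` with
probability noticeably above `δ` (for instance `δ = 1/2`). -/
def CircuitFamily.NotLearnable (F : CircuitFamily) (π : ∀ k, Bits k → Bool) (δ : ℕ → ℝ) : Prop :=
  ∀ S : F.Alg 0, ∃ ν, Negligible ν ∧ ∀ k,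
    pr ((unif k).bind fun s => (S.run k (F.fn k s) []).map fun o => o == π k s) ≤ δ k + ν k

/-! ### The statement "some small circuit has the given values" -/

/-- The string that describes the statement "some circuit of size at most `B` with `n` inputs and
`m` outputs maps `x` to `y` for every pair `(x, y)` in the list". -/
def encodeStmt (n m B : ℕ) (pts : List (Bits n × Bits m)) : List Bool :=
  unary n ++ unary m ++ unary B ++
    pts.flatMap (fun q => true :: (List.ofFn q.1 ++ List.ofFn q.2)) ++ [false]

/-- The witness relation of these statements: the witnesses are the circuits. -/
def SmallCircuitRel (x w : List Bool) : Prop :=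
  ∃ (n m B : ℕ) (pts : List (Bits n × Bits m)) (C : Circuit n m),
    x = encodeStmt n m B pts ∧ w = C.encode ∧ C.size ≤ B ∧ ∀ q ∈ pts, C.eval q.1 = q.2

/-- The statement "some circuit of size at most `B` agrees with `f_s` on `I`". -/
def CircuitFamily.stmt (F : CircuitFamily) (k B : ℕ) (I : Finset (Bits (F.inLen k))) (s : Bits k) :
    List Bool :=
  encodeStmt (F.inLen k) (F.outLen k) B (I.toList.map fun i => (i, F.fn k s i))

/-- Auxiliary input: an encryption, under this statement, of a random bit, which is the target. -/
def CircuitFamily.auxRandom (F : CircuitFamily) (Enc : PPT 3) (k B : ℕ)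
    (I : Finset (Bits (F.inLen k))) (s : Bits k) : PMF (List Bool × Bool) :=
  coin.bind fun b => (encrypt Enc k (F.stmt k B I s) b).map fun c => (c, b)

/-- Auxiliary input: an encryption, under this statement, of `π(s)`, which is the target. -/
def CircuitFamily.auxPred (F : CircuitFamily) (Enc : PPT 3) (k B : ℕ)
    (I : Finset (Bits (F.inLen k))) (π : Bits k → Bool) (s : Bits k) : PMF (List Bool × Bool) :=
  (encrypt Enc k (F.stmt k B I s) (π s)).map fun c => (c, π s)

end VBBObf

end

open VBBObf

/-!
The language of the statements "some circuit of size at most `B` maps `i` to `y i` for all `i ∈ I`"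
is in NP, because circuits can be evaluated in polynomial time (`isNPRelation_smallCircuitRel`).
Hence it reduces to the given NP-complete language, and witness encryption can be pulled back along a
Levin reduction (`IsWitnessEncryption.of_reduces`).

Let `x_s` be the statement for the function `f_s`. An obfuscated circuit for `f_s` is small and
agrees with `f_s`, so it is a witness for `x_s` and decrypts
(`CircuitFamily.exists_obfuscation_decryptor`). Now let `S` be an algorithm with oracle access to a
function `f`, and let `gain f` be its advantage in telling an encryption of `1` from one of `0`, both
under the statement for `f`. When the values of `f_s` on `I` are replaced by a random variable `Y` of
min-entropy at least `B + k`, the statement is false except with probability at most `2^(1 - k)`,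
since there are fewer than `2^(B + 1)` circuits of size at most `B`, and each of them determines the
values on `I` (`card_computable_le`). For false statements the advantage is negligible by the
security of the encryption (`CircuitFamily.gain_patch_le`); there the patched function is part of the
advice of the adversary, as a circuit with a table of exceptions. The oracle algorithm that runs `S`
twice on encryptions of random bits and accepts if both attempts succeed or both fail accepts with
probability `1 / 2 + gain ^ 2 / 2` (`pr_trial_eq_trial`). By pseudo-entropy, the mean of `gain ^ 2`
over the `f_s` is therefore close to the one over the patched functions, so it is negligible, and so
is the mean of `|gain|` (`CircuitFamily.negligible_gain`). The square takes care of the sign of the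
advantage, which matters for a predicate `π`: an algorithm `S` that gets an encryption of `π(s)`
predicts `π(s)` better than the learner that runs `S` on an encryption of `0` by at most the mean of
`|gain|` (`CircuitFamily.prSim_auxPred_le`).

With an average-case obfuscator a simulator would have to decrypt as well as the obfuscated circuit.
The auxiliary input and the predicate of the definition are functions of `s`, so the coins of the
encryption and the encrypted bit are first fixed by averaging
(`CircuitFamily.SuperPolyPseudoEntropy.not_isAvgVBBDepAux`).

All algorithms have to be programs for the machine model of the definitions. The predicate `RPT` says
that a randomized oracle function is computed by a program in polynomial time. It is closed under
composition (`RPT.bind`), under substituting a computable function for the oracle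
(`RPT.substOracle`), and under loops with a polynomial number of rounds (`RPT.while`), and it is
connected with the machines of the definitions by `PPT.rpt`, `RPT.exists_ppt`,
`OraclePPT.exists_rpt` and `RPT.exists_oraclePPT`.
-/
namespace VBBObf

/-! ### Running programs -/

/-- Bit strings. -/
abbrev Str : Type := List Bool

/-- Oracles. -/
abbrev Orc : Type := Str → Str

/-- The registers that hold the strings of a list, all others being empty. -/
def rg (l : List Str) : Regs := fun i => l.getD i []

theorem PMF_bind_congr {α β : Type*} {p : PMF α} {f g : α → PMF β}
    (h : ∀ a ∈ p.support, f a = g a) : p.bind f = p.bind g := by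
  ext b
  rw [PMF.bind_apply, PMF.bind_apply]
  refine tsum_congr fun a => ?_
  by_cases ha : a ∈ p.support
  · rw [h a ha]
  · rw [(p.apply_eq_zero_iff a).2 ha, zero_mul, zero_mul]

theorem PMF_map_congr {α β : Type*} {p : PMF α} {f g : α → β}
    (h : ∀ a ∈ p.support, f a = g a) : p.map f = p.map g :=
  PMF_bind_congr fun a ha => by simp [h a ha]

/-- The distribution of the configuration after `T` steps from `c`. -/
noncomputable def stepN (g : Orc) (T : ℕ) (c : Config) : PMF Config :=
  (fun μ : PMF Config => μ.bind (step g))^[T] (PMF.pure c)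

theorem iterate_bind_step (g : Orc) (T : ℕ) (μ : PMF Config) :
    (fun μ : PMF Config => μ.bind (step g))^[T] μ = μ.bind (stepN g T) := by
  induction T with
  | zero => exact (PMF.bind_pure μ).symm
  | succ T ih =>
    rw [Function.iterate_succ_apply', ih, PMF.bind_bind]
    congr 1; funext c
    simp only [stepN, Function.iterate_succ_apply']

theorem stepN_zero (g : Orc) (c : Config) : stepN g 0 c = PMF.pure c := rfl

theorem stepN_succ (g : Orc) (T : ℕ) (c : Config) :
    stepN g (T + 1) c = (step g c).bind (stepN g T) := by
  rw [stepN, Function.iterate_succ_apply, PMF.pure_bind, iterate_bind_step]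

/-- From the configuration `c`, all runs halt within `T` steps, and `μ` is the distribution of the
registers at that time. -/
def Den (g : Orc) (c : Config) (T : ℕ) (μ : PMF Regs) : Prop :=
  stepN g T c = μ.map fun σ => ([], σ)

theorem stepN_nil (g : Orc) (T : ℕ) (σ : Regs) : stepN g T ([], σ) = PMF.pure ([], σ) := by
  induction T with
  | zero => rfl
  | succ T ih => rw [stepN_succ]; simp [step, ih]

theorem Den.nil (g : Orc) (σ : Regs) (T : ℕ) : Den g ([], σ) T (PMF.pure σ) := by
  rw [Den, stepN_nil, PMF.pure_map]

theorem Den.map_snd {g : Orc} {c : Config} {T : ℕ} {μ : PMF Regs} (h : Den g c T μ) :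
    (stepN g T c).map Prod.snd = μ := by
  rw [h, PMF.map_comp]; exact PMF.map_id μ

theorem Den.unique {g : Orc} {c : Config} {T : ℕ} {μ ν : PMF Regs} (h : Den g c T μ)
    (h' : Den g c T ν) : μ = ν := by rw [← h.map_snd, ← h'.map_snd]

/-- The halting condition and the output distribution of a machine, as the definition of machines
speaks of them. -/
theorem den_iff {g : Orc} {c : Config} {T : ℕ} {μ : PMF Regs} :
    Den g c T μ ↔ (∀ c' ∈ (stepN g T c).support, c'.1 = []) ∧ (stepN g T c).map Prod.snd = μ := by
  constructor
  · intro h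
    refine ⟨fun c' hc' => ?_, h.map_snd⟩
    rw [h, PMF.mem_support_map_iff] at hc'
    obtain ⟨σ, -, rfl⟩ := hc'
    rfl
  · rintro ⟨h, rfl⟩
    rw [Den, PMF.map_comp]
    conv_lhs => rw [← PMF.map_id (stepN g T c)]
    refine PMF_map_congr fun c' hc' => ?_
    have := h c' hc'
    obtain ⟨a, b⟩ := c'
    simp only at this
    simp [this]

theorem Den.of_halts {g : Orc} {c : Config} {T : ℕ}
    (h : ∀ c' ∈ (stepN g T c).support, c'.1 = []) :
    Den g c T ((stepN g T c).map Prod.snd) := den_iff.2 ⟨h, rfl⟩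

theorem Den.step {g : Orc} {c : Config} {T : ℕ} {κ : Config → PMF Regs}
    (h : ∀ c' ∈ (step g c).support, Den g c' T (κ c')) :
    Den g c (T + 1) ((VBBObf.step g c).bind κ) := by
  rw [Den, stepN_succ, PMF.map_bind]
  exact PMF_bind_congr fun c' hc' => h c' hc'

theorem Den.of_step {g : Orc} {c : Config} {T : ℕ} {μ : PMF Regs} (h : Den g c (T + 1) μ) :
    (∀ c' ∈ (VBBObf.step g c).support, Den g c' T ((stepN g T c').map Prod.snd)) ∧
    μ = (VBBObf.step g c).bind fun c' => (stepN g T c').map Prod.snd := by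
  have h' := den_iff.1 h
  refine ⟨fun c' hc' => Den.of_halts fun c'' hc'' => h'.1 c'' ?_, ?_⟩
  · rw [stepN_succ, PMF.mem_support_bind_iff]
    exact ⟨c', hc', hc''⟩
  · rw [← h'.2, stepN_succ, PMF.map_bind]

theorem Den.nil_of_zero {g : Orc} {c : Config} {μ : PMF Regs} (h : Den g c 0 μ) : c.1 = [] :=
  (den_iff.1 h).1 c (by rw [stepN_zero]; simp)

theorem step_append (g : Orc) (P : Prog) (K K' : List Prog) (σ : Regs) :
    step g (P :: K ++ K', σ) = (step g (P :: K, σ)).map fun c => (c.1 ++ K', c.2) := by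
  cases P <;> simp [step, PMF.pure_map, PMF.map_comp, Function.comp_def]
  all_goals split_ifs <;> simp

/-- Sequential composition. -/
theorem Den.append {g : Orc} {L₁ L₂ : List Prog} {σ : Regs} {T₁ T₂ : ℕ} {μ : PMF Regs}
    {κ : Regs → PMF Regs} (h₁ : Den g (L₁, σ) T₁ μ)
    (h₂ : ∀ σ' ∈ μ.support, Den g (L₂, σ') T₂ (κ σ')) :
    Den g (L₁ ++ L₂, σ) (T₁ + T₂) (μ.bind κ) := by
  have base : ∀ (T : ℕ) (σ : Regs) (μ : PMF Regs), Den g ([], σ) T μ →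
      (∀ σ' ∈ μ.support, Den g (L₂, σ') T₂ (κ σ')) → Den g (L₂, σ) (T + T₂) (μ.bind κ) := by
    intro T σ μ h₁ h₂
    obtain rfl := h₁.unique (Den.nil g σ T)
    have := h₂ σ (by simp)
    rw [PMF.pure_bind]
    clear h₁ h₂
    induction T with
    | zero => simpa using this
    | succ T ih =>
      rw [Den, show T + 1 + T₂ = (T + T₂) + 1 by ring, stepN, Function.iterate_succ_apply',
        show (fun μ : PMF Config => μ.bind (VBBObf.step g))^[T + T₂] (PMF.pure (L₂, σ))
          = stepN g (T + T₂) (L₂, σ) from rfl, ih]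
      simp only [PMF.bind_map]
      refine PMF_bind_congr fun c _ => ?_
      simp [VBBObf.step]
  induction T₁ generalizing L₁ σ μ with
  | zero =>
    obtain rfl : L₁ = [] := h₁.nil_of_zero
    exact base 0 σ μ h₁ h₂
  | succ T ih =>
    cases L₁ with
    | nil => exact base _ σ μ h₁ h₂
    | cons P K =>
      obtain ⟨h, rfl⟩ := h₁.of_step
      rw [show T + 1 + T₂ = (T + T₂) + 1 by ring, Den, stepN_succ, step_append, PMF.bind_map,
        PMF.bind_bind, PMF.map_bind]
      refine PMF_bind_congr fun c hc => ?_
      refine ih (h c hc) fun σ' hσ' => h₂ σ' ?_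
      rw [PMF.mem_support_bind_iff]
      exact ⟨c, hc, hσ'⟩

theorem Den.mono {g : Orc} {c : Config} {T T' : ℕ} {μ : PMF Regs} (h : Den g c T μ)
    (hT : T ≤ T') : Den g c T' μ := by
  obtain ⟨k, rfl⟩ := Nat.exists_eq_add_of_le hT
  have := Den.append (L₂ := []) (κ := PMF.pure) (T₂ := k) h fun σ' _ => Den.nil g σ' k
  simpa using this

theorem Den.cons {g : Orc} {P : Prog} {K : List Prog} {σ : Regs} {T₁ T₂ : ℕ} {μ : PMF Regs}
    {κ : Regs → PMF Regs} (h₁ : Den g ([P], σ) T₁ μ)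
    (h₂ : ∀ σ' ∈ μ.support, Den g (K, σ') T₂ (κ σ')) :
    Den g (P :: K, σ) (T₁ + T₂) (μ.bind κ) := Den.append h₁ h₂

/-- A step that is determined. -/
theorem Den.head {g : Orc} {c c' : Config} {T : ℕ} {μ : PMF Regs}
    (hs : VBBObf.step g c = PMF.pure c') (h : Den g c' T μ) : Den g c (T + 1) μ := by
  have := Den.step (g := g) (c := c) (T := T) (κ := fun _ => μ) (by
    rw [hs]; intro c'' hc''; rw [PMF.support_pure, Set.mem_singleton_iff] at hc''; rwa [hc''])
  rwa [hs, PMF.pure_bind] at this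

theorem Den.seq {g : Orc} {P Q : Prog} {σ : Regs} {T₁ T₂ : ℕ} {μ : PMF Regs}
    {κ : Regs → PMF Regs} (h₁ : Den g ([P], σ) T₁ μ)
    (h₂ : ∀ σ' ∈ μ.support, Den g ([Q], σ') T₂ (κ σ')) :
    Den g ([.seq P Q], σ) (T₁ + T₂ + 1) (μ.bind κ) :=
  Den.head (c' := ([P, Q], σ)) rfl (Den.cons h₁ h₂)

/-- `P` always leads from `σ` to `σ'`, within `T` steps. -/
def Ex (g : Orc) (P : Prog) (σ : Regs) (T : ℕ) (σ' : Regs) : Prop :=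
  Den g ([P], σ) T (PMF.pure σ')

section Ex
variable {g : Orc} {P Q : Prog} {σ σ₁ σ₂ : Regs} {T T₁ T₂ : ℕ}

theorem Ex.mono (h : Ex g P σ T σ₁) (hT : T ≤ T₁) : Ex g P σ T₁ σ₁ := Den.mono h hT

theorem Ex.of_eq (h : Ex g P σ T σ₁) (hT : T ≤ T₁) (hσ : σ₁ = σ₂) : Ex g P σ T₁ σ₂ :=
  hσ ▸ h.mono hT

theorem Ex.skip : Ex g .skip σ 1 σ := Den.head rfl (Den.nil g _ 0)

theorem Ex.push (r : ℕ) (b : Bool) :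
    Ex g (.push r b) σ 1 (Function.update σ r (b :: σ r)) := Den.head rfl (Den.nil g _ 0)

theorem Ex.pop (r : ℕ) : Ex g (.pop r) σ 1 (Function.update σ r (σ r).tail) :=
  Den.head rfl (Den.nil g _ 0)

theorem Ex.query (q a : ℕ) : Ex g (.query q a) σ 1 (Function.update σ a (g (σ q))) :=
  Den.head rfl (Den.nil g _ 0)

/-- A deterministic program followed by a probabilistic one. -/
theorem Ex.seqDen {μ : PMF Regs} (h₁ : Ex g P σ T₁ σ₁) (h₂ : Den g ([Q], σ₁) T₂ μ) :
    Den g ([.seq P Q], σ) (T₁ + T₂ + 1) μ := by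
  have := Den.seq (κ := fun _ => μ) h₁ (T₂ := T₂) (Q := Q) (by
    intro σ' hσ'; rw [PMF.support_pure, Set.mem_singleton_iff] at hσ'; rwa [hσ'])
  rwa [PMF.pure_bind] at this

theorem Ex.seq (h₁ : Ex g P σ T₁ σ₁) (h₂ : Ex g Q σ₁ T₂ σ₂) :
    Ex g (.seq P Q) σ (T₁ + T₂ + 1) σ₂ := Ex.seqDen h₁ h₂

theorem Ex.ite {r : ℕ} {t : Option Bool → Bool}
    (h : Ex g (if t (σ r).head? then P else Q) σ T σ₁) : Ex g (.ite r t P Q) σ (T + 1) σ₁ :=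
  Den.head rfl h

theorem Ex.loop_stop {r : ℕ} {t : Option Bool → Bool} (h : t (σ r).head? = false) :
    Ex g (.loop r t P) σ 1 σ := by
  refine Den.head (c' := ([], σ)) ?_ (Den.nil g _ 0)
  simp [step, h]

theorem Ex.loop_next {r : ℕ} {t : Option Bool → Bool} (h : t (σ r).head? = true)
    (h₁ : Ex g P σ T₁ σ₁) (h₂ : Ex g (.loop r t P) σ₁ T₂ σ₂) :
    Ex g (.loop r t P) σ (T₁ + T₂ + 1) σ₂ := by
  refine Den.head (c' := ([P, .loop r t P], σ)) ?_ ?_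
  · simp [step, h]
  · have := Den.cons (κ := fun _ => PMF.pure σ₂) h₁ (T₂ := T₂) (K := [.loop r t P]) (by
      intro σ' hσ'; rw [PMF.support_pure, Set.mem_singleton_iff] at hσ'; rw [hσ']; exact h₂)
    rwa [PMF.pure_bind] at this

end Ex

/-! ### Straight-line programs on a list of registers -/

/-- No loops, coins or queries, and only registers below `N`. -/
def Prog.straight (N : ℕ) : Prog → Bool
  | .skip => true
  | .push r _ => r < N
  | .pop r => r < N
  | .flip _ => false
  | .query _ _ => false
  | .seq P Q => P.straight N && Q.straight N
  | .ite _ _ P Q => P.straight N && Q.straight N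
  | .loop _ _ _ => false

/-- The effect of a straight-line program on a list of registers. -/
def Prog.evL : Prog → List Str → List Str
  | .push r b, l => l.set r (b :: l.getD r [])
  | .pop r, l => l.set r (l.getD r []).tail
  | .seq P Q, l => Q.evL (P.evL l)
  | .ite r t P Q, l => if t (l.getD r []).head? then P.evL l else Q.evL l
  | _, l => l

/-- An upper bound for the number of steps of a straight-line program. -/
def Prog.cost : Prog → ℕ
  | .seq P Q => P.cost + Q.cost + 1
  | .ite _ _ P Q => P.cost + Q.cost + 1
  | _ => 1

theorem update_rg {l : List Str} {r : ℕ} (hr : r < l.length) (v : Str) :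
    Function.update (rg l) r v = rg (l.set r v) := by
  funext i
  by_cases h : i = r
  · subst h; simp [rg, hr]
  · simp [rg, Function.update_of_ne h, Ne.symm h]

/-- A straight-line program neither adds nor removes registers. -/
theorem Prog.evL_length (P : Prog) (l : List Str) : (P.evL l).length = l.length := by
  induction P generalizing l with
  | seq P Q hP hQ => simp [evL, hP, hQ]
  | ite r t P Q hP hQ => simp only [evL]; split_ifs <;> simp [hP, hQ]
  | _ => simp [evL]

theorem Ex.straight {g : Orc} (P : Prog) (l : List Str) (hP : P.straight l.length = true) :
    Ex g P (rg l) P.cost (rg (P.evL l)) := by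
  induction P generalizing l with
  | skip => exact Ex.skip
  | push r b =>
    rw [Prog.evL, ← update_rg (by simpa [Prog.straight] using hP)]
    exact Ex.push r b
  | pop r =>
    rw [Prog.evL, ← update_rg (by simpa [Prog.straight] using hP)]
    exact Ex.pop r
  | flip r => simp [Prog.straight] at hP
  | query r => simp [Prog.straight] at hP
  | loop r => simp [Prog.straight] at hP
  | seq P Q ihP ihQ =>
    simp only [Prog.straight, Bool.and_eq_true] at hP
    exact Ex.seq (ihP l hP.1) (ihQ _ (by rw [Prog.evL_length]; exact hP.2))
  | ite r t P Q ihP ihQ =>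
    simp only [Prog.straight, Bool.and_eq_true] at hP
    refine Ex.ite (T := P.cost + Q.cost) ?_
    simp only [Prog.evL]
    change Ex g (if t (l.getD r []).head? then P else Q) _ _ _
    split_ifs
    · exact (ihP l hP.1).mono (by omega)
    · exact (ihQ l hP.2).mono (by omega)

/-- A further round of a loop with a straight-line body. -/
theorem Ex.loop_straight {g : Orc} {P : Prog} {r : ℕ} {t : Option Bool → Bool} {l l' : List Str}
    {σ : Regs} {T : ℕ} (h : t (l.getD r []).head? = true)
    (hP : P.straight l.length = true) (hl : P.evL l = l')
    (h₂ : Ex g (.loop r t P) (rg l') T σ) :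
    Ex g (.loop r t P) (rg l) (T + (P.cost + 1)) σ := by
  subst hl
  exact (Ex.loop_next h (Ex.straight P l hP) h₂).mono (by omega)

/-! ### Clearing, moving and copying registers -/

/-- Empty the register `r`. -/
def clr (r : ℕ) : Prog := .loop r Option.isSome (.pop r)

/-- Move the contents of `a` to `b`, reversed. -/
def mv (a b : ℕ) : Prog :=
  .loop a Option.isSome
    (.seq (.ite a (fun o => o == some true) (.push b true) (.push b false)) (.pop a))

/-- Move the contents of `t` to `a` and to `b`, reversed. -/
def mv2 (t a b : ℕ) : Prog :=
  .loop t Option.isSome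
    (.seq (.ite t (fun o => o == some true) (.seq (.push a true) (.push b true))
      (.seq (.push a false) (.push b false))) (.pop t))

/-- Copy `a` to `b`, with the help of `t`. -/
def cp (a b t : ℕ) : Prog := .seq (mv a t) (mv2 t a b)

/-- Move `a` to `b`, overwriting `b`, with the help of `t`. -/
def xfer (a b t : ℕ) : Prog := .seq (clr b) (.seq (mv a t) (mv t b))

theorem ex_clr (g : Orc) (r : ℕ) (σ : Regs) :
    Ex g (clr r) σ (2 * (σ r).length + 1) (Function.update σ r []) := by
  generalize hs : σ r = s
  induction s generalizing σ with
  | nil =>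
    refine (Ex.loop_stop (by simp [hs])).of_eq (by simp) ?_
    rw [← hs, Function.update_eq_self]
  | cons b s ih =>
    refine (Ex.loop_next (by simp [hs]) (Ex.pop r) (ih _ (by simp [hs]))).of_eq
      (by simp; omega) (by simp)

theorem ex_mv (g : Orc) {a b : ℕ} (hab : a ≠ b) (σ : Regs) :
    Ex g (mv a b) σ (5 * (σ a).length + 1)
      (Function.update (Function.update σ b ((σ a).reverse ++ σ b)) a []) := by
  generalize hs : σ a = s
  induction s generalizing σ with
  | nil =>
    refine (Ex.loop_stop (by simp [hs])).of_eq (by simp) ?_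
    funext r
    by_cases h1 : r = a <;> by_cases h2 : r = b <;> simp_all
  | cons c s ih =>
    have h : Ex g (.seq (.ite a (fun o => o == some true) (.push b true) (.push b false)) (.pop a))
        σ 4 (Function.update (Function.update σ b (c :: σ b)) a s) := by
      refine (Ex.seq (Ex.ite (T := 1) (σ₁ := Function.update σ b (c :: σ b)) ?_)
        (Ex.pop a)).of_eq le_rfl ?_
      · rw [hs]
        cases c
        · exact Ex.push b false
        · exact Ex.push b true
      · simp [hab, hs]
    refine (Ex.loop_next (by simp [hs]) h (ih _ (by simp))).of_eq (by simp; omega) ?_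
    funext r
    by_cases h1 : r = a <;> by_cases h2 : r = b <;> simp_all

theorem ex_mv2 (g : Orc) {t a b : ℕ} (hta : t ≠ a) (htb : t ≠ b) (hab : a ≠ b) (σ : Regs) :
    Ex g (mv2 t a b) σ (7 * (σ t).length + 1)
      (Function.update (Function.update (Function.update σ a ((σ t).reverse ++ σ a))
        b ((σ t).reverse ++ σ b)) t []) := by
  generalize hs : σ t = s
  induction s generalizing σ with
  | nil =>
    refine (Ex.loop_stop (by simp [hs])).of_eq (by simp) ?_
    funext r
    by_cases h1 : r = t <;> by_cases h2 : r = a <;> by_cases h3 : r = b <;> simp_all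
  | cons c s ih =>
    have h : Ex g (.seq (.ite t (fun o => o == some true) (.seq (.push a true) (.push b true))
        (.seq (.push a false) (.push b false))) (.pop t))
        σ 6 (Function.update (Function.update (Function.update σ a (c :: σ a)) b (c :: σ b)) t s) := by
      refine (Ex.seq (Ex.ite (T := 3)
        (σ₁ := Function.update (Function.update σ a (c :: σ a)) b (c :: σ b)) ?_)
        (Ex.pop t)).of_eq le_rfl ?_
      · rw [hs]
        cases c
        · exact (Ex.seq (Ex.push a false) (Ex.push b false)).of_eq le_rfl
            (by simp [hab.symm])
        · exact (Ex.seq (Ex.push a true) (Ex.push b true)).of_eq le_rfl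
            (by simp [hab.symm])
      · simp [hta, htb, hs]
    refine (Ex.loop_next (by simp [hs]) h (ih _ (by simp))).of_eq (by simp; omega) ?_
    funext r
    by_cases h1 : r = t <;> by_cases h2 : r = a <;> by_cases h3 : r = b <;> simp_all

theorem ex_cp (g : Orc) {a b t : ℕ} (hta : t ≠ a) (htb : t ≠ b) (hab : a ≠ b) (σ : Regs)
    (ht : σ t = []) :
    Ex g (cp a b t) σ (12 * (σ a).length + 3) (Function.update σ b (σ a ++ σ b)) := by
  refine (Ex.seq (ex_mv g hta.symm σ) (ex_mv2 g hta htb hab _)).of_eq ?_ ?_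
  · simp [hta, ht]; omega
  · funext r
    by_cases h1 : r = t <;> by_cases h2 : r = a <;> by_cases h3 : r = b <;>
      simp_all

theorem ex_xfer (g : Orc) {a b t : ℕ} (hta : t ≠ a) (htb : t ≠ b) (hab : a ≠ b) (σ : Regs)
    (ht : σ t = []) :
    Ex g (xfer a b t) σ (2 * (σ b).length + 10 * (σ a).length + 5)
      (Function.update (Function.update σ b (σ a)) a []) := by
  refine (Ex.seq (ex_clr g b σ) (Ex.seq (ex_mv g hta.symm _) (ex_mv g htb _))).of_eq ?_ ?_
  · simp [hta, htb, ht, hab]; omega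
  · funext r
    by_cases h1 : r = t <;> by_cases h2 : r = a <;> by_cases h3 : r = b <;>
      simp_all

/-! ### Polynomial bounds -/

theorem eval_mono (p : Polynomial ℕ) {a b : ℕ} (h : a ≤ b) : p.eval a ≤ p.eval b := by
  induction p using Polynomial.induction_on' with
  | add p q hp hq => simpa using Nat.add_le_add hp hq
  | monomial n c => simpa using Nat.mul_le_mul_left c (Nat.pow_le_pow_left h n)

/-- `f` is bounded by a polynomial. -/
def PolyBdd (f : ℕ → ℕ) : Prop := ∃ p : Polynomial ℕ, ∀ n, f n ≤ p.eval n

theorem PolyBdd.const (c : ℕ) : PolyBdd fun _ => c := ⟨Polynomial.C c, by simp⟩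
theorem PolyBdd.id : PolyBdd fun n => n := ⟨Polynomial.X, by simp⟩
theorem PolyBdd.add {f h : ℕ → ℕ} (hf : PolyBdd f) (hh : PolyBdd h) :
    PolyBdd fun n => f n + h n := by
  obtain ⟨p, hp⟩ := hf; obtain ⟨q, hq⟩ := hh
  exact ⟨p + q, fun n => by simpa using Nat.add_le_add (hp n) (hq n)⟩
theorem PolyBdd.mul {f h : ℕ → ℕ} (hf : PolyBdd f) (hh : PolyBdd h) :
    PolyBdd fun n => f n * h n := by
  obtain ⟨p, hp⟩ := hf; obtain ⟨q, hq⟩ := hh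
  exact ⟨p * q, fun n => by simpa using Nat.mul_le_mul (hp n) (hq n)⟩
theorem PolyBdd.eval (p : Polynomial ℕ) {f : ℕ → ℕ} (hf : PolyBdd f) :
    PolyBdd fun n => p.eval (f n) := by
  obtain ⟨q, hq⟩ := hf
  exact ⟨p.comp q, fun n => by rw [Polynomial.eval_comp]; exact eval_mono p (hq n)⟩

/-! ### Renaming registers and answering queries by a program -/

/-- The program with registers renamed by `ρ` and the query instructions replaced by the programs
`H`. -/
def Prog.tr (ρ : ℕ → ℕ) (H : ℕ → ℕ → Prog) : Prog → Prog
  | .skip => .skip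
  | .push r b => .push (ρ r) b
  | .pop r => .pop (ρ r)
  | .flip r => .flip (ρ r)
  | .query q a => H q a
  | .seq P Q => .seq (P.tr ρ H) (Q.tr ρ H)
  | .ite r t P Q => .ite (ρ r) t (P.tr ρ H) (Q.tr ρ H)
  | .loop r t P => .loop (ρ r) t (P.tr ρ H)

theorem Den.step_map {g g' : Orc} {c c' : Config} {T : ℕ} {φ : Config → Config}
    {κ : Config → PMF Regs} (hs : VBBObf.step g' c' = (VBBObf.step g c).map φ)
    (h : ∀ d ∈ (VBBObf.step g c).support, Den g' (φ d) T (κ d)) :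
    Den g' c' (T + 1) ((VBBObf.step g c).bind κ) := by
  rw [Den, stepN_succ, hs, PMF.bind_map, PMF.map_bind]
  exact PMF_bind_congr fun d hd => h d hd

/-- A run of `P` with oracle `g` is simulated by a run of the translated program with oracle `g'`,
provided that the programs `H` compute the answers of `g`. The predicate `Inv T` holds of the
registers when at most `T` steps are left. -/
theorem Den.tr {g g' : Orc} {ρ : ℕ → ℕ} {H : ℕ → ℕ → Prog} {emb : Regs → Regs} {θ : ℕ}
    (hθ : 1 ≤ θ) (Inv : ℕ → Regs → Prop) (h_get : ∀ τ r, emb τ (ρ r) = τ r)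
    (h_upd : ∀ τ r v, emb (Function.update τ r v) = Function.update (emb τ) (ρ r) v)
    (h_inv : ∀ T c c', Inv (T + 1) c.2 → c' ∈ (VBBObf.step g c).support → Inv T c'.2)
    (h_q : ∀ T τ q a, Inv (T + 1) τ →
      Ex g' (H q a) (emb τ) θ (emb (Function.update τ a (g (τ q)))))
    (T : ℕ) (L : List Prog) (τ : Regs) (μ : PMF Regs) (hI : Inv T τ) (h : Den g (L, τ) T μ) :
    Den g' (L.map (Prog.tr ρ H), emb τ) (T * θ) (μ.map emb) := by
  induction T generalizing L τ μ with
  | zero =>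
    obtain rfl : L = [] := h.nil_of_zero
    obtain rfl := h.unique (Den.nil g τ 0)
    rw [PMF.pure_map]; exact Den.nil _ _ _
  | succ T ih =>
    cases L with
    | nil =>
      obtain rfl := h.unique (Den.nil g τ _)
      rw [PMF.pure_map]; exact Den.nil _ _ _
    | cons P K =>
      obtain ⟨h', rfl⟩ := h.of_step
      rw [PMF.map_bind]
      have main : ∀ d ∈ (VBBObf.step g (P :: K, τ)).support,
          Den g' (d.1.map (Prog.tr ρ H), emb d.2) (T * θ)
            (((stepN g T d).map Prod.snd).map emb) := fun d hd =>
        ih d.1 d.2 _ (h_inv T _ d hI hd) (h' d hd)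
      by_cases hQ : ∃ q a, P = .query q a
      · obtain ⟨q, a, rfl⟩ := hQ
        have hd := main (K, Function.update τ a (g (τ q))) (by simp [VBBObf.step])
        have := Den.cons (κ := fun _ => ((stepN g T (K, Function.update τ a (g (τ q)))).map
          Prod.snd).map emb) (h_q T τ q a hI) (T₂ := T * θ) (K := K.map (Prog.tr ρ H)) (by
            intro σ' hσ'
            rw [PMF.support_pure, Set.mem_singleton_iff] at hσ'
            rw [hσ']; exact hd)
        rw [PMF.pure_bind] at this
        simp only [VBBObf.step, PMF.pure_bind]
        exact this.mono (by rw [Nat.succ_mul]; omega)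
      · refine (Den.step_map (φ := fun d => (d.1.map (Prog.tr ρ H), emb d.2)) ?_ main).mono
          (by rw [Nat.succ_mul]; omega)
        cases P with
        | query q a => exact absurd ⟨q, a, rfl⟩ hQ
        | ite r t P Q =>
          simp only [VBBObf.step, Prog.tr, List.map_cons, h_get, PMF.pure_map]
          split_ifs <;> rfl
        | loop r t P =>
          simp only [VBBObf.step, Prog.tr, List.map_cons, h_get, PMF.pure_map]
          split_ifs <;> rfl
        | _ =>
          simp [VBBObf.step, Prog.tr, PMF.pure_map, PMF.map_comp, Function.comp_def, h_get, h_upd]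

theorem extend_update {ρ : ℕ → ℕ} (hρ : Function.Injective ρ) (τ σ : Regs) (r : ℕ) (v : Str) :
    Function.extend ρ (Function.update τ r v) σ = Function.update (Function.extend ρ τ σ) (ρ r) v := by
  funext i
  by_cases h : ∃ j, ρ j = i
  · obtain ⟨j, rfl⟩ := h
    rw [hρ.extend_apply]
    by_cases hj : j = r
    · subst hj; simp
    · rw [Function.update_of_ne hj, Function.update_of_ne (fun h => hj (hρ h)), hρ.extend_apply]
  · rw [Function.extend_apply' _ _ _ h, Function.update_of_ne (fun h' => h ⟨r, h'.symm⟩),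
      Function.extend_apply' _ _ _ h]

/-! ### Subroutine calls -/

/-- Copy the registers of a list to the registers `ρ i`, `ρ (i + 1)`, …. -/
def copyIn (ρ : ℕ → ℕ) (t : ℕ) : ℕ → List ℕ → Prog
  | _, [] => .skip
  | i, s :: l => .seq (cp s (ρ i) t) (copyIn ρ t (i + 1) l)

/-- Run `P` on copies of the registers `srcs`, in its own registers `ρ 0, ρ 1, …`, and move its
output to the register `dst`. -/
def call (ρ : ℕ → ℕ) (t : ℕ) (srcs : List ℕ) (dst : ℕ) (P : Prog) : Prog :=
  .seq (copyIn ρ t 0 srcs)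
    (.seq (P.tr ρ fun q a => .query (ρ q) (ρ a)) (xfer (ρ 0) dst t))

theorem rg_snoc (l : List Str) (v : Str) : Function.update (rg l) l.length v = rg (l ++ [v]) := by
  funext i
  rcases lt_trichotomy i l.length with h | rfl | h
  · simp [rg, Function.update_of_ne h.ne, h, List.getElem?_append_left h]
  · simp [rg]
  · simp [rg, Function.update_of_ne h.ne']
    rw [List.getElem?_eq_none (by omega), List.getElem?_eq_none (by simp; omega)]

theorem extend_rg_nil {ρ : ℕ → ℕ} (hρ : Function.Injective ρ) {σ : Regs} (h : ∀ i, σ (ρ i) = []) :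
    Function.extend ρ (rg []) σ = σ := by
  funext i
  by_cases hi : ∃ j, ρ j = i
  · obtain ⟨j, rfl⟩ := hi
    rw [hρ.extend_apply, h]; simp [rg]
  · rw [Function.extend_apply' _ _ _ hi]

theorem ex_copyIn (g : Orc) {ρ : ℕ → ℕ} (hρ : Function.Injective ρ) {t : ℕ} (ht : ∀ i, ρ i ≠ t)
    {σ : Regs} (hσt : σ t = []) {N : ℕ} (srcs : List ℕ)
    (hs : ∀ s ∈ srcs, s ≠ t ∧ (∀ i, ρ i ≠ s) ∧ (σ s).length ≤ N) (pre : List Str) :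
    Ex g (copyIn ρ t pre.length srcs) (Function.extend ρ (rg pre) σ)
      (srcs.length * (12 * N + 4) + 1) (Function.extend ρ (rg (pre ++ srcs.map σ)) σ) := by
  induction srcs generalizing pre with
  | nil => simpa [copyIn] using Ex.skip
  | cons s l ih =>
    obtain ⟨h1, h2, h3⟩ := hs s (by simp)
    have e : ∀ s, (∀ i, ρ i ≠ s) → Function.extend ρ (rg pre) σ s = σ s := fun s h =>
      Function.extend_apply' _ _ _ (by rintro ⟨j, hj⟩; exact h j hj)
    have hcp := ex_cp g (a := s) (b := ρ pre.length) (t := t) h1.symm (ht _).symm (h2 _).symm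
      (Function.extend ρ (rg pre) σ) (by rw [e t ht, hσt])
    rw [e s h2, hρ.extend_apply, ← extend_update hρ,
      show rg pre pre.length = [] by simp [rg], List.append_nil, rg_snoc] at hcp
    have := ih (fun s hs' => hs s (by simp [hs'])) (pre ++ [σ s])
    rw [List.length_append, List.length_singleton] at this
    refine (Ex.seq hcp this).of_eq ?_ (by simp)
    have : 12 * (σ s).length ≤ 12 * N := by omega
    simp only [List.length_cons, Nat.succ_mul]
    omega

/-- The effect of a subroutine call. -/
theorem den_call {g : Orc} {ρ : ℕ → ℕ} (hρ : Function.Injective ρ) {t : ℕ} (ht : ∀ i, ρ i ≠ t)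
    {σ : Regs} (hσt : σ t = []) (hσ : ∀ i, σ (ρ i) = []) {N T Y : ℕ} {srcs : List ℕ}
    (hs : ∀ s ∈ srcs, s ≠ t ∧ (∀ i, ρ i ≠ s) ∧ (σ s).length ≤ N) {dst : ℕ}
    (hdt : dst ≠ t) (hd : ∀ i, ρ i ≠ dst) {P : Prog} {κ : PMF Str}
    (hP : Den g ([P], rg (srcs.map σ)) T (κ.map fun y => rg [y]))
    (hY : ∀ y ∈ κ.support, y.length ≤ Y) :
    Den g ([call ρ t srcs dst P], σ)
      (srcs.length * (12 * N + 4) + T + 2 * (σ dst).length + 10 * Y + 8)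
      (κ.map fun y => Function.update σ dst y) := by
  have h1 := ex_copyIn g hρ ht hσt srcs hs []
  rw [extend_rg_nil hρ hσ, List.nil_append] at h1
  have h2 := Den.tr (g := g) (g' := g) (ρ := ρ) (H := fun q a => .query (ρ q) (ρ a))
    (emb := fun τ => Function.extend ρ τ σ) le_rfl (fun _ _ => True)
    (fun τ r => hρ.extend_apply _ _ _) (fun τ r v => extend_update hρ _ _ _ _)
    (fun _ _ _ _ _ => trivial) (fun _ τ q a _ => by
      have := Ex.query (g := g) (σ := Function.extend ρ τ σ) (ρ q) (ρ a)
      rwa [← extend_update hρ, hρ.extend_apply] at this) T [P] _ _ trivial hP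
  have h3 := Den.seq (T₂ := 2 * (σ dst).length + 10 * Y + 5) (Q := xfer (ρ 0) dst t)
    (κ := fun σ' => PMF.pure (Function.update (Function.update σ' dst (σ' (ρ 0))) (ρ 0) [])) h2 (by
      intro σ' hσ'
      rw [PMF.map_comp, PMF.mem_support_map_iff] at hσ'
      obtain ⟨y, hy, rfl⟩ := hσ'
      refine (ex_xfer g (ht 0).symm hdt.symm (hd 0) _ ?_).mono ?_
      · simp only [Function.comp]
        rw [Function.extend_apply' _ _ _ (by rintro ⟨j, hj⟩; exact ht j hj), hσt]
      · simp only [Function.comp]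
        rw [Function.extend_apply' _ _ _ (by rintro ⟨j, hj⟩; exact hd j hj), hρ.extend_apply]
        have := hY y hy
        simp [rg]; omega)
  have h4 := (Ex.seqDen h1 h3).mono (T' := srcs.length * (12 * N + 4) + T + 2 * (σ dst).length
    + 10 * Y + 8) (by omega)
  refine Eq.mp ?_ h4
  congr 1
  rw [PMF.map_comp, PMF.bind_map, PMF.map]
  refine PMF_bind_congr fun y _ => ?_
  simp only [Function.comp]
  congr 1
  rw [hρ.extend_apply]
  funext i
  by_cases h : ∃ j, ρ j = i
  · obtain ⟨j, rfl⟩ := h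
    rw [Function.update_of_ne (hd j) , hσ]
    by_cases hj : j = 0
    · simp [hj]
    · rw [Function.update_of_ne (fun h => hj (hρ h)), Function.update_of_ne (hd j),
        hρ.extend_apply]
      simp [rg, hj]
  · rw [Function.update_of_ne (fun h' => h ⟨0, h'.symm⟩)]
    by_cases hi : i = dst
    · subst hi; simp [rg]
    · rw [Function.update_of_ne hi, Function.update_of_ne hi, Function.extend_apply' _ _ _ h]

/-- Empty all registers of a list. -/
def clrs : List ℕ → Prog
  | [] => .skip
  | r :: l => .seq (clr r) (clrs l)

theorem ex_clrs (g : Orc) (l : List ℕ) (σ : Regs) {N : ℕ} (h : ∀ r ∈ l, (σ r).length ≤ N) :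
    Ex g (clrs l) σ (l.length * (2 * N + 2) + 1) (fun r => if r ∈ l then [] else σ r) := by
  induction l generalizing σ with
  | nil => simpa [clrs] using Ex.skip
  | cons r l ih =>
    have h1 := h r (by simp)
    refine (Ex.seq (ex_clr g r σ) (ih _ fun r' hr' => ?_)).of_eq ?_ ?_
    · by_cases hr : r' = r
      · simp [hr]
      · rw [Function.update_of_ne hr]; exact h r' (by simp [hr'])
    · simp only [List.length_cons, Nat.succ_mul]; omega
    · funext i
      by_cases hi : i = r
      · simp [hi]
      · simp [hi]

/-- Return from the main program: the register `src` holds the output, and the registers of `l`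
are emptied. -/
def finish (l : List ℕ) (src t : ℕ) : Prog := .seq (clrs l) (xfer src 0 t)

theorem ex_finish (g : Orc) {l : List ℕ} {src t : ℕ} {σ : Regs} {N : ℕ} (ht : σ t = [])
    (hts : t ≠ src) (ht0 : t ≠ 0) (hs0 : src ≠ 0) (hsl : src ∉ l) (h0 : 0 ∈ l)
    (hl : ∀ r ∈ l, (σ r).length ≤ N) (hσ : ∀ r, r ∉ l → r ≠ src → σ r = []) :
    Ex g (finish l src t) σ (l.length * (2 * N + 2) + 10 * (σ src).length + 7) (rg [σ src]) := by
  refine (Ex.seq (ex_clrs g l σ hl) (ex_xfer g hts ht0 hs0 _ ?_)).of_eq ?_ ?_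
  · simp [ht]
  · simp [h0, hsl]; omega
  · funext i
    by_cases hi : i = src
    · subst hi
      simp only [Function.update_self, rg]
      rw [List.getD_eq_default _ _ (by simp; omega)]
    · rw [Function.update_of_ne hi]
      rcases Nat.eq_zero_or_pos i with rfl | hi'
      · simp [rg, hsl]
      · rw [Function.update_of_ne hi'.ne']
        have : rg [σ src] i = [] := by
          simp only [rg]; rw [List.getD_eq_default _ _ (by simp; omega)]
        rw [this]
        by_cases hil : i ∈ l
        · simp [hil]
        · simp [hil, hσ i hil hi]

/-! ### Functions computed in polynomial time -/

/-- The randomized function `κ` of `a` strings, which may depend on an oracle, is computed in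
polynomial time by some program, for all oracles and inputs in `D`. In the end, all registers but
register `0`, which holds the output, are empty. -/
def RPT (a : ℕ) (D : Orc → List Str → Prop) (κ : Orc → List Str → PMF Str) : Prop :=
  ∃ (P : Prog) (p : Polynomial ℕ), ∀ g ins, ins.length = a → D g ins →
    Den g ([P], rg ins) (p.eval (totalLen ins)) ((κ g ins).map fun y => rg [y]) ∧
    ∀ y ∈ (κ g ins).support, y.length ≤ p.eval (totalLen ins)

theorem RPT.of_bdd {a : ℕ} {D : Orc → List Str → Prop} {κ : Orc → List Str → PMF Str} (P : Prog)
    {b : ℕ → ℕ} (hb : PolyBdd b)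
    (h : ∀ g ins, ins.length = a → D g ins →
      Den g ([P], rg ins) (b (totalLen ins)) ((κ g ins).map fun y => rg [y]) ∧
      ∀ y ∈ (κ g ins).support, y.length ≤ b (totalLen ins)) : RPT a D κ := by
  obtain ⟨p, hp⟩ := hb
  exact ⟨P, p, fun g ins ha hD => ⟨(h g ins ha hD).1.mono (hp _),
    fun y hy => ((h g ins ha hD).2 y hy).trans (hp _)⟩⟩

/-- The restriction of `κ` to a smaller domain. -/
theorem RPT.congr {a : ℕ} {D D' : Orc → List Str → Prop} {κ κ' : Orc → List Str → PMF Str}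
    (h : RPT a D κ) (h' : ∀ g ins, ins.length = a → D' g ins → D g ins ∧ κ g ins = κ' g ins) :
    RPT a D' κ' := by
  obtain ⟨P, p, hP⟩ := h
  refine ⟨P, p, fun g ins ha hD => ?_⟩
  obtain ⟨h1, h2⟩ := h' g ins ha hD
  rw [← h2]
  exact hP g ins ha h1

theorem le_totalLen {ins : List Str} {s : Str} (h : s ∈ ins) : s.length ≤ totalLen ins :=
  List.single_le_sum (by simp) _ (List.mem_map_of_mem h)

theorem getD_le_totalLen (ins : List Str) (j : ℕ) : (ins.getD j []).length ≤ totalLen ins := by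
  by_cases h : j < ins.length
  · rw [List.getD_eq_getElem _ _ h]; exact le_totalLen (List.getElem_mem h)
  · rw [List.getD_eq_default _ _ (by omega)]; simp

theorem totalLen_le {ins : List Str} {N : ℕ} (h : ∀ s ∈ ins, s.length ≤ N) :
    totalLen ins ≤ ins.length * N := by
  have := List.sum_le_card_nsmul (ins.map List.length) N (by simpa using h)
  simpa [totalLen] using this

@[simp] theorem totalLen_cons (s : Str) (ins : List Str) :
    totalLen (s :: ins) = s.length + totalLen ins := by simp [totalLen]

@[simp] theorem totalLen_nil : totalLen [] = 0 := rfl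

/-- The entries of `ins` with the indices `l`. -/
def sel (l : List ℕ) (ins : List Str) : List Str := l.map fun j => ins.getD j []

theorem totalLen_sel_le (l : List ℕ) (ins : List Str) :
    totalLen (sel l ins) ≤ l.length * totalLen ins := by
  refine (totalLen_le (N := totalLen ins) ?_).trans (by simp [sel])
  intro s hs
  simp only [sel, List.mem_map] at hs
  obtain ⟨j, -, rfl⟩ := hs
  exact getD_le_totalLen ins j

theorem mem_support_pure_iff' {α : Type*} {a b : α} : a ∈ (PMF.pure b).support ↔ a = b := by
  simp

/-- Composition: the output of `κ₁` on some of the inputs is added to the inputs of `κ₂`. -/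
theorem RPT.bindSel {a : ℕ} {D D₁ D₂ : Orc → List Str → Prop} {κ₁ κ₂ : Orc → List Str → PMF Str}
    (l₁ l₂ : List ℕ) (h₁ : RPT l₁.length D₁ κ₁) (h₂ : RPT l₂.length D₂ κ₂)
    (hl₁ : ∀ j ∈ l₁, j < a) (hl₂ : ∀ j ∈ l₂, j < a + 1)
    (hD₁ : ∀ g ins, ins.length = a → D g ins → D₁ g (sel l₁ ins))
    (hD₂ : ∀ g ins, ins.length = a → D g ins → ∀ y ∈ (κ₁ g (sel l₁ ins)).support,
      D₂ g (sel l₂ (y :: ins))) :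
    RPT a D fun g ins => (κ₁ g (sel l₁ ins)).bind fun y => κ₂ g (sel l₂ (y :: ins)) := by
  obtain ⟨P₁, p₁, hP₁⟩ := h₁
  obtain ⟨P₂, p₂, hP₂⟩ := h₂
  set ρ : ℕ → ℕ := fun i => a + 4 + i with hρd
  have hρ : Function.Injective ρ := fun i j h => by simp only [hρd] at h; omega
  set l₂' : List ℕ := l₂.map fun j => if j = 0 then a + 2 else j - 1 with hl₂'
  -- register `a + 1` is scratch, the two outputs go to `a + 2` and `a + 3`
  let y₁ : ℕ → ℕ := fun n => p₁.eval (l₁.length * n)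
  let y₂ : ℕ → ℕ := fun n => p₂.eval (l₂.length * (n + y₁ n))
  have hy₁ : PolyBdd y₁ := .eval _ (.mul (.const _) .id)
  have hy₂ : PolyBdd y₂ := .eval _ (.mul (.const _) (.add .id hy₁))
  let b₁ : ℕ → ℕ := fun n => l₁.length * (12 * n + 4) + y₁ n + 10 * y₁ n + 8
  let b₂ : ℕ → ℕ := fun n => l₂.length * (12 * (n + y₁ n) + 4) + y₂ n + 10 * y₂ n + 8
  let b₃ : ℕ → ℕ := fun n => (a + 2) * (2 * (n + y₁ n) + 2) + 1
  refine RPT.of_bdd (.seq (call ρ (a + 1) l₁ (a + 2) P₁) (.seq (call ρ (a + 1) l₂' (a + 3) P₂)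
    (finish ((a + 2) :: List.range (a + 1)) (a + 3) (a + 1))))
    (b := fun n => b₁ n + (b₂ n + (b₃ n + (10 * y₂ n + 7)) + 1) + 1) ?_ ?_
  · have hb₁ : PolyBdd b₁ := .add (.add (.add (.mul (.const _)
      (.add (.mul (.const _) .id) (.const _))) hy₁) (.mul (.const _) hy₁)) (.const _)
    have hb₂ : PolyBdd b₂ := .add (.add (.add (.mul (.const _)
      (.add (.mul (.const _) (.add .id hy₁)) (.const _))) hy₂) (.mul (.const _) hy₂)) (.const _)
    have hb₃ : PolyBdd b₃ := .add (.mul (.const _)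
      (.add (.mul (.const _) (.add .id hy₁)) (.const _))) (.const _)
    exact .add (.add hb₁ (.add (.add hb₂ (.add hb₃ (.add (.mul (.const _) hy₂) (.const _))))
      (.const _))) (.const _)
  · intro g ins ha hD
    set n := totalLen ins with hn
    have hout : ∀ i, a ≤ i → rg ins i = [] := fun i hi => by
      simp [rg, List.getElem?_eq_none (show ins.length ≤ i by omega)]
    obtain ⟨hd₁, hs₁⟩ := hP₁ g (sel l₁ ins) (by simp [sel]) (hD₁ g ins ha hD)
    have le₁ : p₁.eval (totalLen (sel l₁ ins)) ≤ y₁ n := eval_mono _ (totalLen_sel_le _ _)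
    have c₁ := den_call hρ (t := a + 1) (σ := rg ins) (fun i => by simp only [hρd]; omega)
      (hout _ (by omega)) (fun i => hout _ (by simp only [hρd]; omega)) (N := n) (srcs := l₁)
      (fun s hs => ⟨by have := hl₁ s hs; omega, fun i => by have := hl₁ s hs; simp only [hρd]; omega,
        getD_le_totalLen _ _⟩)
      (dst := a + 2) (by omega) (fun i => by simp only [hρd]; omega) (hd₁.mono le₁)
      (fun y hy => (hs₁ y hy).trans le₁)
    have key : ∀ y ∈ (κ₁ g (sel l₁ ins)).support,
        Den g ([.seq (call ρ (a + 1) l₂' (a + 3) P₂)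
          (finish ((a + 2) :: List.range (a + 1)) (a + 3) (a + 1))],
          Function.update (rg ins) (a + 2) y) (b₂ n + (b₃ n + (10 * y₂ n + 7)) + 1)
          ((κ₂ g (sel l₂ (y :: ins))).map fun z => rg [z]) ∧
        ∀ z ∈ (κ₂ g (sel l₂ (y :: ins))).support, z.length ≤ y₂ n := by
      intro y hy
      have hyl := (hs₁ y hy).trans le₁
      obtain ⟨hd₂, hs₂⟩ := hP₂ g (sel l₂ (y :: ins)) (by simp [sel]) (hD₂ g ins ha hD y hy)
      have le₂ : p₂.eval (totalLen (sel l₂ (y :: ins))) ≤ y₂ n := by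
        refine eval_mono _ ((totalLen_sel_le _ _).trans (Nat.mul_le_mul_left _ ?_))
        rw [totalLen_cons]; omega
      refine ⟨?_, fun z hz => (hs₂ z hz).trans le₂⟩
      have hsel : l₂'.map (Function.update (rg ins) (a + 2) y) = sel l₂ (y :: ins) := by
        rw [hl₂', sel, List.map_map]
        refine List.map_congr_left fun j hj => ?_
        have := hl₂ j hj
        rcases j with _ | j
        · simp
        · simp only [Function.comp, Nat.succ_ne_zero, if_false, Nat.add_sub_cancel]
          rw [Function.update_of_ne (by omega)]
          simp [rg]
      have hlen : ∀ r, (Function.update (rg ins) (a + 2) y r).length ≤ n + y₁ n := by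
        intro r
        by_cases hr : r = a + 2
        · subst hr; simp; omega
        · rw [Function.update_of_ne hr]; exact (getD_le_totalLen _ _).trans (Nat.le_add_right _ _)
      have c₂ := den_call hρ (t := a + 1) (σ := Function.update (rg ins) (a + 2) y)
        (fun i => by simp only [hρd]; omega)
        (by rw [Function.update_of_ne (by omega)]; exact hout _ (by omega))
        (fun i => by
          rw [Function.update_of_ne (by simp only [hρd]; omega)]
          exact hout _ (by simp only [hρd]; omega))
        (N := n + y₁ n) (srcs := l₂')
        (fun s hs => by
          rw [hl₂', List.mem_map] at hs
          obtain ⟨j, hj, rfl⟩ := hs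
          have := hl₂ j hj
          refine ⟨by split_ifs <;> omega, fun i => by simp only [hρd]; split_ifs <;> omega, hlen _⟩)
        (dst := a + 3) (by omega) (fun i => by simp only [hρd]; omega)
        (by rw [hsel]; exact hd₂.mono le₂)
        (fun y hy => (hs₂ y hy).trans le₂)
      have c₃ := Den.seq (c₂) (T₂ := b₃ n + (10 * y₂ n + 7))
        (Q := finish ((a + 2) :: List.range (a + 1)) (a + 3) (a + 1))
        (κ := fun σ => PMF.pure (rg [σ (a + 3)])) (by
          intro σ' hσ'
          rw [PMF.mem_support_map_iff] at hσ'
          obtain ⟨z, hz, rfl⟩ := hσ'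
          have hzl := (hs₂ z hz).trans le₂
          have hσ := ex_finish g (l := (a + 2) :: List.range (a + 1)) (src := a + 3) (t := a + 1)
            (σ := Function.update (Function.update (rg ins) (a + 2) y) (a + 3) z) (N := n + y₁ n)
            (by simp [hout]) (by omega) (by omega) (by omega) (by simp) (by simp)
            (fun r hr => by
              rw [Function.update_of_ne (by simp at hr; omega)]; exact hlen r)
            (fun r hr hr' => by
              simp at hr
              rw [Function.update_of_ne hr', Function.update_of_ne hr.1]
              exact hout r (by omega))
          refine hσ.of_eq ?_ (by simp)
          simp only [b₃, List.length_cons, List.length_range, Function.update_self]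
          linarith)
      have hb : Function.update (rg ins) (a + 2) y (a + 3) = [] := by
        rw [Function.update_of_ne (by omega)]; exact hout _ (by omega)
      refine Eq.mp ?_ (c₃.mono (T' := b₂ n + (b₃ n + (10 * y₂ n + 7)) + 1) ?_)
      · congr 1
        rw [PMF.bind_map, PMF.map]
        refine PMF_bind_congr fun z _ => ?_
        simp
      · rw [hb]
        have : l₂'.length = l₂.length := by simp [hl₂']
        rw [this]
        simp only [b₂, List.length_nil]; omega
    constructor
    · have c₄ := Den.seq c₁ (T₂ := b₂ n + (b₃ n + (10 * y₂ n + 7)) + 1)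
        (κ := fun σ => (κ₂ g (sel l₂ (σ (a + 2) :: ins))).map fun z => rg [z])
        (Q := .seq (call ρ (a + 1) l₂' (a + 3) P₂)
          (finish ((a + 2) :: List.range (a + 1)) (a + 3) (a + 1))) (by
        intro σ' hσ'
        rw [PMF.mem_support_map_iff] at hσ'
        obtain ⟨y, hy, rfl⟩ := hσ'
        simpa using (key y hy).1)
      refine Eq.mp ?_ (c₄.mono
        (T' := b₁ n + (b₂ n + (b₃ n + (10 * y₂ n + 7)) + 1) + 1) ?_)
      · congr 1
        rw [PMF.bind_map, PMF.map_bind]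
        refine PMF_bind_congr fun z _ => ?_
        simp
      · rw [hout (a + 2) (by omega)]
        simp only [b₁, List.length_nil]; omega
    · intro z hz
      rw [PMF.mem_support_bind_iff] at hz
      obtain ⟨y, hy, hz⟩ := hz
      have := (key y hy).2 z hz
      omega

/-- Replacing the oracle: if the oracle can be computed from one further input, the oracle queries
can be answered by a subroutine. -/
theorem RPT.substOracle {a : ℕ} {D Dh D' : Orc → List Str → Prop} {κ : Orc → List Str → PMF Str}
    {h : List Str → Str} (pb : Polynomial ℕ) (hκ : RPT a D κ)
    (hh : RPT 2 Dh fun _ ins => PMF.pure (h ins))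
    (hD : ∀ g adv ins, ins.length = a → D' g (adv :: ins) → D (fun q => h [adv, q]) ins ∧
      ∀ q, Dh g [adv, q] ∧ (h [adv, q]).length ≤ pb.eval (totalLen (adv :: ins))) :
    RPT (a + 1) D' fun _ ins => κ (fun q => h [ins.headD [], q]) ins.tail := by
  obtain ⟨P, p, hP⟩ := hκ
  obtain ⟨Q, ph, hQ⟩ := hh
  set ρ : ℕ → ℕ := fun i => a + 2 + 2 * i with hρd
  set ρ' : ℕ → ℕ := fun i => a + 3 + 2 * i with hρd'
  have hρ : Function.Injective ρ := fun i j h => by simp only [hρd] at h; omega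
  have hρ' : Function.Injective ρ' := fun i j h => by simp only [hρd'] at h; omega
  -- the registers of the main program are `ρ i`, those of the subroutine are `ρ' i`;
  -- `S n` bounds the lengths of all registers, `θ n` the time to answer a query
  let S : ℕ → ℕ := fun n => n + p.eval n + pb.eval n
  let θ : ℕ → ℕ := fun n => 2 * (12 * S n + 4) + ph.eval (2 * S n) + 2 * S n + 10 * S n + 8
  have hS : PolyBdd S := .add (.add .id (.eval _ .id)) (.eval _ .id)
  have hθ : PolyBdd θ := .add (.add (.add (.add (.mul (.const _) (.add (.mul (.const _) hS)
    (.const _))) (.eval _ (.mul (.const _) hS))) (.mul (.const _) hS)) (.mul (.const _) hS))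
    (.const _)
  refine RPT.of_bdd (.seq (copyIn ρ (a + 1) 0 ((List.range a).map (· + 1)))
    (.seq (P.tr ρ fun q x => call ρ' (a + 1) [0, ρ q] (ρ x) Q)
      (finish (List.range (a + 1)) (ρ 0) (a + 1))))
    (b := fun n => (a * (12 * n + 4) + 1) + (p.eval n * θ n +
      ((a + 1) * (2 * n + 2) + 10 * p.eval n + 7) + 1) + 1) ?_ ?_
  · exact .add (.add (.add (.mul (.const _) (.add (.mul (.const _) .id) (.const _))) (.const _))
      (.add (.add (.mul (.eval _ .id) hθ) (.add (.add (.mul (.const _) (.add (.mul (.const _) .id)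
      (.const _))) (.mul (.const _) (.eval _ .id))) (.const _))) (.const _))) (.const _)
  · intro g ins0 ha hD'
    obtain ⟨adv, ins, rfl⟩ : ∃ adv ins, ins0 = adv :: ins := by
      cases ins0 with
      | nil => simp at ha
      | cons x l => exact ⟨x, l, rfl⟩
    replace ha : ins.length = a := by simpa using ha
    obtain ⟨hDi, hq⟩ := hD g adv ins ha hD'
    set n := totalLen (adv :: ins) with hn
    have hnl : adv.length + totalLen ins = n := by rw [hn, totalLen_cons]
    simp only [List.headD_cons, List.tail_cons]
    set σ := rg (adv :: ins) with hσ
    obtain ⟨hden, hlen⟩ := hP (fun q => h [adv, q]) ins ha hDi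
    have hp : p.eval (totalLen ins) ≤ p.eval n := eval_mono _ (by omega)
    have hout : ∀ i, a + 1 ≤ i → σ i = [] := fun i hi => by
      rw [hσ, rg, List.getD_eq_default _ _ (by simp; omega)]
    have hσn : ∀ i, (σ i).length ≤ n := fun i => getD_le_totalLen _ _
    have c₁ := ex_copyIn g hρ (t := a + 1) (σ := σ) (fun i => by simp only [hρd]; omega)
      (hout _ (by omega)) (N := n) ((List.range a).map (· + 1)) (by
        intro s hs
        simp only [List.mem_map, List.mem_range] at hs
        obtain ⟨j, hj, rfl⟩ := hs
        exact ⟨by omega, fun i => by simp only [hρd]; omega, hσn _⟩) []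
    have hmap : ((List.range a).map (· + 1)).map σ = ins := by
      rw [List.map_map]
      refine List.ext_getElem (by simp [ha]) fun i h1 h2 => ?_
      simp [hσ, rg, h2]
    rw [hmap, extend_rg_nil hρ (fun i => hout _ (by simp only [hρd]; omega)), List.nil_append,
      List.length_map, List.length_range] at c₁
    have ext_low : ∀ τ i, i ≤ a + 1 → Function.extend ρ τ σ i = σ i := fun τ i hi =>
      Function.extend_apply' _ _ _ (by rintro ⟨j, hj⟩; simp only [hρd] at hj; omega)
    have c₂ := Den.tr (g := fun q => h [adv, q]) (g' := g) (ρ := ρ)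
      (H := fun q x => call ρ' (a + 1) [0, ρ q] (ρ x) Q)
      (emb := fun τ => Function.extend ρ τ σ) (θ := θ n) (by simp only [θ]; omega)
      (fun T τ => ∀ r, (τ r).length + T ≤ S n ∧ pb.eval n + T ≤ S n)
      (fun τ r => hρ.extend_apply _ _ _) (fun τ r v => extend_update hρ _ _ _ _)
      (by
        rintro T ⟨L, τ⟩ c' hI hc'
        have upd : ∀ (x : ℕ) (v : Str), v.length ≤ (τ x).length + 1 ∨ v.length ≤ pb.eval n →
            ∀ r, (Function.update τ x v r).length + T ≤ S n ∧ pb.eval n + T ≤ S n := by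
          intro x v hv r
          have h1 := hI x
          have h2 := hI r
          simp only at h1 h2
          by_cases hr : r = x
          · subst hr; rw [Function.update_self]; omega
          · rw [Function.update_of_ne hr]; omega
        have same : ∀ r, (τ r).length + T ≤ S n ∧ pb.eval n + T ≤ S n := fun r => by
          have := hI r; simp only at this; omega
        cases L with
        | nil =>
          simp only [VBBObf.step, mem_support_pure_iff'] at hc'
          subst hc'; exact same
        | cons P K =>
          cases P with
          | flip r =>
            simp only [VBBObf.step, PMF.mem_support_map_iff] at hc'
            obtain ⟨b, -, rfl⟩ := hc'
            exact upd _ _ (by simp)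
          | query q x =>
            simp only [VBBObf.step, mem_support_pure_iff'] at hc'
            subst hc'; exact upd _ _ (Or.inr (hq _).2)
          | push r b =>
            simp only [VBBObf.step, mem_support_pure_iff'] at hc'
            subst hc'; exact upd _ _ (by simp)
          | pop r =>
            simp only [VBBObf.step, mem_support_pure_iff'] at hc'
            subst hc'; exact upd _ _ (by simp; omega)
          | _ =>
            simp only [VBBObf.step, mem_support_pure_iff'] at hc'
            subst hc'; exact same)
      (by
        intro T τ q x hI
        have hE : ∀ i, Function.extend ρ τ σ (ρ i) = τ i := fun i => hρ.extend_apply _ _ _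
        have hcall := den_call (g := g) hρ' (t := a + 1) (σ := Function.extend ρ τ σ)
          (fun i => by simp only [hρd']; omega)
          (by rw [ext_low _ _ le_rfl]; exact hout _ le_rfl)
          (fun i => by
            rw [Function.extend_apply' _ _ _ (by
              rintro ⟨j, hj⟩; simp only [hρd, hρd'] at hj; omega)]
            exact hout _ (by simp only [hρd']; omega))
          (N := S n) (srcs := [0, ρ q]) (by
            intro s hs
            simp only [List.mem_cons, List.not_mem_nil, or_false] at hs
            rcases hs with rfl | rfl
            · refine ⟨by omega, fun i => by simp only [hρd']; omega, ?_⟩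
              rw [ext_low _ _ (by omega)]
              have := hσn 0
              simp only [S]; omega
            · refine ⟨by simp only [hρd]; omega, fun i => by simp only [hρd, hρd']; omega, ?_⟩
              rw [hE]; have := hI q; omega)
          (dst := ρ x) (by simp only [hρd]; omega) (fun i => by simp only [hρd, hρd']; omega)
          (P := Q) (κ := PMF.pure (h [adv, τ q])) (T := ph.eval (2 * S n)) (Y := S n) (by
            have e : [0, ρ q].map (Function.extend ρ τ σ) = [adv, τ q] := by
              simp only [List.map_cons, List.map_nil, hE]
              rw [ext_low _ _ (by omega)]; simp [hσ, rg]
            rw [e]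
            refine (hQ g [adv, τ q] rfl (hq _).1).1.mono (eval_mono _ ?_)
            have h1 := hI q
            have h2 : adv.length ≤ S n := by simp only [S]; omega
            simp; omega)
          (by
            intro y hy
            rw [mem_support_pure_iff'] at hy
            subst hy
            refine (hq _).2.trans ?_
            simp only [S]; omega)
        rw [hE, PMF.pure_map] at hcall
        rw [extend_update hρ]
        refine Ex.mono hcall ?_
        have h1 := hI x
        simp only [θ, List.length_cons, List.length_nil]
        omega)
      (p.eval n) [P] (rg ins) _ (by
        intro r
        have := getD_le_totalLen ins r
        simp only [S, rg]
        omega) (hden.mono hp)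
    have c₃ := Den.seq c₂ (T₂ := (a + 1) * (2 * n + 2) + 10 * p.eval n + 7)
      (Q := finish (List.range (a + 1)) (ρ 0) (a + 1))
      (κ := fun σ' => PMF.pure (rg [σ' (ρ 0)])) (by
        intro σ' hσ'
        rw [PMF.map_comp, PMF.mem_support_map_iff] at hσ'
        obtain ⟨y, hy, rfl⟩ := hσ'
        simp only [Function.comp]
        refine (ex_finish g (N := n) ?_ ?_ ?_ ?_ ?_ ?_ ?_ ?_).mono ?_
        · rw [ext_low _ _ le_rfl]; exact hout _ le_rfl
        · simp only [hρd]; omega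
        · omega
        · simp only [hρd]; omega
        · simp [hρd]
        · simp
        · intro r hr
          rw [ext_low _ _ (by simp at hr; omega)]; exact hσn _
        · intro r hr hr'
          by_cases hj : ∃ j, ρ j = r
          · obtain ⟨j, rfl⟩ := hj
            rw [hρ.extend_apply]
            have : j ≠ 0 := by rintro rfl; exact hr' rfl
            rw [rg, List.getD_eq_default _ _ (by simp; omega)]
          · rw [Function.extend_apply' _ _ _ hj]
            exact hout _ (by simpa using hr)
        · rw [hρ.extend_apply, List.length_range]
          have := (hlen y hy).trans hp
          simp [rg]; omega)
    constructor
    · refine Eq.mp ?_ (Ex.seqDen c₁ c₃)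
      congr 1
      rw [PMF.map_comp, PMF.bind_map, PMF.map]
      refine PMF_bind_congr fun y _ => ?_
      simp [Function.comp, hρ.extend_apply, rg]
    · intro y hy
      have := (hlen y hy).trans hp
      omega

/-- A while loop with state in the first input: while the test `c` yields `true`, the body `f` is
applied to the state. The invariant `Inv`, which holds of the states and may depend on the inputs,
bounds their lengths, and the measure `m` bounds the number of rounds. -/
theorem RPT.while {a : ℕ} {D Df Dc : Orc → List Str → Prop} {f c res : Orc → List Str → Str}
    (pb : Polynomial ℕ) (hf : RPT (a + 1) Df fun g ins => PMF.pure (f g ins))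
    (hc : RPT (a + 1) Dc fun g ins => PMF.pure (c g ins))
    (h : ∀ g s e, e.length = a → D g (s :: e) → ∃ (Inv : Str → Prop) (m : Str → ℕ), Inv s ∧
      (∀ s', Inv s' → s'.length ≤ pb.eval (totalLen (s :: e)) ∧
        m s' ≤ pb.eval (totalLen (s :: e)) ∧ Dc g (s' :: e)) ∧
      (∀ s', Inv s' → (c g (s' :: e)).head? = some true → Df g (s' :: e) ∧ Inv (f g (s' :: e)) ∧
        m (f g (s' :: e)) < m s' ∧ res g (f g (s' :: e) :: e) = res g (s' :: e)) ∧
      ∀ s', Inv s' → (c g (s' :: e)).head? ≠ some true → res g (s' :: e) = s') :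
    RPT (a + 1) D fun g ins => PMF.pure (res g ins) := by
  obtain ⟨P, p, hP⟩ := hf
  obtain ⟨Q, pc, hQ⟩ := hc
  set ρ : ℕ → ℕ := fun i => a + 3 + i with hρd
  have hρ : Function.Injective ρ := fun i j h => by simp only [hρd] at h; omega
  -- `N n` bounds the total length of state and inputs, `F n` and `C n` the time of a call
  let N : ℕ → ℕ := fun n => n + pb.eval n
  let F : ℕ → ℕ := fun n => (a + 1) * (12 * N n + 4) + p.eval (N n) + 2 * N n + 10 * p.eval (N n) + 8
  let C : ℕ → ℕ := fun n => (a + 1) * (12 * N n + 4) + pc.eval (N n) + 2 * pc.eval (N n) +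
    10 * pc.eval (N n) + 8
  have hN : PolyBdd N := .add .id (.eval _ .id)
  have hF : PolyBdd F := .add (.add (.add (.add (.mul (.const _) (.add (.mul (.const _) hN)
    (.const _))) (.eval _ hN)) (.mul (.const _) hN)) (.mul (.const _) (.eval _ hN))) (.const _)
  have hC : PolyBdd C := .add (.add (.add (.add (.mul (.const _) (.add (.mul (.const _) hN)
    (.const _))) (.eval _ hN)) (.mul (.const _) (.eval _ hN))) (.mul (.const _) (.eval _ hN)))
    (.const _)
  -- register `a + 2` holds the outcome of the test, which is computed anew at the end of each round
  let body : Prog := .seq (call ρ (a + 1) (List.range (a + 1)) 0 P)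
    (call ρ (a + 1) (List.range (a + 1)) (a + 2) Q)
  let W : Prog := .loop (a + 2) (fun o => o == some true) body
  let E : ℕ → ℕ := fun n => (a + 1) * (2 * (N n + pc.eval (N n)) + 2) + 1
  refine RPT.of_bdd (.seq (call ρ (a + 1) (List.range (a + 1)) (a + 2) Q)
    (.seq W (clrs ((List.range (a + 1)).map fun j => if j = a then a + 2 else j + 1))))
    (b := fun n => C n + ((pb.eval n * (F n + C n + 2) + 1) + E n + 1) + 1) ?_ ?_
  · exact .add (.add hC (.add (.add (.add (.mul (.eval _ .id) (.add (.add hF hC) (.const _)))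
      (.const _)) (.add (.mul (.const _) (.add (.mul (.const _) (.add hN (.eval _ hN))) (.const _)))
      (.const _))) (.const _))) (.const _)
  · intro g ins0 ha hD
    obtain ⟨s, e, rfl⟩ : ∃ s e, ins0 = s :: e := by
      cases ins0 with
      | nil => simp at ha
      | cons x l => exact ⟨x, l, rfl⟩
    replace ha : e.length = a := by simpa using ha
    obtain ⟨Inv, m, hI, hB, hstep, hend⟩ := h g s e ha hD
    set n := totalLen (s :: e) with hn
    have hne : totalLen e ≤ n := by rw [hn, totalLen_cons]; omega
    -- the registers between two calls: state, inputs, and the outcome `v` of the test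
    let st : Str → Str → Regs := fun s' v => Function.update (rg (s' :: e)) (a + 2) v
    have st_hi : ∀ s' v i, a + 1 ≤ i → i ≠ a + 2 → st s' v i = [] := fun s' v i hi hi' => by
      simp only [st]; rw [Function.update_of_ne hi', rg, List.getD_eq_default _ _ (by simp; omega)]
    have st_map : ∀ s' v, (List.range (a + 1)).map (st s' v) = s' :: e := fun s' v => by
      refine List.ext_getElem (by simp [ha]) fun i h1 h2 => ?_
      have : i < a + 1 := by simpa using h1
      simp only [List.getElem_map, List.getElem_range, st]
      rw [Function.update_of_ne (by omega), rg, List.getD_eq_getElem _ _ h2]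
    have st_len : ∀ s' v, Inv s' → ∀ j, j ≠ a + 2 → (st s' v j).length ≤ N n := fun s' v hs' j hj => by
      simp only [st]; rw [Function.update_of_ne hj]
      refine (getD_le_totalLen _ _).trans ?_
      have := (hB s' hs').1
      simp only [totalLen_cons, N]; omega
    have tot : ∀ s', Inv s' → totalLen (s' :: e) ≤ N n := fun s' hs' => by
      have := (hB s' hs').1
      simp only [totalLen_cons, N]; omega
    have hsrc : ∀ s' v, Inv s' → ∀ j ∈ List.range (a + 1), j ≠ a + 1 ∧ (∀ i, ρ i ≠ j) ∧
        (st s' v j).length ≤ N n := fun s' v hs' j hj => by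
      rw [List.mem_range] at hj
      exact ⟨by omega, fun i => by simp only [hρd]; omega, st_len s' v hs' j (by omega)⟩
    have callQ : ∀ s' v, Inv s' → v.length ≤ pc.eval (N n) →
        Ex g (call ρ (a + 1) (List.range (a + 1)) (a + 2) Q) (st s' v) (C n)
          (st s' (c g (s' :: e))) ∧ (c g (s' :: e)).length ≤ pc.eval (N n) := by
      intro s' v hs' hv
      obtain ⟨h1, h2⟩ := hQ g (s' :: e) (by simp [ha]) (hB s' hs').2.2
      have h3 : pc.eval (totalLen (s' :: e)) ≤ pc.eval (N n) := eval_mono _ (tot s' hs')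
      have hl := (h2 (c g (s' :: e)) (by simp)).trans h3
      refine ⟨?_, hl⟩
      have := den_call (g := g) hρ (t := a + 1) (σ := st s' v) (fun i => by simp only [hρd]; omega)
        (st_hi _ _ _ le_rfl (by omega))
        (fun i => st_hi _ _ _ (by simp only [hρd]; omega) (by simp only [hρd]; omega))
        (hsrc s' v hs') (dst := a + 2) (by omega) (fun i => by simp only [hρd]; omega)
        (by rw [st_map]; exact h1.mono h3) (Y := pc.eval (N n)) (by
          intro y hy; rw [mem_support_pure_iff'] at hy; rwa [hy])
      rw [PMF.pure_map] at this
      refine Ex.of_eq this ?_ (by simp [st])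
      simp only [st, Function.update_self, C, List.length_range]; omega
    have callP : ∀ s' v, Inv s' → Df g (s' :: e) →
        Ex g (call ρ (a + 1) (List.range (a + 1)) 0 P) (st s' v) (F n) (st (f g (s' :: e)) v) := by
      intro s' v hs' hd
      obtain ⟨h1, h2⟩ := hP g (s' :: e) (by simp [ha]) hd
      have h3 : p.eval (totalLen (s' :: e)) ≤ p.eval (N n) := eval_mono _ (tot s' hs')
      have hl := (h2 (f g (s' :: e)) (by simp)).trans h3
      have := den_call (g := g) hρ (t := a + 1) (σ := st s' v) (fun i => by simp only [hρd]; omega)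
        (st_hi _ _ _ le_rfl (by omega))
        (fun i => st_hi _ _ _ (by simp only [hρd]; omega) (by simp only [hρd]; omega))
        (hsrc s' v hs') (dst := 0) (by omega) (fun i => by simp only [hρd]; omega)
        (by rw [st_map]; exact h1.mono h3) (Y := p.eval (N n)) (by
          intro y hy; rw [mem_support_pure_iff'] at hy; rwa [hy])
      rw [PMF.pure_map] at this
      refine Ex.of_eq this ?_ ?_
      · have := st_len s' v hs' 0 (by omega)
        simp only [F, List.length_range]; omega
      · simp only [st]
        rw [Function.update_comm (by omega), update_rg (by simp)]; rfl
    have loop : ∀ k s', m s' ≤ k → Inv s' → ∃ s'' v, Inv s'' ∧ v.length ≤ pc.eval (N n) ∧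
        s'' = res g (s' :: e) ∧
        Ex g W (st s' (c g (s' :: e))) (k * (F n + C n + 2) + 1) (st s'' v) := by
      intro k
      induction k with
      | zero =>
        intro s' hm hs'
        have hno : (c g (s' :: e)).head? ≠ some true := fun ht => by
          have := (hstep s' hs' ht).2.2.1; omega
        refine ⟨s', _, hs', (callQ s' [] hs' (by simp)).2, (hend s' hs' hno).symm,
          (Ex.loop_stop ?_).mono (by omega)⟩
        simpa [st] using hno
      | succ k ih =>
        intro s' hm hs'
        by_cases ht : (c g (s' :: e)).head? = some true
        · obtain ⟨h1, h2, h3, h4⟩ := hstep s' hs' ht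
          obtain ⟨s'', v, hi, hv, hr, hx⟩ := ih _ (by omega) h2
          refine ⟨s'', v, hi, hv, by rw [hr, h4], ?_⟩
          have hl := (callQ s' [] hs' (by simp)).2
          refine (Ex.loop_next ?_ (Ex.seq (callP s' _ hs' h1) (callQ _ _ h2 hl).1) hx).mono ?_
          · simpa [st] using ht
          · rw [Nat.succ_mul]; omega
        · refine ⟨s', _, hs', (callQ s' [] hs' (by simp)).2, (hend s' hs' ht).symm,
            (Ex.loop_stop ?_).mono (by omega)⟩
          simpa [st] using ht
    obtain ⟨s'', v, hi, hv, hr, hx⟩ := loop (pb.eval n) s (hB s hI).2.1 hI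
    have hcl := ex_clrs g ((List.range (a + 1)).map fun j => if j = a then a + 2 else j + 1)
      (st s'' v) (N := N n + pc.eval (N n)) (by
        intro r hr
        by_cases hr2 : r = a + 2
        · subst hr2; simp only [st, Function.update_self]; omega
        · exact (st_len s'' v hi r hr2).trans (by omega))
    have hst : st s [] = rg (s :: e) := by
      simp only [st]
      have : rg (s :: e) (a + 2) = [] := by rw [rg, List.getD_eq_default _ _ (by simp; omega)]
      rw [← this, Function.update_eq_self]
    have all := Ex.seq (callQ s [] hI (by simp)).1 (Ex.seq hx hcl)
    rw [hst] at all
    constructor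
    · rw [PMF.pure_map]
      refine Ex.of_eq all ?_ ?_
      · simp only [List.length_map, List.length_range, E]; omega
      · rw [← hr]
        funext i
        have hmem : i ∈ ((List.range (a + 1)).map fun j => if j = a then a + 2 else j + 1) ↔
            (1 ≤ i ∧ i ≤ a) ∨ i = a + 2 := by
          simp only [List.mem_map, List.mem_range]
          constructor
          · rintro ⟨j, hj, rfl⟩; split_ifs <;> omega
          · rintro (h | h)
            · exact ⟨i - 1, by omega, by split_ifs <;> omega⟩
            · exact ⟨a, by omega, by simp [h]⟩
        rcases Nat.eq_zero_or_pos i with rfl | hi0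
        · rw [if_neg (by rw [hmem]; omega)]
          simp [st, rg]
        · have : rg [s''] i = [] := by rw [rg, List.getD_eq_default _ _ (by simp; omega)]
          rw [this]
          split_ifs with hm
          · rfl
          · rw [hmem] at hm
            exact st_hi _ _ _ (by omega) (by omega)
    · intro y hy
      rw [mem_support_pure_iff'] at hy
      subst hy
      rw [← hr]
      have := (hB s'' hi).1
      have h2 : pb.eval n ≤ pb.eval n * (F n + C n + 2) := Nat.le_mul_of_pos_right _ (by omega)
      omega

/-! ### Between machines and functions computed in polynomial time -/

/-- All registers that `P` mentions are below `N`. -/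
def Prog.within (N : ℕ) : Prog → Prop
  | .skip => True
  | .push r _ => r < N
  | .pop r => r < N
  | .flip r => r < N
  | .query q a => q < N ∧ a < N
  | .seq P Q => P.within N ∧ Q.within N
  | .ite _ _ P Q => P.within N ∧ Q.within N
  | .loop _ _ P => P.within N

theorem Prog.within_mono {N M : ℕ} (h : N ≤ M) (P : Prog) (hP : P.within N) : P.within M := by
  induction P with
  | query q a => exact ⟨hP.1.trans_le h, hP.2.trans_le h⟩
  | seq P Q ihP ihQ => exact ⟨ihP hP.1, ihQ hP.2⟩
  | ite r t P Q ihP ihQ => exact ⟨ihP hP.1, ihQ hP.2⟩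
  | loop r t P ih => exact ih hP
  | skip => trivial
  | _ => exact lt_of_lt_of_le hP h

theorem Prog.exists_within (P : Prog) : ∃ N, P.within N := by
  induction P with
  | skip => exact ⟨0, trivial⟩
  | push r b => exact ⟨r + 1, Nat.lt_succ_self r⟩
  | pop r => exact ⟨r + 1, Nat.lt_succ_self r⟩
  | flip r => exact ⟨r + 1, Nat.lt_succ_self r⟩
  | query q a => exact ⟨q + a + 1, by simp only [within]; omega⟩
  | seq P Q ihP ihQ =>
    obtain ⟨N, hN⟩ := ihP
    obtain ⟨M, hM⟩ := ihQ
    exact ⟨N + M, P.within_mono (by omega) hN, Q.within_mono (by omega) hM⟩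
  | ite r t P Q ihP ihQ =>
    obtain ⟨N, hN⟩ := ihP
    obtain ⟨M, hM⟩ := ihQ
    exact ⟨N + M, P.within_mono (by omega) hN, Q.within_mono (by omega) hM⟩
  | loop r t P ih => exact ih

/-- Within `T` steps, the registers that the program does not mention remain empty, and the others
grow by at most `T`, or are replaced by answers of the oracle. -/
theorem growth {g : Orc} {N B : ℕ} (hB : ∀ q, (g q).length ≤ B) (T : ℕ) (c : Config) (S : ℕ)
    (hL : ∀ P ∈ c.1, P.within N) (hN : ∀ r, N ≤ r → c.2 r = [])
    (hS : ∀ r, (c.2 r).length ≤ S + B) :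
    ∀ c' ∈ (stepN g T c).support, (∀ r, N ≤ r → c'.2 r = []) ∧
      ∀ r, (c'.2 r).length ≤ S + B + T := by
  induction T generalizing c S with
  | zero =>
    intro c' hc'
    rw [stepN_zero, mem_support_pure_iff'] at hc'
    subst hc'; exact ⟨hN, hS⟩
  | succ T ih =>
    intro c' hc'
    rw [stepN_succ, PMF.mem_support_bind_iff] at hc'
    obtain ⟨d, hd, hc'⟩ := hc'
    have key : (∀ P ∈ d.1, P.within N) ∧ (∀ r, N ≤ r → d.2 r = []) ∧
        ∀ r, (d.2 r).length ≤ S + 1 + B := by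
      obtain ⟨L, σ⟩ := c
      simp only at hL hN hS
      have upd : ∀ x v, x < N → v.length ≤ S + 1 + B → (∀ r, N ≤ r → Function.update σ x v r = []) ∧
          ∀ r, (Function.update σ x v r).length ≤ S + 1 + B := by
        intro x v hx hv
        refine ⟨fun r hr => ?_, fun r => ?_⟩
        · rw [Function.update_of_ne (by omega)]; exact hN r hr
        · by_cases hr : r = x
          · subst hr; rwa [Function.update_self]
          · rw [Function.update_of_ne hr]; have := hS r; omega
      have same : (∀ r, N ≤ r → σ r = []) ∧ ∀ r, (σ r).length ≤ S + 1 + B :=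
        ⟨hN, fun r => by have := hS r; omega⟩
      cases L with
      | nil =>
        simp only [step, mem_support_pure_iff'] at hd
        subst hd; exact ⟨by simp, same⟩
      | cons P K =>
        have hP := hL P (by simp)
        have hK : ∀ P ∈ K, P.within N := fun P hP => hL P (by simp [hP])
        cases P with
        | skip =>
          simp only [step, mem_support_pure_iff'] at hd
          subst hd; exact ⟨hK, same⟩
        | push r b =>
          simp only [step, mem_support_pure_iff'] at hd
          subst hd; exact ⟨hK, upd _ _ hP (by have := hS r; simp; omega)⟩
        | pop r =>
          simp only [step, mem_support_pure_iff'] at hd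
          subst hd; exact ⟨hK, upd _ _ hP (by have := hS r; simp; omega)⟩
        | flip r =>
          simp only [step, PMF.mem_support_map_iff] at hd
          obtain ⟨b, -, rfl⟩ := hd
          exact ⟨hK, upd _ _ hP (by have := hS r; simp; omega)⟩
        | query q a =>
          simp only [step, mem_support_pure_iff'] at hd
          subst hd; exact ⟨hK, upd _ _ hP.2 (by have := hB (σ q); omega)⟩
        | seq P Q =>
          simp only [step, mem_support_pure_iff'] at hd
          subst hd; refine ⟨?_, same⟩
          simp only [List.mem_cons, forall_eq_or_imp]
          exact ⟨hP.1, hP.2, hK⟩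
        | ite r t P Q =>
          simp only [step, mem_support_pure_iff'] at hd
          subst hd; refine ⟨?_, same⟩
          simp only [List.mem_cons, forall_eq_or_imp]
          refine ⟨?_, hK⟩
          split_ifs
          · exact hP.1
          · exact hP.2
        | loop r t P =>
          simp only [step, mem_support_pure_iff'] at hd
          subst hd; refine ⟨?_, same⟩
          simp only
          split_ifs
          · simp only [List.mem_cons, forall_eq_or_imp]
            exact ⟨hP, hP, hK⟩
          · exact hK
    have := ih d (S + 1) key.1 key.2.1 key.2.2 c' hc'
    exact ⟨this.1, fun r => by have := this.2 r; omega⟩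

/-- The output of a program with a polynomial time bound is computed in polynomial time, provided
that the answers of the oracle have polynomial length. -/
theorem RPT.of_prog {a : ℕ} {D : Orc → List Str → Prop} (P : Prog) (p pb : Polynomial ℕ)
    (hP : ∀ g ins, ins.length = a → D g ins →
      HaltsWithin g P ins (p.eval (totalLen ins)) ∧ ∀ q, (g q).length ≤ pb.eval (totalLen ins)) :
    RPT a D fun g ins => (runFor g P ins (p.eval (totalLen ins))).map fun c => c.2 0 := by
  obtain ⟨N, hN⟩ := P.exists_within
  let b : ℕ → ℕ := fun n => n + pb.eval n + p.eval n
  have hb : PolyBdd b := .add (.add .id (.eval _ .id)) (.eval _ .id)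
  refine RPT.of_bdd (.seq P (clrs ((List.range (N + a)).map (· + 1))))
    (b := fun n => b n + ((N + a) * (2 * b n + 2) + 1) + 1)
    (.add (.add hb (.add (.mul (.const _) (.add (.mul (.const _) hb) (.const _))) (.const _)))
      (.const _)) ?_
  intro g ins ha hD
  obtain ⟨hh, hg⟩ := hP g ins ha hD
  have h0 : ∀ r, (rg ins r).length ≤ totalLen ins := getD_le_totalLen ins
  generalize totalLen ins = n at *
  have hden : Den g ([P], rg ins) (b n) ((runFor g P ins (p.eval n)).map Prod.snd) :=
    (Den.of_halts hh).mono (by simp only [b]; omega)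
  have gr := growth hg (p.eval n) ([P], rg ins) n (N := N + a)
    (by simpa using P.within_mono (by omega) hN)
    (fun r hr => by simp only [rg]; rw [List.getD_eq_default _ _ (by omega)])
    (fun r => (h0 r).trans (Nat.le_add_right _ _))
  constructor
  · have := Den.seq hden (T₂ := (N + a) * (2 * b n + 2) + 1)
      (Q := clrs ((List.range (N + a)).map (· + 1))) (κ := fun σ => PMF.pure (rg [σ 0])) (by
        intro σ hσ
        rw [PMF.mem_support_map_iff] at hσ
        obtain ⟨c, hc, rfl⟩ := hσ
        obtain ⟨h1, h2⟩ := gr c hc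
        refine (ex_clrs g _ c.2 (N := b n) fun r _ => (h2 r)).of_eq (by simp) ?_
        funext i
        rcases Nat.eq_zero_or_pos i with rfl | hi
        · simp [rg]
        · have : rg [c.2 0] i = [] := by rw [rg, List.getD_eq_default _ _ (by simp; omega)]
          rw [this]
          split_ifs with hm
          · rfl
          · refine h1 i ?_
            simp only [List.mem_map, List.mem_range, not_exists, not_and] at hm
            by_contra hlt
            exact hm (i - 1) (by omega) (by omega))
    refine Eq.mp ?_ this
    congr 1
    rw [PMF.bind_map, PMF.map_comp]
    rfl
  · intro y hy
    rw [PMF.mem_support_map_iff] at hy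
    obtain ⟨c, hc, rfl⟩ := hy
    have := (gr c hc).2 0
    simp only [b]; omega

/-- Deterministic functions computed in polynomial time without oracle. -/
def PF (a : ℕ) (f : List Str → Str) : Prop :=
  RPT a (fun _ _ => True) fun _ ins => PMF.pure (f ins)

theorem PF.of_ex {a : ℕ} {f : List Str → Str} (P : Prog) {b : ℕ → ℕ} (hb : PolyBdd b)
    (h : ∀ g ins, ins.length = a → Ex g P (rg ins) (b (totalLen ins)) (rg [f ins]) ∧
      (f ins).length ≤ b (totalLen ins)) : PF a f :=
  RPT.of_bdd P hb fun g ins ha _ => ⟨by rw [PMF.pure_map]; exact (h g ins ha).1, fun y hy => by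
    rw [mem_support_pure_iff'] at hy
    subst hy; exact (h g ins ha).2⟩

theorem PF.nil (a : ℕ) : PF a fun _ => [] := by
  refine PF.of_ex (clrs (List.range a)) (b := fun n => a * (2 * n + 2) + 1)
    (.add (.mul (.const _) (.add (.mul (.const _) .id) (.const _))) (.const _)) fun g ins ha => ?_
  refine ⟨(ex_clrs g _ _ (N := totalLen ins) fun r _ => getD_le_totalLen _ _).of_eq (by simp) ?_,
    by simp⟩
  funext i
  have : rg [[]] i = [] := by cases i <;> rfl
  rw [this]
  split_ifs with hi
  · rfl
  · rw [List.getD_eq_default _ _ (by simp at hi; omega)]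

theorem sel_range {ins : List Str} {a : ℕ} (h : ins.length = a) : sel (List.range a) ins = ins := by
  refine List.ext_getElem (by simp [sel, h]) fun i h1 h2 => ?_
  simp [sel, h2]

theorem sel_range_succ {ins : List Str} {a : ℕ} (h : ins.length = a) (y : Str) :
    sel ((List.range a).map (· + 1)) (y :: ins) = ins := by
  refine List.ext_getElem (by simp [sel, h]) fun i h1 h2 => ?_
  simp [sel, h2]

/-- The output of a uniform algorithm. Its queries, which get empty answers, are replaced by a
subroutine that returns the empty string, so that it can be used next to any oracle. -/
theorem PPT.rpt {a : ℕ} (M : PPT a) : RPT a (fun _ _ => True) fun _ ins => M.run ins := by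
  have h₁ : RPT a (fun g _ => g = noOracle) fun g ins =>
      (runFor g M.prog ins (M.time.eval (totalLen ins))).map fun c => c.2 0 :=
    RPT.of_prog M.prog M.time 0 (by
      rintro g ins ha rfl
      exact ⟨M.halts ins ha, by simp [noOracle]⟩)
  have h₂ := RPT.substOracle (D' := fun _ _ => True) 0 h₁ (PF.nil 2)
    (fun g adv ins _ _ => ⟨rfl, fun q => ⟨trivial, by simp⟩⟩)
  have h₃ := RPT.bindSel (a := a) (D := fun _ _ => True) [] (List.range (a + 1)) (PF.nil 0)
    (by rw [List.length_range]; exact h₂) (by simp) (by simp) (by simp) (by simp)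
  refine h₃.congr fun g ins ha _ => ⟨trivial, ?_⟩
  rw [PMF.pure_bind, sel_range (by simp [ha])]
  rfl

/-- What is computed in polynomial time is the output of a uniform algorithm. -/
theorem RPT.exists_ppt {a : ℕ} {D : Orc → List Str → Prop} {κ : Orc → List Str → PMF Str}
    (h : RPT a D κ) (hD : ∀ ins, ins.length = a → D noOracle ins) :
    ∃ M : PPT a, ∀ ins, ins.length = a → M.run ins = κ noOracle ins := by
  obtain ⟨P, p, hP⟩ := h
  refine ⟨⟨P, p, fun ins ha => (den_iff.1 (hP _ ins ha (hD ins ha)).1).1⟩, fun ins ha => ?_⟩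
  have := (hP _ ins ha (hD ins ha)).1
  change (stepN noOracle _ ([P], rg ins)).map _ = _
  rw [this, PMF.map_comp, PMF.map_comp]
  exact PMF.map_id _

/-- Replace coin tosses by the constant `0`. -/
def Prog.derandomize : Prog → Prog
  | .flip r => .push r false
  | .seq P Q => .seq P.derandomize Q.derandomize
  | .ite r t P Q => .ite r t P.derandomize Q.derandomize
  | .loop r t P => .loop r t P.derandomize
  | P => P

theorem Prog.derandomize_coinFree (P : Prog) : P.derandomize.CoinFree := by
  induction P with
  | seq P Q hP hQ => exact ⟨hP, hQ⟩
  | ite r t P Q hP hQ => exact ⟨hP, hQ⟩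
  | loop r t P hP => exact hP
  | _ => trivial

/-- The run of the derandomized program is one of the possible runs of the program. -/
theorem stepN_derandomize (g : Orc) (T : ℕ) (c : Config) : ∃ d ∈ (stepN g T c).support,
    stepN g T (c.1.map Prog.derandomize, c.2) = PMF.pure (d.1.map Prog.derandomize, d.2) := by
  induction T generalizing c with
  | zero => exact ⟨c, by simp [stepN_zero], rfl⟩
  | succ T ih =>
    have : ∃ d ∈ (step g c).support,
        step g (c.1.map Prog.derandomize, c.2) = PMF.pure (d.1.map Prog.derandomize, d.2) := by
      obtain ⟨L, σ⟩ := c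
      cases L with
      | nil => exact ⟨([], σ), by simp [step], rfl⟩
      | cons P K =>
        cases P with
        | flip r =>
          refine ⟨(K, Function.update σ r (false :: σ r)), ?_, rfl⟩
          simp only [step, PMF.mem_support_map_iff]
          exact ⟨false, by simp [coin], rfl⟩
        | ite r t P Q =>
          refine ⟨_, (mem_support_pure_iff' (b := _)).2 rfl, ?_⟩
          simp only [List.map_cons, Prog.derandomize, step]
          split_ifs <;> rfl
        | loop r t P =>
          refine ⟨_, (mem_support_pure_iff' (b := _)).2 rfl, ?_⟩
          simp only [List.map_cons, Prog.derandomize, step]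
          split_ifs <;> rfl
        | _ => exact ⟨_, (mem_support_pure_iff' (b := _)).2 rfl, rfl⟩
    obtain ⟨d, hd, h1⟩ := this
    obtain ⟨e, he, h2⟩ := ih d
    refine ⟨e, ?_, ?_⟩
    · rw [stepN_succ, PMF.mem_support_bind_iff]; exact ⟨d, hd, he⟩
    · rw [stepN_succ, h1, PMF.pure_bind, h2]

/-- The value of a function does not depend on coins, so that they can be fixed. -/
theorem PF.polyTimeComputable {a : ℕ} {f : List Str → Str} (h : PF a f) :
    PolyTimeComputable a f := by
  obtain ⟨P, p, hP⟩ := h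
  have key : ∀ ins, ins.length = a →
      Den noOracle ([P.derandomize], rg ins) (p.eval (totalLen ins)) (PMF.pure (rg [f ins])) := by
    intro ins ha
    obtain ⟨d, hd, h1⟩ := stepN_derandomize noOracle (p.eval (totalLen ins)) ([P], rg ins)
    have := (hP noOracle ins ha trivial).1
    rw [this, PMF.pure_map, PMF.pure_map, mem_support_pure_iff'] at hd
    subst hd
    rw [Den, PMF.pure_map]
    exact h1
  refine ⟨⟨P.derandomize, p, fun ins ha => (den_iff.1 (key ins ha)).1⟩,
    P.derandomize_coinFree, fun ins ha => ?_⟩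
  change (stepN noOracle _ ([P.derandomize], rg ins)).map _ = _
  rw [key ins ha, PMF.pure_map, PMF.pure_map]
  rfl

theorem PolyTimeComputable.pf {a : ℕ} {f : List Str → Str} (h : PolyTimeComputable a f) :
    PF a f := by
  obtain ⟨M, -, hM⟩ := h
  exact M.rpt.congr fun g ins ha _ => ⟨trivial, hM ins ha⟩

theorem asOracle_length {n m : ℕ} (g : Bits n → Bits m) (q : Str) : (asOracle g q).length ≤ m := by
  unfold asOracle; split_ifs <;> simp

/-- After all runs have halted, further steps have no effect. -/
theorem HaltsWithin.run_eq {g : Orc} {P : Prog} {ins : List Str} {T T' : ℕ}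
    (h : HaltsWithin g P ins T) (hT : T ≤ T') : runFor g P ins T' = runFor g P ins T := by
  have h1 := Den.of_halts h
  have h2 := h1.mono hT
  exact h2.trans h1.symm

/-- The inputs of an oracle algorithm with advice `adv`, together with its oracle. -/
def AdvDom {n m : ℕ → ℕ} (adv : ℕ → Str) (a : ℕ) (g : Orc) (ins : List Str) : Prop :=
  ∃ (k : ℕ) (g' : Bits (n k) → Bits (m k)) (ins' : List Str), ins'.length = a ∧ g = asOracle g' ∧
    ins = List.replicate k true :: adv k :: ins'

/-- A non-uniform oracle algorithm as a randomized function of `1^k`, the advice and the inputs. The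
bound for `m` keeps the answers of the oracle short. -/
theorem OraclePPT.exists_rpt {n m : ℕ → ℕ} {a : ℕ} (hm : ∃ p : Polynomial ℕ, ∀ k, m k ≤ p.eval k)
    (M : OraclePPT n m a) : ∃ κ : Orc → List Str → PMF Str,
      RPT (a + 2) (AdvDom (n := n) (m := m) M.advice a) κ ∧
      ∀ k (g : Bits (n k) → Bits (m k)) ins, ins.length = a →
        (κ (asOracle g) (List.replicate k true :: M.advice k :: ins)).map (fun o => o.headD false) =
          M.run k g ins := by
  obtain ⟨p, hp⟩ := hm
  have hT : ∀ k ins, M.time.eval (k + totalLen ins) ≤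
      M.time.eval (totalLen (List.replicate k true :: M.advice k :: ins)) := fun k ins =>
    eval_mono _ (by simp)
  refine ⟨_, RPT.of_prog M.prog M.time p ?_, ?_⟩
  · rintro g ins ha ⟨k, g', ins', ha', rfl, rfl⟩
    refine ⟨?_, fun q => (asOracle_length g' q).trans ((hp k).trans (eval_mono _ (by simp)))⟩
    rw [HaltsWithin, (M.halts k g' ins' ha').run_eq (hT k ins')]
    exact M.halts k g' ins' ha'
  · intro k g ins ha
    rw [(M.halts k g ins ha).run_eq (hT k ins), PMF.map_comp]
    rfl

/-- What is computed in polynomial time, given `1^k` and an advice string, is the output of a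
non-uniform oracle algorithm. -/
theorem RPT.exists_oraclePPT {n m : ℕ → ℕ} {a : ℕ} {D : Orc → List Str → Prop}
    {κ : Orc → List Str → PMF Str} (h : RPT (a + 2) D κ) (adv : ℕ → Str)
    (hadv : ∃ p : Polynomial ℕ, ∀ k, (adv k).length ≤ p.eval k)
    (hD : ∀ k (g : Bits (n k) → Bits (m k)) ins, ins.length = a →
      D (asOracle g) (List.replicate k true :: adv k :: ins)) :
    ∃ M : OraclePPT n m a, ∀ k (g : Bits (n k) → Bits (m k)) ins, ins.length = a →
      M.run k g ins = (κ (asOracle g) (List.replicate k true :: adv k :: ins)).map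
        fun o => o.headD false := by
  obtain ⟨P, p, hP⟩ := h
  obtain ⟨q, hq⟩ := hadv
  have hT : ∀ k ins, p.eval (totalLen (List.replicate k true :: adv k :: ins)) ≤
      (p.comp (Polynomial.X + q)).eval (k + totalLen ins) := fun k ins => by
    rw [Polynomial.eval_comp]
    refine eval_mono _ ?_
    have h1 := hq k
    have h2 := eval_mono q (Nat.le_add_right k (totalLen ins))
    simp; omega
  have key := fun k (g : Bits (n k) → Bits (m k)) ins (ha : ins.length = a) =>
    (hP _ _ (by simp [ha]) (hD k g ins ha)).1.mono (hT k ins)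
  refine ⟨⟨P, adv, ⟨q, hq⟩, p.comp (Polynomial.X + q), fun k g ins ha =>
    (den_iff.1 (key k g ins ha)).1⟩, fun k g ins ha => ?_⟩
  change (stepN (asOracle g) _ ([P], rg (List.replicate k true :: adv k :: ins))).map _ = _
  rw [key k g ins ha, PMF.map_comp, PMF.map_comp]
  rfl

/-! ### Closure properties and basic functions -/

/-- Sequential composition: the output of `κ₁` is added in front of the inputs. -/
theorem RPT.bind {a : ℕ} {D D₁ D₂ : Orc → List Str → Prop} {κ₁ κ₂ : Orc → List Str → PMF Str}
    (h₁ : RPT a D₁ κ₁) (h₂ : RPT (a + 1) D₂ κ₂)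
    (hD₁ : ∀ g ins, ins.length = a → D g ins → D₁ g ins)
    (hD₂ : ∀ g ins, ins.length = a → D g ins → ∀ y ∈ (κ₁ g ins).support, D₂ g (y :: ins)) :
    RPT a D fun g ins => (κ₁ g ins).bind fun y => κ₂ g (y :: ins) := by
  have := RPT.bindSel (a := a) (D := D) (List.range a) (List.range (a + 1))
    (by rw [List.length_range]; exact h₁) (by rw [List.length_range]; exact h₂) (by simp) (by simp)
    (fun g ins ha hD => by rw [sel_range ha]; exact hD₁ g ins ha hD)
    (fun g ins ha hD y hy => by
      rw [sel_range ha] at hy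
      rw [sel_range (by simp [ha])]; exact hD₂ g ins ha hD y hy)
  refine this.congr fun g ins ha hD => ⟨hD, ?_⟩
  simp only [sel_range ha]
  congr 1; funext y
  rw [sel_range (by simp [ha])]

/-- Feeding `κ` with selected inputs. -/
theorem RPT.sel {a : ℕ} {D D' : Orc → List Str → Prop} {κ : Orc → List Str → PMF Str}
    (l : List ℕ) (h : RPT l.length D' κ) (hl : ∀ j ∈ l, j < a)
    (hD : ∀ g ins, ins.length = a → D g ins → D' g (sel l ins)) :
    RPT a D fun g ins => κ g (VBBObf.sel l ins) := by
  have e : ∀ y ins, VBBObf.sel (l.map (· + 1)) (y :: ins) = VBBObf.sel l ins := fun y ins => by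
    simp [VBBObf.sel]
  have := RPT.bindSel (a := a) (D := D) [] (l.map (· + 1)) (PF.nil 0)
    (by rw [List.length_map]; exact h) (by simp) (by simpa using hl) (by simp)
    (fun g ins ha hd y _ => by rw [e]; exact hD g ins ha hd)
  refine this.congr fun g ins ha hD => ⟨hD, ?_⟩
  rw [PMF.pure_bind, e]

theorem PF.sel {a : ℕ} {f : List Str → Str} (l : List ℕ) (h : PF l.length f)
    (hl : ∀ j ∈ l, j < a) : PF a fun ins => f (VBBObf.sel l ins) :=
  RPT.sel l h hl fun _ _ _ _ => trivial

theorem PF.id : PF 1 fun ins => ins.getD 0 [] := by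
  refine PF.of_ex .skip (b := fun n => n + 1) (.add .id (.const _)) fun g ins ha => ?_
  obtain ⟨s, rfl⟩ := List.length_eq_one_iff.1 ha
  exact ⟨Ex.skip.mono (by simp), by simp⟩

theorem PF.proj {a : ℕ} (j : ℕ) (hj : j < a) : PF a fun ins => ins.getD j [] :=
  (PF.id.sel [j] (by simpa using hj)).congr fun g ins _ _ => ⟨trivial, by simp [VBBObf.sel]⟩

theorem PF.rpt {a : ℕ} {f : List Str → Str} (h : PF a f) (D : Orc → List Str → Prop) :
    RPT a D fun _ ins => PMF.pure (f ins) := h.congr fun _ _ _ _ => ⟨trivial, rfl⟩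

theorem RPT.comp1 {a : ℕ} {D D' : Orc → List Str → Prop} {κ : Orc → List Str → PMF Str}
    {f : Orc → List Str → Str} (h : RPT 1 D' κ) (hf : RPT a D fun g ins => PMF.pure (f g ins))
    (hD : ∀ g ins, ins.length = a → D g ins → D' g [f g ins]) :
    RPT a D fun g ins => κ g [f g ins] := by
  have := RPT.bind (D := D) hf (h.sel (a := a + 1) (D := fun g ins => D' g [ins.getD 0 []]) [0]
    (by simp) (fun _ _ _ h => h)) (fun _ _ _ h => h)
    (fun g ins ha hd y hy => by rw [mem_support_pure_iff'] at hy; subst hy; exact hD g ins ha hd)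
  refine this.congr fun g ins ha hD => ⟨hD, ?_⟩
  rw [PMF.pure_bind]; rfl

theorem RPT.comp2 {a : ℕ} {D D' : Orc → List Str → Prop} {κ : Orc → List Str → PMF Str}
    {f₁ f₂ : Orc → List Str → Str} (h : RPT 2 D' κ)
    (h₁ : RPT a D fun g ins => PMF.pure (f₁ g ins)) (h₂ : RPT a D fun g ins => PMF.pure (f₂ g ins))
    (hD : ∀ g ins, ins.length = a → D g ins → D' g [f₁ g ins, f₂ g ins]) :
    RPT a D fun g ins => κ g [f₁ g ins, f₂ g ins] := by
  have := RPT.bind (D := D) h₂ (RPT.bindSel (a := a + 1)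
    (D := fun g ins => D g ins.tail ∧ D' g [f₁ g ins.tail, ins.getD 0 []])
    ((List.range a).map (· + 1)) [0, 1] (by simpa using h₁) h (by simp) (by simp)
    (fun g ins ha hd => by
      cases ins with
      | nil => simp at ha
      | cons y ins => rw [sel_range_succ (by simpa using ha)]; exact hd.1)
    (fun g ins ha hd y hy => by
      cases ins with
      | nil => simp at ha
      | cons z ins =>
        rw [sel_range_succ (by simpa using ha), mem_support_pure_iff'] at hy
        subst hy; exact hd.2)) (fun _ _ _ h => h)
    (fun g ins ha hd y hy => by
      rw [mem_support_pure_iff'] at hy; subst hy; exact ⟨hd, hD g ins ha hd⟩)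
  refine this.congr fun g ins ha hD => ⟨hD, ?_⟩
  rw [PMF.pure_bind, PMF.pure_bind, sel_range_succ ha]; rfl

theorem RPT.comp3 {a : ℕ} {D D' : Orc → List Str → Prop} {κ : Orc → List Str → PMF Str}
    {f₁ f₂ f₃ : Orc → List Str → Str} (h : RPT 3 D' κ)
    (h₁ : RPT a D fun g ins => PMF.pure (f₁ g ins)) (h₂ : RPT a D fun g ins => PMF.pure (f₂ g ins))
    (h₃ : RPT a D fun g ins => PMF.pure (f₃ g ins))
    (hD : ∀ g ins, ins.length = a → D g ins → D' g [f₁ g ins, f₂ g ins, f₃ g ins]) :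
    RPT a D fun g ins => κ g [f₁ g ins, f₂ g ins, f₃ g ins] := by
  -- the domain of the intermediate functions, which have some outputs in front of the inputs
  have aux : ∀ {f : Orc → List Str → Str}, (RPT a D fun g ins => PMF.pure (f g ins)) →
      RPT (a + 1) (fun g ins => D g ins.tail) fun g ins => PMF.pure (f g ins.tail) := by
    intro f hf
    refine (RPT.sel (a := a + 1) (D := fun g ins => D g ins.tail) ((List.range a).map (· + 1))
      (by simpa using hf) (by simp) ?_).congr ?_
    · intro g ins ha hd
      cases ins with
      | nil => simp at ha
      | cons y ins => rw [sel_range_succ (by simpa using ha)]; exact hd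
    · intro g ins ha hd
      refine ⟨hd, ?_⟩
      cases ins with
      | nil => simp at ha
      | cons y ins => rw [sel_range_succ (by simpa using ha)]; rfl
  have h12 := RPT.bind (D := fun g ins => D g ins.tail ∧
      D' g [f₁ g ins.tail, f₂ g ins.tail, ins.getD 0 []]) (aux h₂)
    (RPT.bindSel (a := a + 1 + 1) (D := fun g ins => D g ins.tail.tail ∧
        D' g [f₁ g ins.tail.tail, ins.getD 0 [], ins.getD 1 []])
      ((List.range (a + 1)).map (· + 1)) [0, 1, 2] (by simpa using aux h₁) h (by simp)
      (by simp)
      (fun g ins ha hd => by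
        cases ins with
        | nil => simp at ha
        | cons y ins => rw [sel_range_succ (by simpa using ha)]; exact hd.1)
      (fun g ins ha hd y hy => by
        cases ins with
        | nil => simp at ha
        | cons z ins =>
          rw [sel_range_succ (by simpa using ha), mem_support_pure_iff'] at hy
          subst hy; exact hd.2)) (fun _ _ _ h => h.1)
    (fun g ins ha hd y hy => by rw [mem_support_pure_iff'] at hy; subst hy; exact hd)
  have := RPT.bind (D := D) h₃ h12 (fun _ _ _ h => h) (fun g ins ha hd y hy => by
    rw [mem_support_pure_iff'] at hy; subst hy; exact ⟨hd, hD g ins ha hd⟩)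
  refine this.congr fun g ins ha hD => ⟨hD, ?_⟩
  rw [PMF.pure_bind, PMF.pure_bind, PMF.pure_bind, sel_range_succ (by simp [ha])]; rfl

theorem PF.comp2 {a : ℕ} {F f₁ f₂ : List Str → Str} (h : PF 2 F) (h₁ : PF a f₁) (h₂ : PF a f₂) :
    PF a fun ins => F [f₁ ins, f₂ ins] := RPT.comp2 h h₁ h₂ fun _ _ _ _ => trivial

/-- Empty registers at the end of a list serve as scratch registers of a program. -/
theorem rg_drop_nil (l : List Str) : rg (l ++ [[]]) = rg l := by
  funext i
  simp only [rg]
  rcases lt_trichotomy i l.length with h | rfl | h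
  · rw [List.getD_append _ _ _ _ h]
  · simp
  · rw [List.getD_eq_default _ _ (by simp; omega), List.getD_eq_default _ _ (by omega)]

theorem rg1 (s : Str) : rg [s, []] = rg [s] := rg_drop_nil [s]
theorem rg2 (s : Str) : rg [s, [], []] = rg [s] := (rg_drop_nil [s, []]).trans (rg1 s)
theorem rg3 (s t : Str) : rg [s, t, []] = rg [s, t] := rg_drop_nil [s, t]

theorem ex_mv_rg (g : Orc) {a b : ℕ} (hab : a ≠ b) {l l' : List Str} {T : ℕ} (ha : a < l.length)
    (hb : b < l.length) (hT : 5 * (l.getD a []).length + 1 ≤ T)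
    (hl : (l.set b ((l.getD a []).reverse ++ l.getD b [])).set a [] = l') :
    Ex g (mv a b) (rg l) T (rg l') := by
  subst hl
  refine (ex_mv g hab (rg l)).of_eq hT ?_
  rw [← update_rg (by simpa using ha), ← update_rg hb]; rfl

theorem ex_clr_rg (g : Orc) {r : ℕ} {l l' : List Str} {T : ℕ} (hr : r < l.length)
    (hT : 2 * (l.getD r []).length + 1 ≤ T) (hl : l.set r [] = l') :
    Ex g (clr r) (rg l) T (rg l') := by
  subst hl
  refine (ex_clr g r (rg l)).of_eq hT ?_
  rw [← update_rg hr]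

/-- Concatenation. -/
def appendF (ins : List Str) : Str := ins.getD 0 [] ++ ins.getD 1 []

theorem pf_append : PF 2 appendF := by
  refine PF.of_ex (.seq (mv 0 2) (.seq (mv 2 1) (.seq (mv 1 2) (mv 2 0))))
    (b := fun n => 50 * n + 50) (.add (.mul (.const _) .id) (.const _)) fun g ins ha => ?_
  obtain ⟨u, v, rfl⟩ := List.length_eq_two.1 ha
  constructor
  · rw [← rg3, ← rg2]
    refine (Ex.seq (ex_mv_rg g (by decide) (by simp) (by simp) le_rfl rfl)
      (Ex.seq (ex_mv_rg g (by decide) (by simp) (by simp) le_rfl rfl)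
      (Ex.seq (ex_mv_rg g (by decide) (by simp) (by simp) le_rfl rfl)
      (ex_mv_rg g (by decide) (by simp) (by simp) le_rfl rfl)))).of_eq ?_ ?_
    · simp; omega
    · simp [appendF]
  · simp [appendF]; omega

/-- The initial run of ones. -/
def onesF (ins : List Str) : Str := (ins.getD 0 []).takeWhile id

theorem pf_ones : PF 1 onesF := by
  have loop : ∀ g (u v : Str), Ex g (.loop 0 (fun o => o == some true)
      (.seq (.pop 0) (.push 1 true))) (rg [u, v]) (4 * u.length + 1)
      (rg [u.dropWhile id, List.replicate (u.takeWhile id).length true ++ v]) := by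
    intro g u
    induction u with
    | nil => intro v; exact (Ex.loop_stop (by rfl)).mono (by simp)
    | cons b u ih =>
      intro v
      cases b
      · exact (Ex.loop_stop (by rfl)).mono (by simp)
      · refine (Ex.loop_straight (by rfl) (by rfl) (by rfl) (ih (true :: v))).of_eq
          (by simp [Prog.cost]; omega) ?_
        simp [List.replicate_succ', List.append_assoc]
  refine PF.of_ex (.seq (.loop 0 (fun o => o == some true) (.seq (.pop 0) (.push 1 true)))
    (.seq (clr 0) (mv 1 0))) (b := fun n => 50 * n + 50) (.add (.mul (.const _) .id) (.const _))
    fun g ins ha => ?_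
  obtain ⟨u, rfl⟩ := List.length_eq_one_iff.1 ha
  have h1 : (u.takeWhile id).length ≤ u.length := (List.takeWhile_prefix _).length_le
  have h2 : (u.dropWhile id).length ≤ u.length := (List.dropWhile_suffix _).length_le
  have h3 : u.takeWhile id = List.replicate (u.takeWhile id).length true := by
    rw [List.eq_replicate_iff]
    exact ⟨rfl, fun b hb => by simpa using List.mem_takeWhile_imp hb⟩
  constructor
  · rw [← rg1, ← rg1]
    refine (Ex.seq (loop g u []) (Ex.seq (ex_clr_rg g (by simp) le_rfl rfl)
      (ex_mv_rg g (by decide) (by simp) (by simp) le_rfl rfl))).of_eq ?_ ?_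
    · simp; omega
    · simp only [List.set, onesF, List.getD_cons_zero]
      rw [h3]; simp
  · simp [onesF]; omega

/-- The first `|u|` symbols of `v`. -/
def takeF (ins : List Str) : Str := (ins.getD 1 []).take (ins.getD 0 []).length

theorem pf_take : PF 2 takeF := by
  have loop : ∀ g (u v w : Str), Ex g (.loop 0 Option.isSome (.seq (.pop 0)
      (.ite 1 Option.isSome (.seq (.ite 1 (fun o => o == some true) (.push 2 true) (.push 2 false))
        (.pop 1)) .skip))) (rg [u, v, w]) (20 * u.length + 1)
      (rg [[], v.drop u.length, (v.take u.length).reverse ++ w]) := by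
    intro g u
    induction u with
    | nil => intro v w; exact (Ex.loop_stop (by rfl)).mono (by simp)
    | cons b u ih =>
      intro v w
      cases v with
      | nil =>
        exact (Ex.loop_straight (by rfl) (by rfl) (by rfl) (ih [] w)).of_eq
          (by simp [Prog.cost]; omega) (by simp)
      | cons c v =>
        cases c
        · exact (Ex.loop_straight (by rfl) (by rfl) (by rfl) (ih v (false :: w))).of_eq
            (by simp [Prog.cost]; omega) (by simp)
        · exact (Ex.loop_straight (by rfl) (by rfl) (by rfl) (ih v (true :: w))).of_eq
            (by simp [Prog.cost]; omega) (by simp)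
  refine PF.of_ex (.seq (.loop 0 Option.isSome (.seq (.pop 0)
      (.ite 1 Option.isSome (.seq (.ite 1 (fun o => o == some true) (.push 2 true) (.push 2 false))
        (.pop 1)) .skip))) (.seq (clr 1) (mv 2 0))) (b := fun n => 50 * n + 50)
    (.add (.mul (.const _) .id) (.const _)) fun g ins ha => ?_
  obtain ⟨u, v, rfl⟩ := List.length_eq_two.1 ha
  constructor
  · rw [← rg3, ← rg2]
    refine (Ex.seq (loop g u v []) (Ex.seq (ex_clr_rg g (by simp) le_rfl rfl)
      (ex_mv_rg g (by decide) (by simp) (by simp) le_rfl rfl))).of_eq ?_ ?_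
    · simp; omega
    · simp [takeF]
  · simp [takeF]; omega

/-- The string `v` without its first `|u|` symbols. -/
def dropF (ins : List Str) : Str := (ins.getD 1 []).drop (ins.getD 0 []).length

theorem pf_drop : PF 2 dropF := by
  have loop : ∀ g (u v : Str), Ex g (.loop 0 Option.isSome (.seq (.pop 0) (.pop 1)))
      (rg [u, v]) (4 * u.length + 1) (rg [[], v.drop u.length]) := by
    intro g u
    induction u with
    | nil => intro v; exact (Ex.loop_stop (by rfl)).mono (by simp)
    | cons b u ih =>
      intro v
      exact (Ex.loop_straight (by rfl) (by rfl) (by rfl) (ih v.tail)).of_eq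
          (by simp [Prog.cost]; omega) (by simp)
  refine PF.of_ex (.seq (.loop 0 Option.isSome (.seq (.pop 0) (.pop 1)))
    (.seq (mv 1 2) (mv 2 0))) (b := fun n => 50 * n + 50)
    (.add (.mul (.const _) .id) (.const _)) fun g ins ha => ?_
  obtain ⟨u, v, rfl⟩ := List.length_eq_two.1 ha
  constructor
  · have := loop g u v
    rw [← rg3 [] _] at this
    rw [← rg2]
    refine (Ex.seq this (Ex.seq (ex_mv_rg g (by decide) (by simp) (by simp) le_rfl rfl)
      (ex_mv_rg g (by decide) (by simp) (by simp) le_rfl rfl))).of_eq ?_ ?_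
    · simp; omega
    · simp [dropF]
  · simp [dropF]; omega

/-- The string of ones of the same length. -/
def lenF (ins : List Str) : Str := List.replicate (ins.getD 0 []).length true

theorem pf_len : PF 1 lenF := by
  have loop : ∀ g (u v : Str), Ex g (.loop 0 Option.isSome (.seq (.pop 0) (.push 1 true)))
      (rg [u, v]) (4 * u.length + 1) (rg [[], List.replicate u.length true ++ v]) := by
    intro g u
    induction u with
    | nil => intro v; exact (Ex.loop_stop (by rfl)).mono (by simp)
    | cons b u ih =>
      intro v
      refine (Ex.loop_straight (by rfl) (by rfl) (by rfl) (ih (true :: v))).of_eq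
          (by simp [Prog.cost]; omega) ?_
      simp [List.replicate_succ', List.append_assoc]
  refine PF.of_ex (.seq (.loop 0 Option.isSome (.seq (.pop 0) (.push 1 true)))
    (mv 1 0)) (b := fun n => 50 * n + 50)
    (.add (.mul (.const _) .id) (.const _)) fun g ins ha => ?_
  obtain ⟨u, rfl⟩ := List.length_eq_one_iff.1 ha
  constructor
  · rw [← rg1, ← rg1]
    refine (Ex.seq (loop g u []) (ex_mv_rg g (by decide) (by simp) (by simp) le_rfl rfl)).of_eq
      ?_ ?_
    · simp; omega
    · simp [lenF]
  · simp [lenF]; omega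

/-- A constant string. -/
theorem PF.const (a : ℕ) (s : Str) : PF a fun _ => s := by
  have h0 : PF 0 fun _ => s := by
    induction s with
    | nil => exact PF.nil 0
    | cons b s ih =>
      have : PF 0 fun _ => [b] := by
        refine PF.of_ex (.push 0 b) (b := fun _ => 1) (.const _) fun g ins ha => ?_
        obtain rfl := List.length_eq_zero_iff.1 ha
        refine ⟨(Ex.push 0 b).of_eq le_rfl ?_, by simp⟩
        funext i; cases i <;> simp [rg]
      exact pf_append.comp2 this ih
  exact (h0.sel (a := a) [] (by simp)).congr fun _ _ _ _ => ⟨trivial, rfl⟩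

/-- Equality test. -/
def eqF (ins : List Str) : Str := [decide (ins.getD 0 [] = ins.getD 1 [])]

theorem pf_eq : PF 2 eqF := by
  -- register `2` is nonempty as soon as a difference has been found
  let body : Prog := .seq (.ite 0 (fun o => o == some true)
    (.ite 1 (fun o => o == some true) .skip (.push 2 true))
    (.ite 1 (fun o => o == some false) .skip (.push 2 true))) (.seq (.pop 0) (.pop 1))
  have loop : ∀ g (u v w : Str), ∃ v' w', Ex g (.loop 0 Option.isSome body)
      (rg [u, v, w]) (20 * u.length + 1) (rg [[], v', w']) ∧ v'.length ≤ v.length ∧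
      w'.length ≤ w.length + u.length ∧ (v' = [] ∧ w' = [] ↔ u = v ∧ w = []) := by
    intro g u
    induction u with
    | nil =>
      intro v w
      exact ⟨v, w, (Ex.loop_stop (by rfl)).mono (by simp), by simp, by simp,
        by rw [eq_comm (a := v)]⟩
    | cons b u ih =>
      intro v w
      have next : ∀ w₁, body.evL [b :: u, v, w] = [u, v.tail, w₁] → w₁.length ≤ w.length + 1 →
          (u = v.tail ∧ w₁ = [] ↔ b :: u = v ∧ w = []) → ∃ v' w', Ex g (.loop 0 Option.isSome body)
          (rg [b :: u, v, w]) (20 * (b :: u).length + 1) (rg [[], v', w']) ∧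
          v'.length ≤ v.length ∧ w'.length ≤ w.length + (b :: u).length ∧
          (v' = [] ∧ w' = [] ↔ b :: u = v ∧ w = []) := by
        intro w₁ h1 h2 h3
        obtain ⟨v', w', e, hv, hw, hi⟩ := ih v.tail w₁
        refine ⟨v', w', (Ex.loop_straight (by rfl) (by rfl) h1 e).mono ?_, ?_, ?_, hi.trans h3⟩
        · simp [body, Prog.cost]; omega
        · refine hv.trans (by simp)
        · simp; omega
      cases v with
      | nil => exact next (true :: w) (by cases b <;> rfl) (by simp) (by simp)
      | cons c v =>
        by_cases hbc : b = c
        · subst hbc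
          exact next w (by cases b <;> rfl) (by simp) (by simp)
        · refine next (true :: w) ?_ (by simp) (by simp [hbc])
          cases b <;> cases c <;> first | rfl | exact absurd rfl hbc
  refine PF.of_ex (.seq (.loop 0 Option.isSome body)
    (.seq (.ite 1 Option.isSome (.push 2 true) .skip) (.seq (.ite 2 Option.isSome (.push 0 false)
      (.push 0 true)) (.seq (clr 1) (clr 2))))) (b := fun n => 50 * n + 50)
    (.add (.mul (.const _) .id) (.const _)) fun g ins ha => ?_
  obtain ⟨u, v, rfl⟩ := List.length_eq_two.1 ha
  refine ⟨?_, by simp [eqF]⟩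
  rw [← rg3, ← rg2]
  obtain ⟨v', w', e, hv, hw, hi⟩ := loop g u v []
  refine (Ex.seq e (Ex.seq (Ex.straight _ _ (by rfl)) (Ex.seq
    (Ex.straight _ _ (by rw [Prog.evL_length]; rfl))
    (Ex.seq (ex_clr_rg g ?_ le_rfl rfl) (ex_clr_rg g ?_ le_rfl rfl))))).of_eq ?_ ?_
  · simp [Prog.evL_length]
  · simp [Prog.evL_length]
  · cases v' <;> cases w' <;> simp [Prog.evL, Prog.cost] at hv hw ⊢ <;> omega
  · have : eqF [u, v] = [decide (v' = [] ∧ w' = [])] := by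
      simp [eqF, hi]
    rw [this]
    cases v' <;> cases w' <;> simp [Prog.evL]

/-- Case distinction: the second input if the first one begins with `1`, the third one otherwise. -/
def iteF (ins : List Str) : Str :=
  if (ins.getD 0 []).head? = some true then ins.getD 1 [] else ins.getD 2 []

theorem pf_ite : PF 3 iteF := by
  refine PF.of_ex (.ite 0 (fun o => o == some true)
    (.seq (clr 0) (.seq (clr 2) (.seq (mv 1 2) (mv 2 0))))
    (.seq (clr 0) (.seq (clr 1) (.seq (mv 2 1) (mv 1 0))))) (b := fun n => 50 * n + 50)
    (.add (.mul (.const _) .id) (.const _)) fun g ins ha => ?_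
  obtain ⟨c, u, v, rfl⟩ := List.length_eq_three.1 ha
  refine ⟨?_, by simp only [iteF]; split_ifs <;> simp <;> omega⟩
  rw [← rg2]
  by_cases h : c.head? = some true
  · refine Ex.mono (T := 20 * (c.length + u.length + v.length) + 20) (Ex.ite ?_) ?_
    · rw [if_pos (by simpa [rg] using h)]
      refine (Ex.seq (ex_clr_rg g (by simp) le_rfl rfl) (Ex.seq (ex_clr_rg g (by simp) le_rfl rfl)
        (Ex.seq (ex_mv_rg g (by decide) (by simp) (by simp) le_rfl rfl)
        (ex_mv_rg g (by decide) (by simp) (by simp) le_rfl rfl)))).of_eq ?_ ?_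
      · simp; omega
      · simp [iteF, h]
    · simp; omega
  · refine Ex.mono (T := 20 * (c.length + u.length + v.length) + 20) (Ex.ite ?_) ?_
    · rw [if_neg (by simpa [rg] using h)]
      refine (Ex.seq (ex_clr_rg g (by simp) le_rfl rfl) (Ex.seq (ex_clr_rg g (by simp) le_rfl rfl)
        (Ex.seq (ex_mv_rg g (by decide) (by simp) (by simp) le_rfl rfl)
        (ex_mv_rg g (by decide) (by simp) (by simp) le_rfl rfl)))).of_eq ?_ ?_
      · simp; omega
      · simp [iteF, h]
    · simp; omega

/-- A fair coin. -/
theorem rpt_coin : RPT 0 (fun _ _ => True) fun _ _ => coin.map fun b => [b] := by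
  refine RPT.of_bdd (.flip 0) (b := fun _ => 1) (.const _) fun g ins ha _ => ?_
  obtain rfl := List.length_eq_zero_iff.1 ha
  refine ⟨?_, ?_⟩
  · rw [Den, stepN_succ]
    simp only [step, PMF.bind_map, PMF.map_comp]
    rw [PMF.map]
    refine PMF_bind_congr fun b _ => ?_
    simp only [Function.comp, stepN_zero]
    congr 2
    funext i; cases i <;> simp [rg]
  · intro y hy
    rw [PMF.mem_support_map_iff] at hy
    obtain ⟨b, -, rfl⟩ := hy
    simp

/-- An oracle query. The second input bounds the length of the answers. -/
theorem rpt_query : RPT 2 (fun g ins => ∀ q, (g q).length ≤ (ins.getD 1 []).length) fun g ins =>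
    PMF.pure (g (ins.getD 0 [])) := by
  refine RPT.of_bdd (.seq (.query 0 0) (clr 1)) (b := fun n => 50 * n + 50)
    (.add (.mul (.const _) .id) (.const _)) fun g ins ha hD => ?_
  obtain ⟨u, v, rfl⟩ := List.length_eq_two.1 ha
  constructor
  · rw [PMF.pure_map, ← rg1]
    refine Ex.of_eq (Ex.seq (σ₁ := rg [g u, v]) ((Ex.query 0 0).of_eq le_rfl ?_)
      (ex_clr_rg g (by simp) le_rfl rfl)) (by simp; omega) rfl
    rw [update_rg (by simp)]; rfl
  · intro y hy
    rw [mem_support_pure_iff'] at hy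
    subst hy
    refine (hD _).trans ?_
    simp; omega

/-! ### Strings as data -/

/-- Deterministic oracle functions computed in polynomial time. -/
abbrev DF (a : ℕ) (D : Orc → List Str → Prop) (f : Orc → List Str → Str) : Prop :=
  RPT a D fun g ins => PMF.pure (f g ins)

/-- What remains of a string after an initial number in unary has been read. -/
def restS (s : Str) : Str := s.drop ((s.takeWhile id).length + 1)

/-- The initial run of ones. -/
def onesS (s : Str) : Str := s.takeWhile id

/-- An encoding of pairs of strings. -/
def pairS (x c : Str) : Str := List.replicate x.length true ++ false :: (x ++ c)

/-- First component of a pair. -/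
def fstS (s : Str) : Str := (restS s).take (onesS s).length

/-- Second component of a pair. -/
def sndS (s : Str) : Str := (restS s).drop (onesS s).length

section DF
variable {a : ℕ} {D : Orc → List Str → Prop} {f f₁ f₂ f₃ : Orc → List Str → Str}

theorem DF.const (s : Str) : DF a D fun _ _ => s := (PF.const a s).rpt D

theorem DF.proj (j : ℕ) (hj : j < a) : DF a D fun _ ins => ins.getD j [] := (PF.proj j hj).rpt D

theorem DF.append (h₁ : DF a D f₁) (h₂ : DF a D f₂) : DF a D fun g ins => f₁ g ins ++ f₂ g ins :=
  RPT.comp2 pf_append h₁ h₂ fun _ _ _ _ => trivial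

theorem DF.take (h₁ : DF a D f₁) (h₂ : DF a D f₂) :
    DF a D fun g ins => (f₂ g ins).take (f₁ g ins).length :=
  RPT.comp2 pf_take h₁ h₂ fun _ _ _ _ => trivial

theorem DF.drop (h₁ : DF a D f₁) (h₂ : DF a D f₂) :
    DF a D fun g ins => (f₂ g ins).drop (f₁ g ins).length :=
  RPT.comp2 pf_drop h₁ h₂ fun _ _ _ _ => trivial

theorem DF.eq (h₁ : DF a D f₁) (h₂ : DF a D f₂) :
    DF a D fun g ins => [decide (f₁ g ins = f₂ g ins)] :=
  RPT.comp2 pf_eq h₁ h₂ fun _ _ _ _ => trivial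

theorem DF.ite (h₁ : DF a D f₁) (h₂ : DF a D f₂) (h₃ : DF a D f₃) :
    DF a D fun g ins => if (f₁ g ins).head? = some true then f₂ g ins else f₃ g ins :=
  RPT.comp3 pf_ite h₁ h₂ h₃ fun _ _ _ _ => trivial

theorem DF.ones (h : DF a D f) : DF a D fun g ins => onesS (f g ins) :=
  RPT.comp1 pf_ones h fun _ _ _ _ => trivial

theorem DF.len (h : DF a D f) : DF a D fun g ins => List.replicate (f g ins).length true :=
  RPT.comp1 pf_len h fun _ _ _ _ => trivial

theorem DF.tail (h : DF a D f) : DF a D fun g ins => (f g ins).drop 1 :=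
  DF.drop (DF.const [true]) h

theorem DF.rest (h : DF a D f) : DF a D fun g ins => restS (f g ins) :=
  (DF.drop ((DF.ones h).append (DF.const [true])) h).congr fun g ins _ hD =>
    ⟨hD, by simp [restS, onesS]⟩

theorem DF.pair (h₁ : DF a D f₁) (h₂ : DF a D f₂) : DF a D fun g ins => pairS (f₁ g ins) (f₂ g ins) :=
  h₁.len.append ((DF.const [false]).append (h₁.append h₂))

theorem DF.fst (h : DF a D f) : DF a D fun g ins => fstS (f g ins) := h.ones.take h.rest

theorem DF.snd (h : DF a D f) : DF a D fun g ins => sndS (f g ins) := h.ones.drop h.rest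

/-- The equality test in the form of a case distinction. -/
theorem DF.iteEq {f₄ : Orc → List Str → Str} (h₁ : DF a D f₁) (h₂ : DF a D f₂) (h₃ : DF a D f₃)
    (h₄ : DF a D f₄) :
    DF a D fun g ins => if f₁ g ins = f₂ g ins then f₃ g ins else f₄ g ins :=
  (DF.ite (h₁.eq h₂) h₃ h₄).congr fun g ins _ hD => ⟨hD, by simp⟩

end DF

@[simp] theorem onesS_unary (i : ℕ) (r : Str) :
    onesS (unary i ++ r) = List.replicate i true := by
  simp [onesS, unary]

@[simp] theorem restS_unary (i : ℕ) (r : Str) : restS (unary i ++ r) = r := by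
  have h : ((unary i ++ r).takeWhile id).length = i := by
    have := onesS_unary i r
    rw [onesS] at this; rw [this]; simp
  rw [restS, h, List.drop_append_of_le_length (by simp [unary])]
  simp [unary]

theorem onesS_eq (s : Str) : onesS s = List.replicate (onesS s).length true := by
  rw [List.eq_replicate_iff]
  exact ⟨rfl, fun b hb => by simpa using List.mem_takeWhile_imp hb⟩

/-- A string with a nonempty rest starts with a number in unary. -/
theorem eq_unary_of_restS {s : Str} (h : restS s ≠ []) :
    s = unary (onesS s).length ++ restS s := by
  have h1 : s = onesS s ++ s.dropWhile id := (List.takeWhile_append_dropWhile (p := id) (l := s)).symm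
  have h2 : restS s = (s.dropWhile id).drop 1 := by
    rw [restS, ← List.drop_drop]
    conv_lhs => rw [show s.takeWhile id = onesS s from rfl]; arg 2; arg 2; rw [h1]
    simp
  rw [unary, ← onesS_eq, List.append_assoc]
  conv_lhs => rw [h1]
  congr 1
  rw [h2] at h ⊢
  cases hd : s.dropWhile id with
  | nil => simp [hd] at h
  | cons b t =>
    have : b = false := by
      have h3 := List.head?_dropWhile_not id s
      rw [hd] at h3
      simpa using h3
    simp [this]

theorem restS_length (s : Str) : (restS s).length ≤ s.length := by simp [restS]

@[simp] theorem fstS_pairS (x c : Str) : fstS (pairS x c) = x := by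
  have : pairS x c = unary x.length ++ (x ++ c) := by simp [pairS, unary]
  rw [fstS, this, restS_unary, onesS_unary]; simp

@[simp] theorem sndS_pairS (x c : Str) : sndS (pairS x c) = c := by
  have : pairS x c = unary x.length ++ (x ++ c) := by simp [pairS, unary]
  rw [sndS, this, restS_unary, onesS_unary]; simp

@[simp] theorem length_pairS (x c : Str) : (pairS x c).length = 2 * x.length + c.length + 1 := by
  simp [pairS]; omega

theorem head?_drop_bit (W : Str) (i : ℕ) : (W.drop i).head? = some true ↔ W.getD i false = true := by
  rw [List.head?_drop, List.getD_eq_getElem?_getD]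
  cases W[i]? <;> simp

/-! ### Evaluation of circuits -/

/-- The description of a list of gates. -/
def encG (gs : List (ℕ × ℕ)) : Str := gs.flatMap fun g => true :: (unary g.1 ++ unary g.2)

/-- The description of a list of output wires. -/
def encO (os : List ℕ) : Str := os.flatMap fun o => true :: unary o

theorem encode_eq {n m : ℕ} (C : Circuit n m) : C.encode =
    unary n ++ (encG C.gates ++ false :: (encO (List.ofFn C.outs) ++ [false])) := by
  simp [Circuit.encode, encG, encO]

/-- Read a list of gates. On malformed strings, the remainder is empty. -/
def gatesParse : Str → List (ℕ × ℕ) × Str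
  | true :: s =>
    let r := gatesParse (restS (restS s))
    (((onesS s).length, (onesS (restS s)).length) :: r.1, r.2)
  | s => ([], s)
termination_by s => s.length
decreasing_by
  have h1 := restS_length s
  have h2 := restS_length (restS s)
  simp; omega

/-- Read a list of output wires. On malformed strings, the remainder is empty. -/
def outsParse : Str → List ℕ × Str
  | true :: s =>
    let r := outsParse (restS s)
    ((onesS s).length :: r.1, r.2)
  | s => ([], s)
termination_by s => s.length
decreasing_by
  have h1 := restS_length s
  simp; omega

theorem gatesParse_true (s : Str) : gatesParse (true :: s) =
    (((onesS s).length, (onesS (restS s)).length) :: (gatesParse (restS (restS s))).1,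
      (gatesParse (restS (restS s))).2) := by rw [gatesParse]

theorem gatesParse_stop {s : Str} (h : s.head? ≠ some true) : gatesParse s = ([], s) := by
  rcases s with _ | ⟨_ | _, s⟩
  · rw [gatesParse]; simp
  · rw [gatesParse]; simp
  · simp at h

theorem outsParse_true (s : Str) : outsParse (true :: s) =
    ((onesS s).length :: (outsParse (restS s)).1, (outsParse (restS s)).2) := by rw [outsParse]

theorem outsParse_stop {s : Str} (h : s.head? ≠ some true) : outsParse s = ([], s) := by
  rcases s with _ | ⟨_ | _, s⟩
  · rw [outsParse]; simp
  · rw [outsParse]; simp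
  · simp at h

theorem gatesParse_encG (gs : List (ℕ × ℕ)) (r : Str) (hr : r.head? ≠ some true) :
    gatesParse (encG gs ++ r) = (gs, r) := by
  induction gs with
  | nil => exact gatesParse_stop hr
  | cons g gs ih =>
    have : encG (g :: gs) ++ r = true :: (unary g.1 ++ (unary g.2 ++ (encG gs ++ r))) := by
      simp [encG]
    rw [this, gatesParse_true]
    simp [ih]

theorem outsParse_encO (os : List ℕ) (r : Str) (hr : r.head? ≠ some true) :
    outsParse (encO os ++ r) = (os, r) := by
  induction os with
  | nil => exact outsParse_stop hr
  | cons g gs ih =>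
    have : encO (g :: gs) ++ r = true :: (unary g ++ (encO gs ++ r)) := by
      simp [encO]
    rw [this, outsParse_true]
    simp [ih]

/-- Conversely, what has been read is the description of the gates, unless nothing is left. -/
theorem gatesParse_spec (s : Str) : (gatesParse s).2.head? ≠ some true ∧
    ((gatesParse s).2 ≠ [] → s = encG (gatesParse s).1 ++ (gatesParse s).2) := by
  induction hn : s.length using Nat.strong_induction_on generalizing s with
  | _ n ih =>
    by_cases h : s.head? = some true
    · obtain ⟨t, rfl⟩ : ∃ t, s = true :: t := by
        cases s with
        | nil => simp at h
        | cons b t => exact ⟨t, by simp at h; rw [h]⟩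
      have h1 := restS_length t
      have h2 := restS_length (restS t)
      obtain ⟨i1, i2⟩ := ih _ (by simp at hn; omega) (restS (restS t)) rfl
      rw [gatesParse_true]
      refine ⟨i1, fun hne => ?_⟩
      have e := i2 hne
      have h3 : restS (restS t) ≠ [] := by
        intro h0; rw [h0, gatesParse_stop (by simp)] at hne; exact hne rfl
      have h4 := eq_unary_of_restS h3
      have h5 : restS t ≠ [] := by intro h0; rw [h0] at h3; simp [restS] at h3
      have h6 := eq_unary_of_restS h5
      have : encG (((onesS t).length, (onesS (restS t)).length) :: (gatesParse (restS (restS t))).1)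
          ++ (gatesParse (restS (restS t))).2 = true :: (unary (onesS t).length ++
          (unary (onesS (restS t)).length ++ (encG (gatesParse (restS (restS t))).1 ++
          (gatesParse (restS (restS t))).2))) := by simp [encG]
      simp only
      rw [this, ← e, ← h4, ← h6]
    · rw [gatesParse_stop h]
      exact ⟨h, fun _ => by simp [encG]⟩

/-- Conversely, what has been read is the description of the outputs, unless nothing is left. -/
theorem outsParse_spec (s : Str) : (outsParse s).2.head? ≠ some true ∧
    ((outsParse s).2 ≠ [] → s = encO (outsParse s).1 ++ (outsParse s).2) := by
  induction hn : s.length using Nat.strong_induction_on generalizing s with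
  | _ n ih =>
    by_cases h : s.head? = some true
    · obtain ⟨t, rfl⟩ : ∃ t, s = true :: t := by
        cases s with
        | nil => simp at h
        | cons b t => exact ⟨t, by simp at h; rw [h]⟩
      have h1 := restS_length t
      obtain ⟨i1, i2⟩ := ih _ (by simp at hn; omega) (restS t) rfl
      rw [outsParse_true]
      refine ⟨i1, fun hne => ?_⟩
      have e := i2 hne
      have h5 : restS t ≠ [] := by
        intro h0; rw [h0, outsParse_stop (by simp)] at hne; exact hne rfl
      have h6 := eq_unary_of_restS h5
      have : encO ((onesS t).length :: (outsParse (restS t)).1)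
          ++ (outsParse (restS t)).2 = true :: (unary (onesS t).length ++
          (encO (outsParse (restS t)).1 ++ (outsParse (restS t)).2)) := by simp [encO]
      simp only
      rw [this, ← e, ← h6]
    · rw [outsParse_stop h]
      exact ⟨h, fun _ => by simp [encO]⟩

/-- The run of the gates of a description, on a pair of a list of wires and a description. -/
def gatesRun (s : Str) : Str :=
  pairS (wires (gatesParse (sndS s)).1 (fstS s)) (gatesParse (sndS s)).2

/-- Reading one bit of a list of wires. -/
theorem DF.bit {a : ℕ} {D : Orc → List Str → Prop} {f₁ f₂ : Orc → List Str → Str}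
    (h₁ : DF a D f₁) (h₂ : DF a D f₂) :
    DF a D fun g ins => [(f₂ g ins).getD (f₁ g ins).length false] :=
  ((DF.drop h₁ h₂).ite (DF.const [true]) (DF.const [false])).congr fun g ins _ hD => ⟨hD, by
    simp only [head?_drop_bit]
    cases (f₂ g ins).getD (f₁ g ins).length false <;> simp⟩

/-- Each round evaluates one gate. It adds one wire and shortens the description, so that the state
does not grow. -/
theorem df_gatesRun : DF 1 (fun _ ins => ∃ W G, ins = [pairS W G])
    fun _ ins => gatesRun (ins.getD 0 []) := by
  -- one round of the loop
  let W : Str → Str := fstS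
  let G₁ : Str → Str := fun s => (sndS s).drop 1
  let body : Str → Str := fun s => pairS
    ((if [(W s).getD (onesS (G₁ s)).length false].head? = some true then
        (if [(W s).getD (onesS (restS (G₁ s))).length false].head? = some true
          then [false] else [true]) else [true]) ++ W s) (restS (restS (G₁ s)))
  have hW : DF (0 + 1) (fun _ _ => True) fun _ ins => W (ins.getD 0 []) :=
    (DF.proj 0 (by simp)).fst
  have hG : DF (0 + 1) (fun _ _ => True) fun _ ins => G₁ (ins.getD 0 []) :=
    (DF.proj 0 (by simp)).snd.tail
  have hbody : DF (0 + 1) (fun _ _ => True) fun _ ins => body (ins.getD 0 []) :=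
    (((hG.ones.bit hW).ite ((hG.rest.ones.bit hW).ite (DF.const [false]) (DF.const [true]))
      (DF.const [true])).append hW).pair hG.rest.rest
  have hcond : DF (0 + 1) (fun _ _ => True) fun _ ins => sndS (ins.getD 0 []) :=
    (DF.proj 0 (by simp)).snd
  refine RPT.while (2 * Polynomial.X + 1) hbody hcond ?_
  rintro g s e he ⟨W₀, G₀, hs⟩
  obtain rfl := List.length_eq_zero_iff.1 he
  obtain rfl : s = pairS W₀ G₀ := by simpa using hs
  refine ⟨fun s => ∃ W G, s = pairS W G ∧ W.length + G.length ≤ W₀.length + G₀.length,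
    fun s => (sndS s).length, ⟨W₀, G₀, rfl, le_rfl⟩, ?_, ?_, ?_⟩
  · rintro s ⟨W, G, rfl, h⟩
    simp; omega
  · rintro s ⟨W', G', rfl, h⟩ hc
    simp only [List.getD_cons_zero, sndS_pairS] at hc
    obtain ⟨t, rfl⟩ : ∃ t, G' = true :: t := by
      cases G' with
      | nil => simp at hc
      | cons b t => exact ⟨t, by simp at hc; rw [hc]⟩
    have h1 := restS_length t
    have h2 := restS_length (restS t)
    have hb : body (pairS W' (true :: t)) = pairS ((!(W'.getD (onesS t).length false &&
        W'.getD (onesS (restS t)).length false)) :: W') (restS (restS t)) := by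
      simp only [body, W, G₁, fstS_pairS, sndS_pairS, List.drop_one, List.tail_cons]
      cases W'.getD (onesS t).length false <;>
        cases W'.getD (onesS (restS t)).length false <;> simp
    simp only [List.getD_cons_zero, hb]
    refine ⟨trivial, ⟨_, _, rfl, ?_⟩, ?_, ?_⟩
    · simp at h ⊢; omega
    · simp; omega
    · simp [gatesRun, gatesParse_true, wires]
  · rintro s ⟨W', G', rfl, h⟩ hc
    simp only [List.getD_cons_zero, sndS_pairS] at hc
    simp [gatesRun, gatesParse_stop hc, wires]

/-- The collection of the output bits, from a pair of the outputs obtained so far and a description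
of the output wires, and the list of wires. -/
def outsRun (s W : Str) : Str :=
  pairS (fstS s ++ (outsParse (sndS s)).1.map fun o => W.getD o false) (outsParse (sndS s)).2

theorem df_outsRun : DF 2 (fun _ ins => ∃ O G W, ins = [pairS O G, W])
    fun _ ins => outsRun (ins.getD 0 []) (ins.getD 1 []) := by
  have hs : DF (1 + 1) (fun _ _ => True) fun _ ins => ins.getD 0 [] := DF.proj 0 (by simp)
  have hW : DF (1 + 1) (fun _ _ => True) fun _ ins => ins.getD 1 [] := DF.proj 1 (by simp)
  have hbody := DF.pair (hs.fst.append (hs.snd.tail.ones.bit hW)) hs.snd.tail.rest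
  refine RPT.while (2 * Polynomial.X + 1) hbody hs.snd ?_
  rintro g s e he ⟨O₀, G₀, W, hs⟩
  obtain ⟨rfl, rfl⟩ : s = pairS O₀ G₀ ∧ e = [W] := by simpa using hs
  refine ⟨fun s => ∃ O G, s = pairS O G ∧ O.length + G.length ≤ O₀.length + G₀.length,
    fun s => (sndS s).length, ⟨O₀, G₀, rfl, le_rfl⟩, ?_, ?_, ?_⟩
  · rintro s ⟨O, G, rfl, h⟩
    simp; omega
  · rintro s ⟨O, G, rfl, h⟩ hc
    simp only [List.getD_cons_zero, sndS_pairS] at hc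
    obtain ⟨t, rfl⟩ : ∃ t, G = true :: t := by
      cases G with
      | nil => simp at hc
      | cons b t => exact ⟨t, by simp at hc; rw [hc]⟩
    have h1 := restS_length t
    simp only [List.getD_cons_zero, List.getD_cons_succ, fstS_pairS, sndS_pairS, List.drop_one,
      List.tail_cons]
    refine ⟨trivial, ⟨_, _, rfl, ?_⟩, ?_, ?_⟩
    · simp at h ⊢; omega
    · simp; omega
    · simp [outsRun, outsParse_true]
  · rintro s ⟨O, G, rfl, h⟩ hc
    simp only [List.getD_cons_zero, sndS_pairS] at hc
    simp [outsRun, outsParse_stop hc]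

/-- Evaluate the description `w` of a circuit on the input bits `q`. The output bits are paired with
what is left of the description, which is `[false]` if it was well-formed. -/
def evalS (w q : Str) : Str :=
  outsRun (pairS [] ((sndS (gatesRun (pairS q (restS w)))).drop 1))
    (fstS (gatesRun (pairS q (restS w))))

theorem DF.circuitEval {a : ℕ} {D : Orc → List Str → Prop} {f₁ f₂ : Orc → List Str → Str}
    (h₁ : DF a D f₁) (h₂ : DF a D f₂) : DF a D fun g ins => evalS (f₁ g ins) (f₂ g ins) := by
  have h := RPT.comp1 df_gatesRun (h₂.pair h₁.rest) fun _ _ _ _ => ⟨_, _, rfl⟩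
  exact RPT.comp2 df_outsRun ((DF.const []).pair (DF.snd h).tail) (DF.fst h) fun _ _ _ _ =>
    ⟨_, _, _, rfl⟩

theorem evalS_eq (w q : Str) : evalS w q =
    pairS ((outsParse ((gatesParse (restS w)).2.drop 1)).1.map fun o =>
      (wires (gatesParse (restS w)).1 q).getD o false)
      (outsParse ((gatesParse (restS w)).2.drop 1)).2 := by
  simp [evalS, gatesRun, outsRun]

theorem parse_encode {n m : ℕ} (C : Circuit n m) :
    gatesParse (restS C.encode) = (C.gates, false :: (encO (List.ofFn C.outs) ++ [false])) ∧
    outsParse (encO (List.ofFn C.outs) ++ [false]) = (List.ofFn C.outs, [false]) := by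
  rw [encode_eq, restS_unary, gatesParse_encG _ _ (by simp), outsParse_encO _ _ (by simp)]
  exact ⟨rfl, rfl⟩

theorem evalS_encode {n m : ℕ} (C : Circuit n m) (q : Str) : evalS C.encode q =
    pairS ((List.ofFn C.outs).map fun o => (wires C.gates q).getD o false) [false] := by
  rw [evalS_eq, (parse_encode C).1]
  simp [(parse_encode C).2]

theorem evalS_encode_eval {n m : ℕ} (C : Circuit n m) (x : Bits n) :
    evalS C.encode (List.ofFn x) = pairS (List.ofFn (C.eval x)) [false] := by
  rw [evalS_encode, List.map_ofFn]; rfl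

theorem encode_injective {n m : ℕ} {C C' : Circuit n m} (h : C.encode = C'.encode) : C = C' := by
  have h1 := (parse_encode C).1
  have h2 := (parse_encode C').1
  rw [h, h2, Prod.mk.injEq] at h1
  have h3 := (parse_encode C).2
  have h4 := (parse_encode C').2
  have h5 := h1.2
  simp only [List.cons.injEq, true_and] at h5
  rw [← h5, h4, Prod.mk.injEq] at h3
  have := List.ofFn_injective h3.1
  cases C; cases C'
  simp only at h1 this
  rw [h1.1, this]

/-- A string that `evalS` accepts as well-formed is the description of a circuit. -/
theorem exists_encode {w : Str} (h : sndS (evalS w []) = [false]) : ∃ C : Circuit (onesS w).length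
    (fstS (evalS w [])).length, w = C.encode := by
  have hl : (fstS (evalS w [])).length = (outsParse ((gatesParse (restS w)).2.drop 1)).1.length := by
    rw [evalS_eq]; simp
  rw [hl]
  rw [evalS_eq, sndS_pairS] at h
  have h1 := (outsParse_spec ((gatesParse (restS w)).2.drop 1)).2 (by rw [h]; simp)
  rw [h] at h1
  obtain ⟨h2, h3⟩ := gatesParse_spec (restS w)
  set r := (gatesParse (restS w)).2 with hr
  obtain ⟨t, ht⟩ : ∃ t, r = false :: t := by
    rcases r with _ | ⟨_ | _, t⟩
    · simp at h1
    · exact ⟨t, rfl⟩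
    · simp at h2
  have h4 := h3 (by rw [ht]; simp)
  have h5 := eq_unary_of_restS (s := w) (by rw [h4, ht]; simp)
  refine ⟨⟨(gatesParse (restS w)).1, fun i => (outsParse (r.drop 1)).1.get i⟩, ?_⟩
  rw [encode_eq]
  simp only
  rw [List.ofFn_get, ← h1]
  conv_lhs => rw [h5, h4, ht]
  rw [ht]
  rfl

/-! ### The statements about small circuits form an NP relation -/

/-- The description of a list of pairs of an input and an output. -/
def encP {n m : ℕ} (pts : List (Bits n × Bits m)) : Str :=
  pts.flatMap fun q => true :: (List.ofFn q.1 ++ List.ofFn q.2)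

theorem encodeStmt_eq (n m B : ℕ) (pts : List (Bits n × Bits m)) : encodeStmt n m B pts =
    unary n ++ (unary m ++ (unary B ++ (encP pts ++ [false]))) := by
  simp [encodeStmt, encP]

/-- Check the pairs `(q, f q)` of a list, where `q` has `n` bits. The result is what is left of the
list when a pair fails the check, it is `[false]` if all pairs are correct. -/
def checkPts (f : Str → Str) (n : ℕ) : Str → Str
  | true :: s =>
    if (s.drop n).take (f (s.take n)).length = f (s.take n) then
      checkPts f n ((s.drop n).drop (f (s.take n)).length) else []
  | s => s
termination_by s => s.length
decreasing_by simp

theorem checkPts_true (f : Str → Str) (n : ℕ) (s : Str) : checkPts f n (true :: s) =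
    if (s.drop n).take (f (s.take n)).length = f (s.take n) then
      checkPts f n ((s.drop n).drop (f (s.take n)).length) else [] := by
  rw [checkPts]

theorem checkPts_stop {f : Str → Str} {n : ℕ} {s : Str} (h : s.head? ≠ some true) :
    checkPts f n s = s := by
  rcases s with _ | ⟨_ | _, s⟩
  · rw [checkPts]; simp
  · rw [checkPts]; simp
  · simp at h

/-- The check succeeds precisely on the descriptions of lists of correct pairs. -/
theorem checkPts_iff {f : Str → Str} {n m : ℕ} {h : Bits n → Bits m}
    (hf : ∀ x : Bits n, f (List.ofFn x) = List.ofFn (h x)) (hl : ∀ q, (f q).length = m) (s : Str) :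
    checkPts f n s = [false] ↔
      ∃ pts : List (Bits n × Bits m), s = encP pts ++ [false] ∧ ∀ q ∈ pts, h q.1 = q.2 := by
  have eqOfFn : ∀ {k : ℕ} {t : Str}, t.length = k → ∃ x : Bits k, t = List.ofFn x := by
    rintro k t rfl
    exact ⟨t.get, (List.ofFn_get t).symm⟩
  constructor
  · induction hn : s.length using Nat.strong_induction_on generalizing s with
    | _ N ih =>
      intro hc
      by_cases hs : s.head? = some true
      · obtain ⟨t, rfl⟩ : ∃ t, s = true :: t := by
          cases s with
          | nil => simp at hs
          | cons b t => exact ⟨t, by simp at hs; rw [hs]⟩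
        rw [checkPts_true] at hc
        split_ifs at hc with h1
        obtain ⟨pts, hp, hq⟩ := ih _ (by simp at hn ⊢; omega) _ rfl hc
        have hlen : n ≤ t.length := by
          by_contra hlt
          rw [List.drop_eq_nil_of_le (as := t) (by omega)] at hp
          simp at hp
        obtain ⟨x, hx⟩ := eqOfFn (show (t.take n).length = n by simp [hlen])
        rw [hx, hf, List.length_ofFn] at h1
        rw [hl] at hp
        refine ⟨(x, h x) :: pts, ?_, ?_⟩
        · have : encP ((x, h x) :: pts) ++ [false] =
              true :: (List.ofFn x ++ (List.ofFn (h x) ++ (encP pts ++ [false]))) := by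
            simp [encP]
          rw [this, ← hp, ← h1, List.take_append_drop, ← hx, List.take_append_drop]
        · simpa using hq
      · rw [checkPts_stop hs] at hc
        exact ⟨[], by simpa [encP] using hc, by simp⟩
  · rintro ⟨pts, rfl, hq⟩
    induction pts with
    | nil => exact checkPts_stop (by simp [encP])
    | cons q pts ih =>
      have : encP (q :: pts) ++ [false] =
          true :: (List.ofFn q.1 ++ (List.ofFn q.2 ++ (encP pts ++ [false]))) := by
        simp [encP]
      rw [this, checkPts_true]
      have h1 : (List.ofFn q.1 ++ (List.ofFn q.2 ++ (encP pts ++ [false]))).take n =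
          List.ofFn q.1 := List.take_left' (by simp)
      have h2 : (List.ofFn q.1 ++ (List.ofFn q.2 ++ (encP pts ++ [false]))).drop n =
          List.ofFn q.2 ++ (encP pts ++ [false]) := List.drop_left' (by simp)
      have h3 : h q.1 = q.2 := hq q (by simp)
      rw [h1, h2, hf, h3, List.length_ofFn, List.take_left' (by simp), List.drop_left' (by simp),
        if_pos rfl]
      exact ih fun q' hq' => hq q' (by simp [hq'])

theorem DF.pointsCheck {a : ℕ} {D : Orc → List Str → Prop} {f₁ f₂ f₃ : Orc → List Str → Str}
    (h₁ : DF a D f₁) (h₂ : DF a D f₂) (h₃ : DF a D f₃) :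
    DF a D fun g ins => checkPts (fun q => fstS (evalS (f₂ g ins) q)) (f₃ g ins).length
      (f₁ g ins) := by
  have key : DF 3 (fun _ _ => True) fun _ ins =>
      checkPts (fun q => fstS (evalS (ins.getD 1 []) q)) (ins.getD 2 []).length
        (ins.getD 0 []) := by
    have hs : DF (2 + 1) (fun _ _ => True) fun _ ins => ins.getD 0 [] := DF.proj 0 (by simp)
    have hw : DF (2 + 1) (fun _ _ => True) fun _ ins => ins.getD 1 [] := DF.proj 1 (by simp)
    have hn : DF (2 + 1) (fun _ _ => True) fun _ ins => ins.getD 2 [] := DF.proj 2 (by simp)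
    have ho := (hw.circuitEval (hn.take hs.tail)).fst
    have hbody := DF.iteEq (ho.take (hn.drop hs.tail)) ho (ho.drop (hn.drop hs.tail)) (DF.const [])
    refine RPT.while Polynomial.X hbody hs ?_
    rintro g s e he -
    obtain ⟨w, n, rfl⟩ := List.length_eq_two.1 he
    refine ⟨fun s' => s'.length ≤ s.length, fun s' => s'.length, le_rfl, ?_, ?_, ?_⟩
    · intro s' hs'; simp; omega
    · intro s' hs' hc
      simp only [List.getD_cons_zero] at hc
      obtain ⟨t, rfl⟩ : ∃ t, s' = true :: t := by
        cases s' with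
        | nil => simp at hc
        | cons b t => exact ⟨t, by simp at hc; rw [hc]⟩
      simp only [List.getD_cons_zero, List.getD_cons_succ, List.drop_one, List.tail_cons]
      refine ⟨trivial, ?_, ?_, ?_⟩
      · split_ifs <;> simp at hs' ⊢; omega
      · split_ifs <;> simp
      · rw [checkPts_true]
        split_ifs
        · rfl
        · exact checkPts_stop (by simp)
    · intro s' hs' hc
      exact checkPts_stop hc
  exact RPT.comp3 key h₁ h₂ h₃ fun _ _ _ _ => trivial

/-- The verifier for the statements about small circuits: `w` is the description of a circuit of
the right format and size, and all the pairs are correct. -/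
def verifyS (x w : Str) : Str :=
  if sndS (evalS w []) = [false] then
    if onesS w = onesS x then
      if List.replicate (fstS (evalS w [])).length true = onesS (restS x) then
        if w.drop (onesS (restS (restS x))).length = [] then
          if checkPts (fun q => fstS (evalS w q)) (onesS x).length (restS (restS (restS x))) =
            [false] then [true] else []
        else []
      else []
    else []
  else []

theorem pf_verifyS : PF 2 fun ins => verifyS (ins.getD 0 []) (ins.getD 1 []) := by
  have hx : DF 2 (fun _ _ => True) fun _ ins => ins.getD 0 [] := DF.proj 0 (by simp)
  have hw : DF 2 (fun _ _ => True) fun _ ins => ins.getD 1 [] := DF.proj 1 (by simp)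
  have e := hw.circuitEval (DF.const [])
  have c := DF.const (a := 2) (D := fun _ _ => True)
  exact DF.iteEq e.snd (c [false]) (DF.iteEq hw.ones hx.ones (DF.iteEq e.fst.len hx.rest.ones
    (DF.iteEq (DF.drop hx.rest.rest.ones hw) (c []) (DF.iteEq
    (DF.pointsCheck hx.rest.rest.rest hw hx.ones) (c [false]) (c [true]) (c [])) (c [])) (c []))
    (c [])) (c [])

theorem verifyS_iff (x w : Str) : verifyS x w = [true] ↔ SmallCircuitRel x w := by
  have len : ∀ {n m : ℕ} (C : Circuit n m) (q : Str), (fstS (evalS C.encode q)).length = m := by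
    intro n m C q
    rw [evalS_encode]; simp
  have ones : ∀ {n m : ℕ} (C : Circuit n m), onesS C.encode = List.replicate n true := by
    intro n m C; rw [encode_eq, onesS_unary]
  constructor
  · intro h
    unfold verifyS at h
    split_ifs at h with h1 h2 h3 h4 h5
    obtain ⟨C, hC⟩ := exists_encode h1
    generalize hn : (onesS w).length = n at C
    generalize hm : (fstS (evalS w [])).length = m at C
    subst hC
    have hx1 : (onesS x).length = n := by rw [← h2, ones]; simp
    have hm' : (onesS (restS x)).length = m := by rw [← h3, len]; simp
    rw [hx1] at h5
    obtain ⟨pts, hp, hq⟩ := (checkPts_iff (h := C.eval)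
      (fun x => by rw [evalS_encode_eval, fstS_pairS]) (len C) _).1 h5
    have n3 : restS (restS (restS x)) ≠ [] := by rw [hp]; simp
    have n2 : restS (restS x) ≠ [] := by intro h0; rw [h0] at n3; simp [restS] at n3
    have n1 : restS x ≠ [] := by intro h0; rw [h0] at n2; simp [restS] at n2
    refine ⟨n, m, (onesS (restS (restS x))).length, pts, C, ?_, rfl, ?_, hq⟩
    · rw [encodeStmt_eq, ← hp, ← eq_unary_of_restS n3]
      conv_lhs => rw [eq_unary_of_restS n1, eq_unary_of_restS n2]
      rw [hx1, hm']
    · rw [Circuit.size]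
      exact List.drop_eq_nil_iff.1 h4
  · rintro ⟨n, m, B, pts, C, rfl, rfl, hB, hq⟩
    have h5 := (checkPts_iff (f := fun q => fstS (evalS C.encode q)) (h := C.eval)
      (fun x => by rw [evalS_encode_eval, fstS_pairS]) (len C) (encP pts ++ [false])).2
      ⟨pts, rfl, hq⟩
    have h4 : C.encode.drop B = [] := List.drop_eq_nil_iff.2 hB
    have h1 : sndS (evalS C.encode []) = [false] := by rw [evalS_encode]; simp
    simp [verifyS, encodeStmt_eq, ones, len, h1, h4, h5]

theorem isNPRelation_smallCircuitRel : IsNPRelation SmallCircuitRel := by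
  refine ⟨⟨Polynomial.X, ?_⟩, fun ins => verifyS (ins.getD 0 []) (ins.getD 1 []),
    pf_verifyS.polyTimeComputable, fun x w => (verifyS_iff x w).symm⟩
  rintro x w ⟨n, m, B, pts, C, rfl, rfl, hB, -⟩
  have : C.encode.length ≤ B := hB
  simp [encodeStmt_eq, unary]; omega

/-! ### Oracles given by a circuit and a table -/

theorem fstS_length (s : Str) : (fstS s).length ≤ s.length := by
  have := restS_length s
  simp [fstS]; omega

theorem sndS_length (s : Str) : (sndS s).length ≤ s.length := by
  have := restS_length s
  simp [sndS]; omega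

/-- The description of a table of arguments and values. -/
def encT (L : List (Str × Str)) : Str := L.foldr (fun p r => true :: pairS p.1 (pairS p.2 r)) []

/-- Look up `q` in a table. The result is empty if there is no entry for `q`, otherwise it is the
value behind a `0`. -/
def lookS (q : Str) : Str → Str
  | true :: t => if fstS t = q then false :: fstS (sndS t) else lookS q (sndS (sndS t))
  | s => s
termination_by s => s.length
decreasing_by
  have h1 := sndS_length t
  have h2 := sndS_length (sndS t)
  simp; omega

theorem lookS_true (q t : Str) : lookS q (true :: t) =
    if fstS t = q then false :: fstS (sndS t) else lookS q (sndS (sndS t)) := by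
  rw [lookS]

theorem lookS_stop {q s : Str} (h : s.head? ≠ some true) : lookS q s = s := by
  rcases s with _ | ⟨_ | _, s⟩
  · rw [lookS]; simp
  · rw [lookS]; simp
  · simp at h

theorem pf_lookS : PF 2 fun ins => lookS (ins.getD 1 []) (ins.getD 0 []) := by
  have hs : DF (1 + 1) (fun _ _ => True) fun _ ins => ins.getD 0 [] := DF.proj 0 (by simp)
  have hq : DF (1 + 1) (fun _ _ => True) fun _ ins => ins.getD 1 [] := DF.proj 1 (by simp)
  have hbody := DF.iteEq hs.tail.fst hq ((DF.const [false]).append hs.tail.snd.fst)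
    hs.tail.snd.snd
  refine RPT.while (Polynomial.X) hbody hs ?_
  rintro g s e he -
  obtain ⟨q, rfl⟩ := List.length_eq_one_iff.1 he
  refine ⟨fun s' => s'.length ≤ s.length,
    fun s' => if s'.head? = some true then s'.length else 0, le_rfl, ?_, ?_, ?_⟩
  · intro s' hs'; simp; split_ifs <;> omega
  · intro s' hs' hc
    simp only [List.getD_cons_zero] at hc
    obtain ⟨t, rfl⟩ : ∃ t, s' = true :: t := by
      cases s' with
      | nil => simp at hc
      | cons b t => exact ⟨t, by simp at hc; rw [hc]⟩
    have h1 := sndS_length t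
    have h2 := sndS_length (sndS t)
    have h3 := fstS_length (sndS t)
    simp only [List.length_cons] at hs'
    simp only [List.getD_cons_zero, List.getD_cons_succ, List.drop_one, List.tail_cons, hc]
    refine ⟨trivial, ?_, ?_, ?_⟩
    · split_ifs
      · simp; omega
      · omega
    · by_cases hf : fstS t = q
      · simp [hf]
      · simp only [if_neg hf, if_true, List.length_cons]
        split_ifs <;> omega
    · rw [lookS_true]
      split_ifs
      · exact lookS_stop (by simp)
      · rfl
  · intro s' hs' hc
    exact lookS_stop hc

theorem lookS_encT {n m : ℕ} (F : Bits n → Bits m) (L : List (Bits n)) (q : Str) :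
    lookS q (encT (L.map fun i => (List.ofFn i, List.ofFn (F i)))) =
      if ∃ i ∈ L, List.ofFn i = q then false :: asOracle F q else [] := by
  induction L with
  | nil => simp only [List.map_nil, encT, List.foldr_nil]; rw [lookS_stop] <;> simp
  | cons i L ih =>
    have : encT ((i :: L).map fun i => (List.ofFn i, List.ofFn (F i))) =
        true :: pairS (List.ofFn i) (pairS (List.ofFn (F i))
          (encT (L.map fun i => (List.ofFn i, List.ofFn (F i))))) := rfl
    rw [this, lookS_true, fstS_pairS, sndS_pairS, fstS_pairS, sndS_pairS, ih]
    by_cases h : List.ofFn i = q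
    · subst h
      simp [asOracle]
    · simp [h]

theorem asOracle_ofFn {n m : ℕ} (F : Bits n → Bits m) (x : Bits n) :
    asOracle F (List.ofFn x) = List.ofFn (F x) := by
  simp [asOracle]

theorem asOracle_eq_nil {n m : ℕ} (F : Bits n → Bits m) {q : Str} (h : q.length ≠ n) :
    asOracle F q = [] := by
  simp [asOracle, h]

/-- The answer to a query `q`, computed from the description of a circuit, the number of its inputs
in unary, and a table of exceptions. -/
def answerS (orc q : Str) : Str :=
  if lookS q (sndS (sndS orc)) = [] then
    if List.replicate q.length true = fstS (sndS orc) then fstS (evalS (fstS orc) q) else []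
  else (lookS q (sndS (sndS orc))).drop 1

theorem pf_answerS : PF 2 fun ins => answerS (ins.getD 0 []) (ins.getD 1 []) := by
  have ho : DF 2 (fun _ _ => True) fun _ ins => ins.getD 0 [] := DF.proj 0 (by simp)
  have hq : DF 2 (fun _ _ => True) fun _ ins => ins.getD 1 [] := DF.proj 1 (by simp)
  have hl : DF 2 (fun _ _ => True) fun _ ins => lookS (ins.getD 1 []) (sndS (sndS (ins.getD 0 []))) :=
    PF.comp2 pf_lookS ho.snd.snd hq
  exact DF.iteEq hl (DF.const []) (DF.iteEq hq.len ho.snd.fst (ho.fst.circuitEval hq).fst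
    (DF.const [])) hl.tail

/-- The description of the function of a circuit with its values on a set replaced. -/
noncomputable def encPatch {n m : ℕ} (C : Circuit n m) (I : Finset (Bits n)) (y : I → Bits m) : Str :=
  pairS C.encode (pairS (List.replicate n true)
    (encT (I.toList.map fun i => (List.ofFn i, List.ofFn (patch C.eval I y i)))))

theorem answerS_encPatch {n m : ℕ} (C : Circuit n m) (I : Finset (Bits n)) (y : I → Bits m)
    (q : Str) : answerS (encPatch C I y) q = asOracle (patch C.eval I y) q := by
  simp only [answerS, encPatch, fstS_pairS, sndS_pairS, lookS_encT, Finset.mem_toList]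
  by_cases h : ∃ i ∈ I, List.ofFn i = q
  · simp [h]
  · simp only [h, if_false, if_true]
    by_cases hq : q.length = n
    · obtain ⟨x', rfl⟩ : ∃ x' : Bits n, q = List.ofFn x' := by
        subst hq; exact ⟨q.get, (List.ofFn_get q).symm⟩
      rw [evalS_encode_eval, fstS_pairS, asOracle_ofFn, if_pos (by simp)]
      have : x' ∉ I := fun hx => h ⟨x', hx, rfl⟩
      simp [patch, this]
    · rw [if_neg, asOracle_eq_nil _ hq]
      intro h'
      exact hq (by simpa using congrArg List.length h')

/-! ### Composing a statement from the answers of an oracle -/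

/-- The description of a list of queries. -/
def encI (L : List Str) (r : Str) : Str := L.foldr (fun i r => true :: pairS i r) r

/-- Read a list of queries. -/
def itemsParse : Str → List Str × Str
  | true :: t => (fstS t :: (itemsParse (sndS t)).1, (itemsParse (sndS t)).2)
  | s => ([], s)
termination_by s => s.length
decreasing_by all_goals
  have h1 := sndS_length t
  simp; omega

/-- The remainder `r` must not look like a further query. -/
theorem itemsParse_encI (L : List Str) (r : Str) (hr : r.head? ≠ some true) :
    itemsParse (encI L r) = (L, r) := by
  induction L with
  | nil =>
    rcases r with _ | ⟨_ | _, s⟩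
    · simp only [encI, List.foldr_nil]; rw [itemsParse]; simp
    · simp only [encI, List.foldr_nil]; rw [itemsParse]; simp
    · simp at hr
  | cons i L ih =>
    have : encI (i :: L) r = true :: pairS i (encI L r) := rfl
    rw [this, itemsParse, sndS_pairS, fstS_pairS, ih]

theorem encI_append (L : List Str) (r u : Str) : encI L r ++ u = encI L (r ++ u) := by
  induction L with
  | nil => rfl
  | cons i L ih =>
    have h : ∀ r, encI (i :: L) r = true :: pairS i (encI L r) := fun _ => rfl
    rw [h, h, ← ih]
    simp [pairS]

theorem length_le_encI (L : List Str) (r : Str) : L.length + r.length ≤ (encI L r).length := by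
  induction L with
  | nil => simp [encI]
  | cons i L ih =>
    have h : encI (i :: L) r = true :: pairS i (encI L r) := rfl
    rw [h]; simp; omega

/-- Append the queries of a list, with the answers of the oracle, to the string behind the list. -/
def askAll (g : Orc) (s : Str) : Str :=
  (itemsParse s).2 ++ (itemsParse s).1.flatMap fun i => true :: (i ++ g i)

/-- The loop has as its state the remaining queries, followed by the string composed so far. The length
of the second input bounds the lengths of the answers, and so the running time. -/
theorem df_askAll : DF 2 (fun g ins => (∃ L acc z, ins = [encI L (false :: acc), z]) ∧
    ∀ q, (g q).length ≤ (ins.getD 1 []).length) fun g ins => askAll g (ins.getD 0 []) := by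
  let D : Orc → List Str → Prop := fun g ins => ∀ q, (g q).length ≤ (ins.getD 1 []).length
  have hs : DF (1 + 1) D fun _ ins => ins.getD 0 [] := DF.proj 0 (by simp)
  have hz : DF (1 + 1) D fun _ ins => ins.getD 1 [] := DF.proj 1 (by simp)
  have ha : DF (1 + 1) D fun g ins => g (fstS ((ins.getD 0 []).drop 1)) :=
    RPT.comp2 rpt_query hs.tail.fst hz fun g ins _ h => h
  have hbody := hs.tail.snd.append ((DF.const [true]).append (hs.tail.fst.append ha))
  refine RPT.while (Polynomial.X + Polynomial.X * Polynomial.X) hbody hs ?_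
  rintro g s e he ⟨⟨L₀, acc₀, z, hs⟩, hD⟩
  obtain ⟨rfl, rfl⟩ : s = encI L₀ (false :: acc₀) ∧ e = [z] := by simpa using hs
  simp only [List.getD_cons_succ, List.getD_cons_zero] at hD
  have hL₀ := length_le_encI L₀ (false :: acc₀)
  refine ⟨fun s => ∃ L acc, s = encI L (false :: acc) ∧ L.length ≤ L₀.length ∧
      s.length + L.length * z.length ≤ (encI L₀ (false :: acc₀)).length + L₀.length * z.length,
    fun s => (itemsParse s).1.length, ⟨L₀, acc₀, rfl, le_rfl, le_rfl⟩, ?_, ?_, ?_⟩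
  · rintro s ⟨L, acc, rfl, h1, h2⟩
    beta_reduce
    rw [itemsParse_encI _ _ (by simp)]
    simp only [totalLen_cons, totalLen_nil, Polynomial.eval_add, Polynomial.eval_mul,
      Polynomial.eval_X, Nat.add_zero]
    generalize (encI L₀ (false :: acc₀)).length = N at *
    have h3 : L₀.length * z.length ≤ (N + z.length) * (N + z.length) :=
      Nat.mul_le_mul (by omega) (by omega)
    refine ⟨by omega, by omega, ?_⟩
    simpa [D] using hD
  · rintro s ⟨L, acc, rfl, h1, h2⟩ hc
    simp only [List.getD_cons_zero] at hc
    cases L with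
    | nil => simp [encI] at hc
    | cons i L =>
      have h : encI (i :: L) (false :: acc) = true :: pairS i (encI L (false :: acc)) := rfl
      have hstep : sndS ((encI (i :: L) (false :: acc)).drop 1) ++
          ([true] ++ (fstS ((encI (i :: L) (false :: acc)).drop 1) ++
            g (fstS ((encI (i :: L) (false :: acc)).drop 1)))) =
          encI L (false :: (acc ++ (true :: (i ++ g i)))) := by
        rw [h]
        simp only [List.drop_one, List.tail_cons, sndS_pairS, fstS_pairS]
        rw [encI_append]
        simp
      simp only [List.getD_cons_zero, hstep]
      refine ⟨by simpa [D] using hD, ⟨_, _, rfl, by simp at h1; omega, ?_⟩, ?_, ?_⟩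
      · rw [← hstep, h]
        rw [h] at h2
        have := hD i
        simp [Nat.succ_mul] at h2 ⊢
        omega
      · rw [itemsParse_encI _ _ (by simp), itemsParse_encI _ _ (by simp)]; simp
      · simp only [askAll]
        rw [itemsParse_encI _ _ (by simp), itemsParse_encI _ _ (by simp)]; simp
  · rintro s ⟨L, acc, rfl, h1, h2⟩ hc
    simp only [List.getD_cons_zero] at hc ⊢
    cases L with
    | cons i L => simp [encI] at hc
    | nil => simp only [askAll]; rw [itemsParse_encI _ _ (by simp)]; simp [encI]

/-- The data from which a statement can be composed with the help of an oracle: the queries, and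
the beginning of the statement. -/
def encPlan (n m B : ℕ) (L : List (Bits n)) : Str :=
  encI (L.map fun i => List.ofFn i) (false :: (unary n ++ (unary m ++ unary B)))

/-- The statement that the oracle is computed by a small circuit on the given queries. -/
def stmtS (g : Orc) (plan : Str) : Str := (askAll g plan).drop 1 ++ [false]

theorem stmtS_encPlan {n m : ℕ} (B : ℕ) (L : List (Bits n)) (f : Bits n → Bits m) :
    stmtS (asOracle f) (encPlan n m B L) = encodeStmt n m B (L.map fun i => (i, f i)) := by
  simp only [stmtS, askAll, encPlan]
  rw [itemsParse_encI _ _ (by simp), encodeStmt_eq]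
  simp only [encP, List.flatMap_map, asOracle_ofFn]
  simp

/-! ### The algorithms of the reductions -/

/-- Decryption with the obfuscated circuit as a witness. -/
theorem exists_decryptor (Dec : PPT 2) : ∃ A : NonuniformPPT 2, ∀ k C c,
    A.exec k [C, c] = Dec.runBit [c, C] := by
  have h : RPT 4 (fun _ _ => True) fun _ ins => Dec.run [ins.getD 3 [], ins.getD 2 []] :=
    RPT.comp2 Dec.rpt (DF.proj 3 (by simp)) (DF.proj 2 (by simp)) fun _ _ _ _ => trivial
  obtain ⟨A, hA⟩ := RPT.exists_oraclePPT (n := fun _ => 0) (m := fun _ => 0) (a := 2) h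
    (fun _ => []) ⟨0, by simp⟩ fun _ _ _ _ => trivial
  exact ⟨A, fun k C c => hA k _ [C, c] rfl⟩

/-- The composition of a non-uniform adversary with the pairing by a fixed string, which is part of
the advice. -/
theorem exists_pairAdversary (A : NonuniformPPT 1) (x : ℕ → Str)
    (hx : ∃ p : Polynomial ℕ, ∀ k, (x k).length ≤ p.eval k) : ∃ A' : NonuniformPPT 1, ∀ k c,
    A'.exec k [c] = A.exec k [pairS (x k) c] := by
  obtain ⟨κ, hκ, hA⟩ := A.exists_rpt (PolyBdd.const 0)
  let adv : ℕ → Str := fun k => pairS (A.advice k) (x k)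
  have hadv : ∃ p : Polynomial ℕ, ∀ k, (adv k).length ≤ p.eval k := by
    obtain ⟨p, hp⟩ := A.advice_poly
    obtain ⟨q, hq⟩ := hx
    refine ⟨2 * p + q + 1, fun k => ?_⟩
    have := hp k
    have := hq k
    simp [adv]; omega
  have h : RPT 3 (AdvDom (n := fun _ => 0) (m := fun _ => 0) adv 1) fun g ins =>
      κ g [ins.getD 0 [], fstS (ins.getD 1 []), pairS (sndS (ins.getD 1 [])) (ins.getD 2 [])] := by
    refine RPT.comp3 hκ (DF.proj 0 (by simp)) (DF.proj 1 (by simp)).fst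
      ((DF.proj 1 (by simp)).snd.pair (DF.proj 2 (by simp))) ?_
    rintro g ins - ⟨k, f, ins', h1, rfl, rfl⟩
    obtain ⟨c, rfl⟩ := List.length_eq_one_iff.1 h1
    exact ⟨k, f, [pairS (x k) c], rfl, rfl, by simp [adv]⟩
  obtain ⟨A', hA'⟩ := RPT.exists_oraclePPT (n := fun _ => 0) (m := fun _ => 0) (a := 1) h adv hadv
    fun k f ins hi => ⟨k, f, ins, hi, rfl, rfl⟩
  refine ⟨A', fun k c => ?_⟩
  have h1 := hA' k (fun z => z) [c] rfl
  have h2 := hA k (fun z => z) [pairS (x k) c] rfl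
  rw [NonuniformPPT.exec, NonuniformPPT.exec, h1, ← h2]
  simp [adv]

/-- A non-uniform adversary without oracle that runs an oracle algorithm, where the oracle is given
by a circuit and a table, which are part of the advice. -/
theorem exists_simAdversary {n m : ℕ → ℕ} (hm : ∃ p : Polynomial ℕ, ∀ k, m k ≤ p.eval k)
    (S : OraclePPT n m 1) (C : ∀ k, Circuit (n k) (m k)) (I : ∀ k, Finset (Bits (n k)))
    (y : ∀ k, I k → Bits (m k))
    (hp : ∃ p : Polynomial ℕ, ∀ k, (encPatch (C k) (I k) (y k)).length ≤ p.eval k) :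
    ∃ A : NonuniformPPT 1, ∀ k c,
      A.exec k [c] = S.run k (patch (C k).eval (I k) (y k)) [c] := by
  obtain ⟨κ, hκ, hS⟩ := S.exists_rpt hm
  obtain ⟨pm, hpm⟩ := hm
  let orc : ℕ → Str := fun k => encPatch (C k) (I k) (y k)
  let adv : ℕ → Str := fun k => pairS (S.advice k) (orc k)
  have hadv : ∃ p : Polynomial ℕ, ∀ k, (adv k).length ≤ p.eval k := by
    obtain ⟨p, hp'⟩ := S.advice_poly
    obtain ⟨q, hq⟩ := hp
    refine ⟨2 * p + q + 1, fun k => ?_⟩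
    have h1 := hp' k
    have h2 := hq k
    simp [adv, orc]; omega
  have hfun : ∀ k, (fun q => answerS (([orc k, q] : List Str).getD 0 [])
      (([orc k, q] : List Str).getD 1 [])) = asOracle (patch (C k).eval (I k) (y k)) := fun k => by
    funext q; exact answerS_encPatch _ _ _ _
  have h₁ : RPT 4 (fun _ ins => ∃ k c, ins = [orc k, List.replicate k true, S.advice k, c])
      fun _ ins => κ (fun q => answerS (([ins.headD [], q] : List Str).getD 0 [])
        (([ins.headD [], q] : List Str).getD 1 [])) ins.tail := by
    refine RPT.substOracle pm hκ pf_answerS ?_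
    rintro g o ins - ⟨k, c, h⟩
    obtain ⟨rfl, rfl⟩ : o = orc k ∧ ins = [List.replicate k true, S.advice k, c] := by simpa using h
    rw [hfun k]
    refine ⟨⟨k, _, [c], rfl, rfl, rfl⟩, fun q => ⟨trivial, ?_⟩⟩
    have := congrFun (hfun k) q
    beta_reduce at this
    rw [this]
    refine (asOracle_length _ _).trans ((hpm k).trans (eval_mono _ ?_))
    simp; omega
  have h₂ : RPT 3 (AdvDom (n := fun _ => 0) (m := fun _ => 0) adv 1) fun _ ins =>
      κ (fun q => answerS (([sndS (ins.getD 1 []), q] : List Str).getD 0 [])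
        (([sndS (ins.getD 1 []), q] : List Str).getD 1 []))
        [ins.getD 0 [], fstS (ins.getD 1 []), ins.getD 2 []] := by
    have h2 : RPT 4 (fun _ ins => ∃ k c, ins = [orc k, List.replicate k true, adv k, c]) _ :=
      RPT.bind (D₁ := fun _ _ => True) ((DF.proj 2 (by simp)).fst : DF 4 _ _)
      (h₁.sel (a := 5)
        (D := fun _ ins => ∃ k c, ins = [S.advice k, orc k, List.replicate k true, adv k, c])
        [1, 2, 0, 4] (by simp) (by
          rintro g ins - ⟨k, c, rfl⟩
          exact ⟨k, c, by simp [sel]⟩)) (fun _ _ _ _ => trivial) (by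
        rintro g ins - ⟨k, c, rfl⟩ y hy
        rw [mem_support_pure_iff'] at hy
        subst hy
        exact ⟨k, c, by simp [adv]⟩)
    have h3 := RPT.bind (D := AdvDom (n := fun _ => 0) (m := fun _ => 0) adv 1)
      (D₁ := fun _ _ => True) ((DF.proj 1 (by simp)).snd : DF 3 _ _) h2
      (fun _ _ _ _ => trivial) (by
        rintro g ins - ⟨k, f, ins', h1, rfl, rfl⟩ y hy
        obtain ⟨c, rfl⟩ := List.length_eq_one_iff.1 h1
        rw [mem_support_pure_iff'] at hy
        subst hy
        exact ⟨k, c, by simp [adv]⟩)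
    refine h3.congr ?_
    rintro g ins - ⟨k, f, ins', h1, rfl, rfl⟩
    obtain ⟨c, rfl⟩ := List.length_eq_one_iff.1 h1
    refine ⟨⟨k, f, [c], rfl, rfl, rfl⟩, ?_⟩
    rw [PMF.pure_bind, PMF.pure_bind]
    simp [sel]
  obtain ⟨A, hA⟩ := RPT.exists_oraclePPT (n := fun _ => 0) (m := fun _ => 0) (a := 1) h₂ adv hadv
    fun k f ins hi => ⟨k, f, ins, hi, rfl, rfl⟩
  refine ⟨A, fun k c => ?_⟩
  have h1 := hA k (fun z => z) [c] rfl
  have h2 := hS k (patch (C k).eval (I k) (y k)) [c] rfl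
  rw [NonuniformPPT.exec, h1, ← h2]
  simp only [List.getD_cons_zero, List.getD_cons_succ, adv, sndS_pairS, fstS_pairS]
  have := hfun k
  simp only [List.getD_cons_zero, List.getD_cons_succ] at this
  rw [this]

section Experiment
variable {n m : ℕ → ℕ} (Enc : PPT 3) (S : OraclePPT n m 1) (B : ℕ → ℕ)
  (L : ∀ k, List (Bits (n k)))

/-- The output of `S` on an encryption of `b` under the statement that the function `f` is computed
by a small circuit on a list of arguments. -/
noncomputable def experiment (k : ℕ) (f : Bits (n k) → Bits (m k)) (b : Bool) : PMF Bool :=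
  (encrypt Enc k (encodeStmt (n k) (m k) (B k) ((L k).map fun i => (i, f i))) b).bind fun c =>
    S.run k f [c]

/-- Whether `S` decrypts a random bit correctly. -/
noncomputable def trial (k : ℕ) (f : Bits (n k) → Bits (m k)) : PMF Bool :=
  coin.bind fun b => (experiment Enc S B L k f b).map fun o => o == b

/-- The experiment can be carried out with oracle access to `f`. -/
theorem exists_experiment (hm : ∃ p : Polynomial ℕ, ∀ k, m k ≤ p.eval k)
    (hL : ∃ p : Polynomial ℕ, ∀ k, (encPlan (n k) (m k) (B k) (L k)).length ≤ p.eval k) :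
    ∃ (adv : ℕ → Str) (κ : Orc → List Str → PMF Str),
      (∃ p : Polynomial ℕ, ∀ k, (adv k).length ≤ p.eval k) ∧
      RPT 3 (fun g ins => ∃ b, ins.getD 0 [] = [b] ∧ AdvDom (n := n) (m := m) adv 0 g ins.tail) κ ∧
      ∀ k (f : Bits (n k) → Bits (m k)) b,
        (κ (asOracle f) [[b], List.replicate k true, adv k]).map (fun o => o.headD false) =
          experiment Enc S B L k f b := by
  obtain ⟨κ, hκ, hS⟩ := S.exists_rpt hm
  let plan : ℕ → Str := fun k => encPlan (n k) (m k) (B k) (L k)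
  let adv : ℕ → Str := fun k => pairS (S.advice k) (pairS (plan k) (List.replicate (m k) true))
  let D : Orc → List Str → Prop := fun g ins =>
    ∃ b, ins.getD 0 [] = [b] ∧ AdvDom (n := n) (m := m) adv 0 g ins.tail
  have hx : DF 3 D fun g ins => stmtS g (fstS (sndS (ins.getD 2 []))) := by
    refine DF.append (DF.tail ?_) (DF.const [false])
    refine RPT.comp2 df_askAll (DF.proj 2 (by simp)).snd.fst (DF.proj 2 (by simp)).snd.snd ?_
    rintro g ins ha ⟨b, hb, k, f, ins', h1, rfl, h2⟩
    obtain rfl := List.length_eq_zero_iff.1 h1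
    cases ins with
    | nil => simp at ha
    | cons c ins =>
      simp only [List.tail_cons] at h2
      subst h2
      refine ⟨⟨(L k).map fun i => List.ofFn i, unary (n k) ++ (unary (m k) ++ unary (B k)),
        List.replicate (m k) true, ?_⟩, fun q => ?_⟩
      · change [fstS (sndS (adv k)), sndS (sndS (adv k))] = _
        simp only [adv, plan, encPlan, sndS_pairS, fstS_pairS]
      · simpa [adv] using asOracle_length f q
  have henc : RPT 3 D fun g ins =>
      Enc.run [ins.getD 1 [], stmtS g (fstS (sndS (ins.getD 2 []))), ins.getD 0 []] :=
    RPT.comp3 Enc.rpt (DF.proj 1 (by simp)) hx (DF.proj 0 (by simp)) fun _ _ _ _ => trivial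
  have hrun : RPT 4 (fun g ins => D g ins.tail) fun g ins =>
      κ g [ins.getD 2 [], fstS (ins.getD 3 []), ins.getD 0 []] := by
    refine RPT.comp3 hκ (DF.proj 2 (by simp)) (DF.proj 3 (by simp)).fst (DF.proj 0 (by simp)) ?_
    rintro g ins ha ⟨b, hb, k, f, ins', h1, rfl, h2⟩
    obtain rfl := List.length_eq_zero_iff.1 h1
    obtain ⟨c, b', ins, rfl⟩ : ∃ c b' ins', ins = c :: b' :: ins' := by
      rcases ins with _ | ⟨c, _ | ⟨b', ins⟩⟩
      · simp at ha
      · simp at ha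
      · exact ⟨c, b', ins, rfl⟩
    simp only [List.tail_cons] at h2
    subst h2
    exact ⟨k, f, [c], rfl, rfl, by simp [adv]⟩
  have hall := RPT.bind (D := D) henc hrun (fun _ _ _ h => h) (fun _ _ _ h _ _ => h)
  refine ⟨adv, _, ?_, hall, fun k f b => ?_⟩
  · obtain ⟨p, hp⟩ := S.advice_poly
    obtain ⟨q, hq⟩ := hL
    obtain ⟨r, hr⟩ := hm
    refine ⟨2 * p + 2 * q + r + 2, fun k => ?_⟩
    have h1 := hp k
    have h2 := hq k
    have h3 := hr k
    simp [adv, plan]; omega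
  · rw [PMF.map_bind, experiment, encrypt]
    simp only [List.getD_cons_zero, List.getD_cons_succ, adv, fstS_pairS, sndS_pairS, plan,
      stmtS_encPlan]
    congr 1
    funext c
    exact hS k f [c] rfl

/-- A learner that carries out the experiment on an encryption of `b`, which it makes on its own. -/
theorem exists_learner (hm : ∃ p : Polynomial ℕ, ∀ k, m k ≤ p.eval k)
    (hL : ∃ p : Polynomial ℕ, ∀ k, (encPlan (n k) (m k) (B k) (L k)).length ≤ p.eval k)
    (b : Bool) :
    ∃ E : OraclePPT n m 0, ∀ k (f : Bits (n k) → Bits (m k)),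
      E.run k f [] = experiment Enc S B L k f b := by
  obtain ⟨adv, κ, hadv, hκ, h⟩ := exists_experiment Enc S B L hm hL
  have : RPT 2 (AdvDom (n := n) (m := m) adv 0) fun g ins => κ g [[b], ins.getD 0 [], ins.getD 1 []] :=
    RPT.comp3 hκ (DF.const [b]) (DF.proj 0 (by simp)) (DF.proj 1 (by simp)) (by
      rintro g ins ha ⟨k, f, ins', h1, rfl, rfl⟩
      obtain rfl := List.length_eq_zero_iff.1 h1
      exact ⟨b, rfl, k, f, [], rfl, rfl, rfl⟩)
  obtain ⟨E, hE⟩ := RPT.exists_oraclePPT (n := n) (m := m) (a := 0) this adv hadv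
    fun k f ins hi => ⟨k, f, ins, hi, rfl, rfl⟩
  refine ⟨E, fun k f => ?_⟩
  rw [hE k f [] rfl, ← h]
  rfl

/-- The distinguisher, which carries out the trial twice and compares the outcomes. -/
theorem exists_distinguisher (hm : ∃ p : Polynomial ℕ, ∀ k, m k ≤ p.eval k)
    (hL : ∃ p : Polynomial ℕ, ∀ k, (encPlan (n k) (m k) (B k) (L k)).length ≤ p.eval k) :
    ∃ E : OraclePPT n m 0, ∀ k (f : Bits (n k) → Bits (m k)),
      E.run k f [] = (trial Enc S B L k f).bind fun t => (trial Enc S B L k f).map fun t' => t == t' := by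
  obtain ⟨adv, κ, hadv, hκ, h⟩ := exists_experiment Enc S B L hm hL
  let D : Orc → List Str → Prop := AdvDom (n := n) (m := m) adv 0
  have hbit : DF 1 (fun _ _ => True) fun _ ins => [(ins.getD 0 []).headD false] :=
    (DF.ite (DF.proj 0 (by simp)) (DF.const [true]) (DF.const [false])).congr fun g ins _ _ =>
      ⟨trivial, by
        beta_reduce
        generalize ins.getD 0 [] = s
        rcases s with _ | ⟨_ | _, s⟩ <;> rfl⟩
  -- one trial
  have ht : RPT 2 D fun g ins => (coin.map fun b => [b]).bind fun b => (κ g (b :: ins)).bind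
      fun o => PMF.pure [decide ([o.headD false] = b)] := by
    have hr : RPT 3 (fun g ins => ∃ b, ins.getD 0 [] = [b] ∧ D g ins.tail) fun g ins =>
        (κ g ins).bind fun o => PMF.pure [decide ([o.headD false] = ins.getD 0 [])] :=
      (RPT.bind (D₂ := fun _ _ => True) (κ₂ := fun _ ins =>
          PMF.pure [decide ([(ins.getD 0 []).headD false] = ins.getD 1 [])]) hκ
        (DF.eq (RPT.comp1 hbit (DF.proj 0 (by simp)) fun _ _ _ _ => trivial)
          (DF.proj 1 (by simp)))
        (fun _ _ _ h => h) fun _ _ _ _ _ _ => trivial)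
    refine (RPT.bind (D := D) (D₁ := fun _ _ => True) (κ₁ := fun _ _ => coin.map fun b => [b])
      (rpt_coin.sel (a := 2) (D := fun _ _ => True) [] (by simp) fun _ _ _ _ => trivial)
      hr (fun _ _ _ _ => trivial) ?_)
    · intro g ins _ hD b hb
      rw [PMF.mem_support_map_iff] at hb
      obtain ⟨b, -, rfl⟩ := hb
      exact ⟨b, rfl, hD⟩
  have h2 : RPT 2 D fun g ins => _ :=
    RPT.bind (D := D) ht (RPT.bind (D := fun g ins => D g ins.tail)
      (ht.sel (a := 3) (D := fun g ins => D g ins.tail) [1, 2] (by simp) (by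
        intro g ins ha h
        obtain ⟨x, y, z, rfl⟩ := List.length_eq_three.1 ha
        exact h))
      (DF.eq (D := fun _ _ => True) (DF.proj 0 (by simp)) (DF.proj 1 (by simp)))
      (fun _ _ _ h => h) (fun _ _ _ _ _ _ => trivial)) (fun _ _ _ h => h)
      (fun _ _ _ h _ _ => h)
  obtain ⟨E, hE⟩ := RPT.exists_oraclePPT (n := n) (m := m) (a := 0) h2 adv hadv
    fun k f ins hi => ⟨k, f, ins, hi, rfl, rfl⟩
  refine ⟨E, fun k f => ?_⟩
  have key : ((coin.map fun b => [b]).bind fun b =>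
      (κ (asOracle f) (b :: [List.replicate k true, adv k])).bind
      fun o => PMF.pure [decide ([o.headD false] = b)]) =
      (trial Enc S B L k f).map fun t => [t] := by
    rw [trial, PMF.map_bind, PMF.bind_map]
    congr 1
    funext b
    rw [← h, PMF.map_comp, PMF.map_comp]
    simp only [Function.comp]
    rw [PMF.map]
    congr 1
    funext o
    simp only [Function.comp]
    congr 2
    cases o.headD false <;> cases b <;> rfl
  rw [hE k f [] rfl]
  simp only [sel, List.map_cons, List.map_nil, List.getD_cons_zero, List.getD_cons_succ]
  rw [key]
  simp only [PMF.bind_map, PMF.map_bind, PMF.pure_map, Function.comp_def]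
  congr 1
  funext t
  rw [PMF.map]
  congr 1
  funext t'
  simp only [Function.comp, List.headD_cons]
  congr 1
  cases t <;> cases t' <;> rfl

end Experiment

/-! ### Probabilities -/

theorem pr_nonneg (μ : PMF Bool) : 0 ≤ pr μ := ENNReal.toReal_nonneg

theorem pr_le_one (μ : PMF Bool) : pr μ ≤ 1 := by
  rw [pr, ← ENNReal.toReal_one]
  exact ENNReal.toReal_mono ENNReal.one_ne_top (μ.coe_le_one _)

theorem summable_toReal {α : Type*} (μ : PMF α) : Summable fun a => (μ a).toReal :=
  ENNReal.summable_toReal (by rw [μ.tsum_coe]; exact ENNReal.one_ne_top)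

theorem tsum_toReal {α : Type*} (μ : PMF α) : ∑' a, (μ a).toReal = 1 := by
  rw [← ENNReal.tsum_toReal_eq fun a => μ.apply_ne_top a, μ.tsum_coe, ENNReal.toReal_one]

theorem pr_bind {α : Type*} (μ : PMF α) (f : α → PMF Bool) :
    pr (μ.bind f) = ∑' a, (μ a).toReal * pr (f a) := by
  rw [pr, PMF.bind_apply, ENNReal.tsum_toReal_eq fun a =>
    ENNReal.mul_ne_top (μ.apply_ne_top a) ((f a).apply_ne_top _)]
  simp only [ENNReal.toReal_mul, pr]

theorem summable_pr {α : Type*} (μ : PMF α) (f : α → PMF Bool) :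
    Summable fun a => (μ a).toReal * pr (f a) :=
  (summable_toReal μ).of_nonneg_of_le (fun _ => mul_nonneg ENNReal.toReal_nonneg (pr_nonneg _))
    fun _ => mul_le_of_le_one_right ENNReal.toReal_nonneg (pr_le_one _)

theorem toReal_eq_zero_of_notMem {α : Type*} {μ : PMF α} {a : α} (h : a ∉ μ.support) :
    (μ a).toReal = 0 := by
  rw [(μ.apply_eq_zero_iff a).2 h, ENNReal.toReal_zero]

theorem le_pr_bind {α : Type*} {μ : PMF α} {f : α → PMF Bool} {c : ℝ}
    (h : ∀ a ∈ μ.support, c ≤ pr (f a)) : c ≤ pr (μ.bind f) := by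
  calc c = ∑' a, (μ a).toReal * c := by rw [tsum_mul_right, tsum_toReal, one_mul]
    _ ≤ _ := by
      rw [pr_bind]
      refine ((summable_toReal μ).mul_right c).tsum_le_tsum (fun a => ?_) (summable_pr μ f)
      by_cases ha : a ∈ μ.support
      · exact mul_le_mul_of_nonneg_left (h a ha) ENNReal.toReal_nonneg
      · simp [toReal_eq_zero_of_notMem ha]

/-- The advantage of an algorithm over another on a random input is attained on some input. -/
theorem exists_le_pr_sub {α : Type*} (μ : PMF α) (f h : α → PMF Bool) :
    ∃ a ∈ μ.support, pr (μ.bind f) - pr (μ.bind h) ≤ pr (f a) - pr (h a) := by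
  by_contra! hc
  obtain ⟨a₀, ha₀⟩ := μ.support_nonempty
  set c := pr (μ.bind f) - pr (μ.bind h)
  have hs : Summable fun a => (μ a).toReal * (pr (f a) - pr (h a)) := by
    simpa only [mul_sub] using (summable_pr μ f).sub (summable_pr μ h)
  have h1 : c = ∑' a, (μ a).toReal * (pr (f a) - pr (h a)) := by
    simp only [c, pr_bind, mul_sub]
    exact ((summable_pr μ f).tsum_sub (summable_pr μ h)).symm
  have h2 : ∑' a, (μ a).toReal * c = c := by rw [tsum_mul_right, tsum_toReal, one_mul]
  have h3 : ∑' a, (μ a).toReal * (pr (f a) - pr (h a)) < ∑' a, (μ a).toReal * c := by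
    refine Summable.tsum_lt_tsum (i := a₀) (fun a => ?_) ?_ hs ((summable_toReal μ).mul_right c)
    · by_cases ha : a ∈ μ.support
      · exact mul_le_mul_of_nonneg_left (hc a ha).le ENNReal.toReal_nonneg
      · simp [toReal_eq_zero_of_notMem ha]
    · exact mul_lt_mul_of_pos_left (hc a₀ ha₀)
        (ENNReal.toReal_pos ((μ.mem_support_iff a₀).1 ha₀) (μ.apply_ne_top a₀))
  linarith

/-- The expectation of a real random variable on a finite probability space. -/
def avg {α : Type*} [Fintype α] (μ : PMF α) (f : α → ℝ) : ℝ := ∑ a, (μ a).toReal * f a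

section Avg
variable {α : Type*} [Fintype α] (μ : PMF α)

theorem pr_bind_avg (f : α → PMF Bool) : pr (μ.bind f) = avg μ fun a => pr (f a) := by
  rw [pr_bind, tsum_fintype, avg]

theorem avg_const (c : ℝ) : avg μ (fun _ => c) = c := by
  rw [avg, ← Finset.sum_mul, ← tsum_fintype (L := .unconditional α), tsum_toReal, one_mul]

theorem avg_add (f h : α → ℝ) : avg μ (fun a => f a + h a) = avg μ f + avg μ h := by
  simp only [avg, mul_add, Finset.sum_add_distrib]

theorem avg_sub (f h : α → ℝ) : avg μ (fun a => f a - h a) = avg μ f - avg μ h := by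
  simp only [avg, mul_sub, Finset.sum_sub_distrib]

theorem avg_mul (c : ℝ) (f : α → ℝ) : avg μ (fun a => c * f a) = c * avg μ f := by
  simp only [avg, Finset.mul_sum]
  exact Finset.sum_congr rfl fun a _ => by ring

theorem avg_mono {f h : α → ℝ} (hf : ∀ a, f a ≤ h a) : avg μ f ≤ avg μ h :=
  Finset.sum_le_sum fun a _ => mul_le_mul_of_nonneg_left (hf a) ENNReal.toReal_nonneg

theorem avg_nonneg {f : α → ℝ} (hf : ∀ a, 0 ≤ f a) : 0 ≤ avg μ f :=
  Finset.sum_nonneg fun a _ => mul_nonneg ENNReal.toReal_nonneg (hf a)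

/-- The variance is nonnegative. -/
theorem sq_avg_le (f : α → ℝ) : avg μ f ^ 2 ≤ avg μ fun a => f a ^ 2 := by
  have h : 0 ≤ avg μ fun a => (f a - avg μ f) ^ 2 := avg_nonneg μ fun a => sq_nonneg _
  have h2 : avg μ (fun a => (f a - avg μ f) ^ 2) =
      avg μ (fun a => f a ^ 2) - 2 * avg μ f * avg μ f + avg μ f ^ 2 := by
    rw [← avg_mul, ← avg_sub]
    conv_rhs => rw [← avg_const μ (avg μ f ^ 2), ← avg_add]
    congr 1; funext a; ring
  nlinarith

/-- If no outcome is likely, then an event that consists of few outcomes is not likely. -/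
theorem avg_indicator_le {c : ℝ} (hc : ∀ a, (μ a).toReal ≤ c) (p : α → Prop) [DecidablePred p] :
    avg μ (fun a => if p a then 1 else 0) ≤ (Finset.univ.filter p).card * c := by
  simp only [avg, mul_ite, mul_one, mul_zero, ← Finset.sum_filter]
  rw [← nsmul_eq_mul]
  exact Finset.sum_le_card_nsmul _ _ _ fun a _ => hc a

end Avg

theorem pr_map_beq (μ : PMF Bool) (b : Bool) :
    pr (μ.map fun o => o == b) = if b then pr μ else 1 - pr μ := by
  have h1 := tsum_toReal μ
  rw [tsum_fintype, Fintype.sum_bool] at h1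
  rw [PMF.map, pr_bind_avg]
  cases b
  · simp [avg, pr]; linarith
  · simp [avg, pr]

theorem pr_coin_bind (f : Bool → PMF Bool) : pr (coin.bind f) = (pr (f true) + pr (f false)) / 2 := by
  rw [pr_bind_avg, avg, Fintype.sum_bool]
  simp [coin]
  ring

theorem pr_bind_eq (μ : PMF Bool) (f : Bool → PMF Bool) :
    pr (μ.bind f) = pr μ * pr (f true) + (1 - pr μ) * pr (f false) := by
  have h1 := tsum_toReal μ
  rw [tsum_fintype, Fintype.sum_bool] at h1
  have h2 : (μ false).toReal = 1 - pr μ := by rw [pr]; linarith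
  rw [pr_bind_avg, avg, Fintype.sum_bool, h2, ← pr]

/-! ### Negligible functions -/

theorem Negligible.add {f h : ℕ → ℝ} (hf : Negligible f) (hh : Negligible h) :
    Negligible fun k => f k + h k :=
  SuperpolynomialDecay.add hf hh

theorem Negligible.const_mul {f : ℕ → ℝ} (hf : Negligible f) (c : ℝ) : Negligible fun k => c * f k :=
  SuperpolynomialDecay.const_mul hf c

theorem Negligible.of_le {f h : ℕ → ℝ} (hh : Negligible h) (h0 : ∀ k, 0 ≤ f k)
    (hf : ∀ᶠ k in atTop, f k ≤ h k) : Negligible f :=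
  SuperpolynomialDecay.trans_eventually_abs_le hh (hf.mono fun k hk => by
    simp only [Function.comp]
    rw [abs_of_nonneg (h0 k)]
    exact hk.trans (le_abs_self _))

theorem Negligible.of_sq {f : ℕ → ℝ} (h0 : ∀ k, 0 ≤ f k) (hf : Negligible fun k => f k ^ 2) :
    Negligible f := by
  intro c
  have h := (hf (2 * c)).sqrt
  rw [Real.sqrt_zero] at h
  refine h.congr fun k => ?_
  rw [pow_mul', ← mul_pow, Real.sqrt_sq]
  have := h0 k
  positivity

theorem Negligible.sq {f : ℕ → ℝ} (hf : Negligible f) : Negligible fun k => f k ^ 2 := by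
  have h : Negligible fun k => f k * f k := SuperpolynomialDecay.mul hf hf
  simpa only [pow_two] using h

theorem negligible_half_pow : Negligible fun k => (1 / 2 : ℝ) ^ k := by
  intro c
  have := tendsto_pow_const_mul_const_pow_of_lt_one c (r := (1 / 2 : ℝ)) (by norm_num) (by norm_num)
  exact this

theorem Negligible.tendsto {f : ℕ → ℝ} (hf : Negligible f) : Tendsto f atTop (nhds 0) := by
  simpa using hf 0

/-! ### Witness encryption along a reduction -/

theorem RPT.length_le {a : ℕ} {D : Orc → List Str → Prop} {κ : Orc → List Str → PMF Str}
    (h : RPT a D κ) : ∃ p : Polynomial ℕ, ∀ g ins, ins.length = a → D g ins →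
      ∀ y ∈ (κ g ins).support, y.length ≤ p.eval (totalLen ins) := by
  obtain ⟨P, p, hP⟩ := h
  exact ⟨p, fun g ins ha hD => (hP g ins ha hD).2⟩

/-- A worst case, if there is any case at all. -/
theorem exists_worst {α : Type*} [Inhabited α] (s : Set α) (hs : s.Finite) (δ : α → ℝ) :
    ∃ x, s.Nonempty → x ∈ s ∧ ∀ y ∈ s, δ y ≤ δ x := by
  by_cases h : s.Nonempty
  · obtain ⟨x, hx⟩ := Set.exists_max_image s δ hs h
    exact ⟨x, fun _ => hx⟩
  · exact ⟨default, fun h' => absurd h' h⟩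

/-- Witness encryption for a language gives witness encryption for every language that reduces to
it. The ciphertext carries the original statement, which is needed to translate the witness. -/
theorem IsWitnessEncryption.of_reduces {R R' : Str → Str → Prop} (hred : Reduces R' R)
    {Enc : PPT 3} {Dec : PPT 2} (hWE : IsWitnessEncryption R Enc Dec) :
    ∃ (Enc' : PPT 3) (Dec' : PPT 2), IsWitnessEncryption R' Enc' Dec' := by
  obtain ⟨f, g, hf, hg, hlang, hwit⟩ := hred
  replace hf := hf.pf
  replace hg := hg.pf
  have hE : RPT 3 (fun _ _ => True) fun _ ins =>
      (Enc.run [ins.getD 0 [], f [ins.getD 1 []], ins.getD 2 []]).bind fun c =>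
        PMF.pure (pairS ((c :: ins).getD 2 []) ((c :: ins).getD 0 [])) :=
    RPT.bind (D := fun _ _ => True)
      (RPT.comp3 Enc.rpt (DF.proj 0 (by simp))
        (RPT.comp1 hf (DF.proj 1 (by simp)) fun _ _ _ _ => trivial) (DF.proj 2 (by simp))
        fun _ _ _ _ => trivial)
      ((DF.proj 2 (by simp)).pair (DF.proj 0 (by simp)) : DF 4 (fun _ _ => True) _)
      (fun _ _ _ _ => trivial) (fun _ _ _ _ _ _ => trivial)
  have hD : RPT 2 (fun _ _ => True) fun _ ins =>
      Dec.run [sndS (ins.getD 0 []), g [fstS (ins.getD 0 []), ins.getD 1 []]] :=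
    RPT.comp2 Dec.rpt (DF.proj 0 (by simp)).snd
      (RPT.comp2 hg (DF.proj 0 (by simp)).fst (DF.proj 1 (by simp)) fun _ _ _ _ => trivial)
      fun _ _ _ _ => trivial
  obtain ⟨Enc', hEnc⟩ := hE.exists_ppt fun _ _ => trivial
  obtain ⟨Dec', hDec⟩ := hD.exists_ppt fun _ _ => trivial
  have henc : ∀ k x b, encrypt Enc' k x b = (encrypt Enc k (f [x]) b).map (pairS x) := by
    intro k x b
    rw [encrypt, hEnc _ rfl]
    rfl
  obtain ⟨p, hp⟩ := hf.length_le
  have hfl : ∀ (q : Polynomial ℕ) k x, x.length ≤ q.eval k →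
      (f [x]).length ≤ (p.comp q).eval k := by
    intro q k x hx
    refine (hp noOracle [x] rfl trivial _ (mem_support_pure_iff'.2 rfl)).trans ?_
    rw [Polynomial.eval_comp]
    exact eval_mono p (by simpa using hx)
  refine ⟨Enc', Dec', fun q => ?_, fun A q => ?_⟩
  · obtain ⟨ν, hν, h⟩ := hWE.1 (p.comp q)
    refine ⟨ν, hν, fun k x w b hR hx => ?_⟩
    have := h k (f [x]) (g [x, w]) b (hwit x w hR) (hfl q k x hx)
    rw [henc, PMF.bind_map]
    convert this using 5 with c
    simp only [Function.comp, PPT.runBit]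
    rw [hDec _ rfl]
    simp
  · classical
    -- the statement for which the advantage of the adversary is largest
    let s : ℕ → Set Str := fun k => {x | (¬ ∃ w, R' x w) ∧ x.length ≤ q.eval k}
    let adv : ℕ → Str → ℝ := fun k x =>
      |pr ((encrypt Enc' k x false).bind fun c => A.exec k [c]) -
        pr ((encrypt Enc' k x true).bind fun c => A.exec k [c])|
    have hfin : ∀ k, (s k).Finite := fun k =>
      (List.finite_length_le Bool (q.eval k)).subset fun x hx => hx.2
    choose x hx using fun k => exists_worst (s k) (hfin k) (adv k)
    have hxl : ∃ p : Polynomial ℕ, ∀ k, (if (s k).Nonempty then x k else []).length ≤ p.eval k := by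
      refine ⟨q, fun k => ?_⟩
      split_ifs with hk
      · exact (hx k hk).1.2
      · simp
    obtain ⟨A', hA'⟩ := exists_pairAdversary A _ hxl
    obtain ⟨ν, hν, h⟩ := hWE.2 A' (p.comp q)
    refine ⟨ν, hν, fun k y hy hyl => ?_⟩
    have hk : (s k).Nonempty := ⟨y, hy, hyl⟩
    obtain ⟨h1, h2⟩ := hx k hk
    have h3 := h k (f [x k]) (by rw [← hlang]; exact h1.1) (hfl q k _ h1.2)
    refine (h2 y ⟨hy, hyl⟩).trans (le_trans (le_of_eq ?_) h3)
    simp only [adv, henc, PMF.bind_map, hA', if_pos hk]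
    rfl

/-! ### Sizes of descriptions and the number of small circuits -/

theorem length_unary (i : ℕ) : (unary i).length = i + 1 := by simp [unary]

theorem Circuit.inputs_le_size {n m : ℕ} (C : Circuit n m) : n ≤ C.size := by
  simp [Circuit.size, Circuit.encode, length_unary]; omega

theorem Circuit.outputs_le_size {n m : ℕ} (C : Circuit n m) : m ≤ C.size := by
  have h : ∀ l : List ℕ, l.length ≤ (l.flatMap fun o => true :: unary o).length := by
    intro l
    induction l with
    | nil => simp
    | cons a l ih => rw [List.flatMap_cons, List.length_append]; simp; omega
  have := h (List.ofFn C.outs)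
  rw [List.length_ofFn] at this
  simp only [Circuit.size, Circuit.encode, List.length_append]
  omega

theorem length_encodeStmt {n m : ℕ} (B : ℕ) (pts : List (Bits n × Bits m)) :
    (encodeStmt n m B pts).length = n + m + B + pts.length * (n + m + 1) + 4 := by
  have : (encP pts).length = pts.length * (n + m + 1) := by
    induction pts with
    | nil => simp [encP]
    | cons q pts ih =>
      rw [encP, List.flatMap_cons, List.length_append, ← encP, ih]
      simp
      ring
  rw [encodeStmt_eq]
  simp only [List.length_append, length_unary, this, List.length_singleton]
  omega

theorem length_encPlan {n : ℕ} (m B : ℕ) (L : List (Bits n)) :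
    (encPlan n m B L).length = n + m + B + L.length * (2 * n + 2) + 4 := by
  have h : ∀ r, (encI (L.map fun i => List.ofFn i) r).length = L.length * (2 * n + 2) + r.length := by
    intro r
    induction L with
    | nil => simp [encI]
    | cons i L ih =>
      have h : encI ((i :: L).map fun i => List.ofFn i) r =
        true :: pairS (List.ofFn i) (encI (L.map fun i => List.ofFn i) r) := rfl
      rw [h, List.length_cons, length_pairS, ih]
      simp
      ring
  rw [encPlan, h]
  simp only [List.length_cons, List.length_append, length_unary]
  omega

theorem length_encPatch {n m : ℕ} (C : Circuit n m) (I : Finset (Bits n)) (y : I → Bits m) :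
    (encPatch C I y).length = 2 * C.size + 2 * n + I.card * (2 * n + 2 * m + 3) + 2 := by
  have h : ∀ L : List (Bits n), (encT (L.map fun i =>
      (List.ofFn i, List.ofFn (patch C.eval I y i)))).length = L.length * (2 * n + 2 * m + 3) := by
    intro L
    induction L with
    | nil => simp [encT]
    | cons i L ih =>
      have h : encT ((i :: L).map fun i => (List.ofFn i, List.ofFn (patch C.eval I y i))) =
        true :: pairS (List.ofFn i) (pairS (List.ofFn (patch C.eval I y i))
          (encT (L.map fun i => (List.ofFn i, List.ofFn (patch C.eval I y i))))) := rfl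
      rw [h, List.length_cons, length_pairS, length_pairS, ih]
      simp
      ring
  rw [encPatch, length_pairS, length_pairS, h, Finset.length_toList, List.length_replicate,
    Circuit.size]
  omega

theorem unary_append_inj {i j : ℕ} {s t : Str} (h : unary i ++ s = unary j ++ t) :
    i = j ∧ s = t := by
  constructor
  · have := congrArg (fun u => (onesS u).length) h
    simpa [onesS_unary] using this
  · have := congrArg restS h
    simpa [restS_unary] using this

theorem encP_inj {n m : ℕ} {p p' : List (Bits n × Bits m)}
    (h : encP p ++ [false] = encP p' ++ [false]) : p = p' := by
  have hc : ∀ (q : Bits n × Bits m) l, encP (q :: l) ++ [false] =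
      true :: (List.ofFn q.1 ++ (List.ofFn q.2 ++ (encP l ++ [false]))) := by
    intro q l
    simp [encP]
  induction p generalizing p' with
  | nil =>
    cases p' with
    | nil => rfl
    | cons q' p' => rw [hc] at h; simp [encP] at h
  | cons q p ih =>
    cases p' with
    | nil => rw [hc] at h; simp [encP] at h
    | cons q' p' =>
      rw [hc, hc, List.cons.injEq] at h
      obtain ⟨h1, h2⟩ := List.append_inj h.2 (by simp)
      obtain ⟨h3, h4⟩ := List.append_inj h2 (by simp)
      rw [ih h4, Prod.ext (List.ofFn_injective h1) (List.ofFn_injective h3)]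

/-- A statement is the description of a unique set of data. -/
theorem exists_circuit_of_rel {n m B : ℕ} {pts : List (Bits n × Bits m)} {w : Str}
    (h : SmallCircuitRel (encodeStmt n m B pts) w) :
    ∃ C : Circuit n m, w = C.encode ∧ C.size ≤ B ∧ ∀ q ∈ pts, C.eval q.1 = q.2 := by
  obtain ⟨n', m', B', pts', C, hx, hw, hB, hC⟩ := h
  rw [encodeStmt_eq, encodeStmt_eq] at hx
  obtain ⟨rfl, h1⟩ := unary_append_inj hx
  obtain ⟨rfl, h2⟩ := unary_append_inj h1
  obtain ⟨rfl, h3⟩ := unary_append_inj h2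
  obtain rfl := encP_inj h3
  exact ⟨C, hw, hB, hC⟩

theorem card_strings_le (B : ℕ) : ∃ s : Finset Str, (∀ w : Str, w.length ≤ B → w ∈ s) ∧
    s.card ≤ 2 ^ (B + 1) := by
  refine ⟨(Finset.range (B + 1)).biUnion fun l =>
    Finset.univ.image (List.ofFn : Bits l → List Bool), fun w hw => ?_, ?_⟩
  · simp only [Finset.mem_biUnion, Finset.mem_range, Finset.mem_image, Finset.mem_univ, true_and]
    exact ⟨w.length, by omega, w.get, List.ofFn_get w⟩
  · refine Finset.card_biUnion_le.trans ?_
    calc ∑ l ∈ Finset.range (B + 1), (Finset.univ.image (List.ofFn : Bits l → List Bool)).card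
        ≤ ∑ l ∈ Finset.range (B + 1), 2 ^ l := Finset.sum_le_sum fun l _ =>
          Finset.card_image_le.trans (by simp)
      _ ≤ 2 ^ (B + 1) := (Nat.geomSum_lt le_rfl fun l hl => Finset.mem_range.1 hl).le

/-- Few tuples of values on `I` are computed by a small circuit, because the circuit determines the
values. -/
theorem card_computable_le {n m : ℕ} (B : ℕ) (I : Finset (Bits n)) (f : Bits n → Bits m)
    (p : (I → Bits m) → Prop) [DecidablePred p]
    (hp : ∀ y, p y → ∃ w, SmallCircuitRel
      (encodeStmt n m B (I.toList.map fun i => (i, patch f I y i))) w) :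
    (Finset.univ.filter p).card ≤ 2 ^ (B + 1) := by
  have h : ∀ y, p y → ∃ C : Circuit n m, C.size ≤ B ∧ ∀ i : I, C.eval i = y i := by
    intro y hy
    obtain ⟨w, hw⟩ := hp y hy
    obtain ⟨C, -, hB, hC⟩ := exists_circuit_of_rel hw
    refine ⟨C, hB, fun i => ?_⟩
    have := hC (i, patch f I y i) (List.mem_map.2 ⟨i, Finset.mem_toList.2 i.2, rfl⟩)
    simpa [patch] using this
  have : Nonempty (Circuit n m) := ⟨⟨[], fun _ => 0⟩⟩
  choose! C hB hC using h
  obtain ⟨s, hs, hcard⟩ := card_strings_le B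
  refine (Finset.card_le_card_of_injOn (fun y => (C y).encode) (fun y hy => ?_) ?_).trans hcard
  · exact hs _ (hB y (by simpa using hy))
  · intro y hy y' hy' hyy
    have h1 := encode_injective hyy
    funext i
    rw [← hC y (by simpa using hy) i, ← hC y' (by simpa using hy') i, h1]

/-! ### The advantage of a simulator -/

section Gain
variable {n m : ℕ → ℕ} (Enc : PPT 3) (S : OraclePPT n m 1) (B : ℕ → ℕ)
  (L : ∀ k, List (Bits (n k)))

/-- The advantage of `S` in telling the two bits apart. -/
noncomputable def gain (k : ℕ) (f : Bits (n k) → Bits (m k)) : ℝ :=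
  pr (experiment Enc S B L k f true) - pr (experiment Enc S B L k f false)

theorem abs_gain_le_one (k : ℕ) (f : Bits (n k) → Bits (m k)) : |gain Enc S B L k f| ≤ 1 := by
  have h1 := pr_nonneg (experiment Enc S B L k f true)
  have h2 := pr_nonneg (experiment Enc S B L k f false)
  have h3 := pr_le_one (experiment Enc S B L k f true)
  have h4 := pr_le_one (experiment Enc S B L k f false)
  rw [gain, abs_le]
  constructor <;> linarith

theorem pr_trial (k : ℕ) (f : Bits (n k) → Bits (m k)) :
    pr (trial Enc S B L k f) = 1 / 2 + 1 / 2 * gain Enc S B L k f := by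
  rw [trial, pr_coin_bind, pr_map_beq, pr_map_beq, gain]
  simp
  ring

/-- The distinguisher accepts with probability `1 / 2` plus half the square of the advantage, so
that advantages of different signs do not cancel. -/
theorem pr_trial_eq_trial (k : ℕ) (f : Bits (n k) → Bits (m k)) :
    pr ((trial Enc S B L k f).bind fun t => (trial Enc S B L k f).map fun t' => t == t') =
      1 / 2 + 1 / 2 * gain Enc S B L k f ^ 2 := by
  have h : ∀ t : Bool, ((trial Enc S B L k f).map fun t' => t == t') =
      (trial Enc S B L k f).map fun t' => t' == t := fun t => by
    congr 1; funext t'; exact Bool.beq_comm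
  rw [pr_bind_eq, h, h, pr_map_beq, pr_map_beq, pr_trial]
  simp
  ring

end Gain

namespace CircuitFamily
variable (F : CircuitFamily)

theorem poly_inLen : PolyBdd F.inLen := by
  obtain ⟨p, hp⟩ := F.poly_size
  exact ⟨p, fun k => (F.circ k fun _ => false).inputs_le_size.trans (hp k _)⟩

theorem poly_outLen : PolyBdd F.outLen := by
  obtain ⟨p, hp⟩ := F.poly_size
  exact ⟨p, fun k => (F.circ k fun _ => false).outputs_le_size.trans (hp k _)⟩

variable {F} {I : ∀ k, Finset (Bits (F.inLen k))} (B : Polynomial ℕ)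

theorem poly_encodeStmt (hI : PolyBdd fun k => (I k).card) : ∃ q : Polynomial ℕ, ∀ k
    (f : Bits (F.inLen k) → Bits (F.outLen k)), (encodeStmt (F.inLen k) (F.outLen k) (B.eval k)
      ((I k).toList.map fun i => (i, f i))).length ≤ q.eval k := by
  obtain ⟨q, hq⟩ := ((((F.poly_inLen.add F.poly_outLen).add (PolyBdd.eval B .id)).add
    (hI.mul ((F.poly_inLen.add F.poly_outLen).add (.const 1)))).add (.const 4))
  refine ⟨q, fun k f => le_trans (le_of_eq ?_) (hq k)⟩
  rw [length_encodeStmt]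
  simp

theorem poly_encPlan (hI : PolyBdd fun k => (I k).card) : PolyBdd fun k =>
    (encPlan (F.inLen k) (F.outLen k) (B.eval k) (I k).toList).length := by
  obtain ⟨q, hq⟩ := ((((F.poly_inLen.add F.poly_outLen).add (PolyBdd.eval B .id)).add
    (hI.mul (((PolyBdd.const 2).mul F.poly_inLen).add (.const 2)))).add (.const 4))
  refine ⟨q, fun k => le_trans (le_of_eq ?_) (hq k)⟩
  beta_reduce
  rw [length_encPlan]
  simp

theorem poly_encPatch (hI : PolyBdd fun k => (I k).card) (s : ∀ k, Bits k)
    (y : ∀ k, I k → Bits (F.outLen k)) :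
    PolyBdd fun k => (encPatch (F.circ k (s k)) (I k) (y k)).length := by
  obtain ⟨p, hp⟩ := F.poly_size
  obtain ⟨q, hq⟩ := (((PolyBdd.const 2).mul ⟨p, fun k => hp k (s k)⟩).add
    ((PolyBdd.const 2).mul F.poly_inLen)).add ((hI.mul ((((PolyBdd.const 2).mul F.poly_inLen).add
      ((PolyBdd.const 2).mul F.poly_outLen)).add (.const 3))).add (.const 2))
  refine ⟨q, fun k => le_trans (le_of_eq ?_) (hq k)⟩
  beta_reduce
  rw [length_encPatch]
  ring

variable {B} {Enc : PPT 3} {Dec : PPT 2}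

/-- Where the patched function is not computed by a small circuit on `I`, the statement is false,
and the advantage is negligible because the encryption is secure. -/
theorem gain_patch_le (hWE : IsWitnessEncryption SmallCircuitRel Enc Dec) (S : F.Alg 1)
    (hI : PolyBdd fun k => (I k).card) : ∃ ν, Negligible ν ∧ ∀ k s y,
    (¬ ∃ w, SmallCircuitRel (encodeStmt (F.inLen k) (F.outLen k) (B.eval k)
      ((I k).toList.map fun i => (i, patch (F.fn k s) (I k) y i))) w) →
    |gain Enc S (fun k => B.eval k) (fun k => (I k).toList) k (patch (F.fn k s) (I k) y)| ≤ ν k := by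
  -- the function for which the advantage is largest becomes part of the advice
  have hw := fun k => exists_worst {z : Bits k × (I k → Bits (F.outLen k)) |
    ¬ ∃ w, SmallCircuitRel (encodeStmt (F.inLen k) (F.outLen k) (B.eval k)
      ((I k).toList.map fun i => (i, patch (F.fn k z.1) (I k) z.2 i))) w} (Set.toFinite _)
    fun z => |gain Enc S (fun k => B.eval k) (fun k => (I k).toList) k
      (patch (F.fn k z.1) (I k) z.2)|
  choose z hz using hw
  obtain ⟨A, hA⟩ := exists_simAdversary F.poly_outLen S (fun k => F.circ k (z k).1) I
    (fun k => (z k).2) (poly_encPatch hI _ _)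
  obtain ⟨q, hq⟩ := poly_encodeStmt B hI
  obtain ⟨ν, hν, h⟩ := hWE.2 A q
  refine ⟨ν, hν, fun k s y hy => ?_⟩
  obtain ⟨h1, h2⟩ := hz k ⟨(s, y), hy⟩
  refine (h2 (s, y) hy).trans ?_
  have h3 := h k _ h1 (hq k _)
  rw [abs_sub_comm] at h3
  simp only [hA] at h3
  exact h3

/-- The advantage of every simulator is negligible on average over the family: by pseudo-entropy the
mean square of the advantage hardly changes when the values on `I` are replaced by random ones, which
are too unpredictable to be those of a small circuit. -/
theorem negligible_gain (hWE : IsWitnessEncryption SmallCircuitRel Enc Dec) (S : F.Alg 1)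
    (hI : F.HasPseudoEntropyOn I fun k => B.eval k + k) :
    Negligible fun k => avg (unif k) fun s =>
      |gain Enc S (fun k => B.eval k) (fun k => (I k).toList) k (F.fn k s)| := by
  classical
  obtain ⟨hcard, Y, hY, hD⟩ := hI
  obtain ⟨ν, hν, hg⟩ := gain_patch_le (B := B) hWE S hcard
  obtain ⟨E, hE⟩ := exists_distinguisher Enc S (fun k => B.eval k) (fun k => (I k).toList)
    F.poly_outLen (poly_encPlan B hcard)
  have hη := hD E
  set G : ∀ k, (Bits (F.inLen k) → Bits (F.outLen k)) → ℝ :=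
    gain Enc S (fun k => B.eval k) (fun k => (I k).toList) with hG
  simp only [hE, pr_bind_avg (unif _), pr_bind_avg (Y _ _), pr_trial_eq_trial, avg_add, avg_const, avg_mul, ← hG] at hη
  refine Negligible.of_sq (fun k => avg_nonneg _ fun s => abs_nonneg _) ?_
  refine Negligible.of_le ((hη.const_mul 2).add (hν.sq.add (negligible_half_pow.const_mul 2)))
    (fun k => sq_nonneg _) ?_
  filter_upwards [hY] with k hk
  have hpatch : ∀ s, avg (Y k s) (fun y => G k (patch (F.fn k s) (I k) y) ^ 2) ≤
      ν k ^ 2 + 2 * (1 / 2) ^ k := by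
    intro s
    let p : (I k → Bits (F.outLen k)) → Prop := fun y =>
      ∃ w, SmallCircuitRel (encodeStmt (F.inLen k) (F.outLen k) (B.eval k)
        ((I k).toList.map fun i => (i, patch (F.fn k s) (I k) y i))) w
    have h1 : ∀ y, G k (patch (F.fn k s) (I k) y) ^ 2 ≤ ν k ^ 2 + if p y then 1 else 0 := by
      intro y
      rw [← sq_abs]
      split_ifs with hp
      · have := abs_gain_le_one Enc S (fun k => B.eval k) (fun k => (I k).toList) k
          (patch (F.fn k s) (I k) y)
        have := pow_le_one₀ (n := 2) (abs_nonneg _) this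
        have := sq_nonneg (ν k)
        linarith
      · rw [add_zero]
        exact pow_le_pow_left₀ (abs_nonneg _) (hg k s y hp) 2
    have h2 := avg_indicator_le (Y k s) (hk s) p
    have h3 : ((Finset.univ.filter p).card : ℝ) ≤ 2 ^ (B.eval k + 1) := by
      exact_mod_cast card_computable_le (B.eval k) (I k) (F.fn k s) p fun y hy => hy
    have h4 : (2 : ℝ) ^ (B.eval k + 1) * (1 / 2) ^ (B.eval k + k) = 2 * (1 / 2) ^ k := by
      rw [pow_succ, pow_add, one_div, inv_pow, inv_pow]
      field_simp
    calc _ ≤ avg (Y k s) (fun y => ν k ^ 2 + if p y then 1 else 0) := avg_mono _ h1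
      _ = ν k ^ 2 + avg (Y k s) (fun y => if p y then 1 else 0) := by rw [avg_add, avg_const]
      _ ≤ _ := by
        have : ((Finset.univ.filter p).card : ℝ) * (1 / 2) ^ (B.eval k + k) ≤
          2 ^ (B.eval k + 1) * (1 / 2) ^ (B.eval k + k) := by gcongr
        linarith
  have h5 := avg_mono (unif k) hpatch
  rw [avg_const] at h5
  have h6 := sq_avg_le (unif k) fun s => |G k (F.fn k s)|
  simp only [sq_abs] at h6
  have h7 := le_abs_self (1 / 2 + 1 / 2 * avg (unif k) (fun s => G k (F.fn k s) ^ 2) -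
    (1 / 2 + 1 / 2 * avg (unif k) fun s => avg (Y k s) fun y => G k (patch (F.fn k s) (I k) y) ^ 2))
  linarith

end CircuitFamily

/-! ### Obfuscated circuits decrypt, simulators do not -/

namespace CircuitFamily
variable {F : CircuitFamily} {I : ∀ k, Finset (Bits (F.inLen k))} {B : Polynomial ℕ}
  {Enc : PPT 3} {Dec : PPT 2} {Obf : F.Obf}

/-- The obfuscated circuit is a witness for the statement. -/
theorem exists_obfuscation_decryptor (hWE : IsWitnessEncryption SmallCircuitRel Enc Dec)
    (hO : F.IsCandidate Obf) (hB : ∀ k s, ∀ C ∈ (Obf k (F.circ k s)).support, C.size ≤ B.eval k)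
    (hI : PolyBdd fun k => (I k).card) : ∃ A : NonuniformPPT 2, ∃ ν, Negligible ν ∧ ∀ k s b,
      1 - ν k ≤ pr ((encrypt Enc k (F.stmt k (B.eval k) (I k) s) b).bind fun c =>
        (Obf k (F.circ k s)).bind fun C => (A.exec k [C.encode, c]).map fun o => o == b) := by
  obtain ⟨A, hA⟩ := exists_decryptor Dec
  obtain ⟨q, hq⟩ := poly_encodeStmt (F := F) B hI
  obtain ⟨ν, hν, h⟩ := hWE.1 q
  refine ⟨A, ν, hν, fun k s b => ?_⟩
  rw [PMF.bind_comm]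
  refine le_pr_bind fun C hC => ?_
  simp only [hA]
  refine h k _ C.encode b ⟨_, _, _, _, C, rfl, rfl, hB k s C hC, ?_⟩ (hq k (F.fn k s))
  intro z hz
  obtain ⟨i, -, rfl⟩ := List.mem_map.1 hz
  funext j
  rw [hO.1 k s C hC i]

/-- Decrypting a random bit is the same as guessing, up to half the advantage. -/
theorem prSim_auxRandom (S : F.Alg 1) (k : ℕ) :
    F.prSim S k (F.auxRandom Enc k (B.eval k) (I k)) = 1 / 2 + 1 / 2 * avg (unif k) fun s =>
      gain Enc S (fun k => B.eval k) (fun k => (I k).toList) k (F.fn k s) := by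
  have h : ∀ s, ((F.auxRandom Enc k (B.eval k) (I k) s).bind fun z =>
      (S.run k (F.fn k s) [z.1]).map fun o => o == z.2) =
      trial Enc S (fun k => B.eval k) (fun k => (I k).toList) k (F.fn k s) := by
    intro s
    simp only [auxRandom, trial, experiment, PMF.bind_bind, PMF.bind_map, PMF.map_bind]
    rfl
  simp only [prSim, h, pr_bind_avg, pr_trial, avg_add, avg_mul, avg_const]

/-- A simulator that gets an encryption of `π(s)` does not do much better than the learner that runs
it on an encryption of `0`. -/
theorem prSim_auxPred_le (S : F.Alg 1) (k : ℕ) (π : Bits k → Bool) :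
    F.prSim S k (F.auxPred Enc k (B.eval k) (I k) π) ≤
      pr ((unif k).bind fun s => (experiment Enc S (fun k => B.eval k) (fun k => (I k).toList) k
        (F.fn k s) false).map fun o => o == π s) +
      avg (unif k) fun s =>
        |gain Enc S (fun k => B.eval k) (fun k => (I k).toList) k (F.fn k s)| := by
  have h : ∀ s, ((F.auxPred Enc k (B.eval k) (I k) π s).bind fun z =>
      (S.run k (F.fn k s) [z.1]).map fun o => o == z.2) =
      (experiment Enc S (fun k => B.eval k) (fun k => (I k).toList) k (F.fn k s) (π s)).map
        fun o => o == π s := by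
    intro s
    simp only [auxPred, experiment, PMF.bind_map, PMF.map_bind]
    rfl
  simp only [prSim, h]
  rw [pr_bind_avg, pr_bind_avg, ← avg_add]
  refine avg_mono _ fun s => ?_
  rw [pr_map_beq, pr_map_beq]
  cases π s
  · simp
  · simp only [if_true]
    have := le_abs_self (gain Enc S (fun k => B.eval k) (fun k => (I k).toList) k (F.fn k s))
    rw [gain] at this ⊢
    linarith

theorem defeats_candidates (hWE : IsWitnessEncryption SmallCircuitRel Enc Dec)
    (hO : F.IsCandidate Obf) (hB : ∀ k s, ∀ C ∈ (Obf k (F.circ k s)).support, C.size ≤ B.eval k)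
    (hI : F.HasPseudoEntropyOn I fun k => B.eval k + k) : ∃ A : NonuniformPPT 2,
      ((∃ ν, Negligible ν ∧ ∀ k,
          1 - ν k ≤ F.prAdv Obf A k (F.auxRandom Enc k (B.eval k) (I k))) ∧
        ∀ S : F.Alg 1, ∃ ν, Negligible ν ∧ ∀ k,
          F.prSim S k (F.auxRandom Enc k (B.eval k) (I k)) ≤ 1 / 2 + ν k) ∧
      ∀ (π : ∀ k, Bits k → Bool) (δ : ℕ → ℝ), F.NotLearnable π δ →
        (∃ ν, Negligible ν ∧ ∀ k,
          1 - ν k ≤ F.prAdv Obf A k (F.auxPred Enc k (B.eval k) (I k) (π k))) ∧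
        ∀ S : F.Alg 1, ∃ ν, Negligible ν ∧ ∀ k,
          F.prSim S k (F.auxPred Enc k (B.eval k) (I k) (π k)) ≤ δ k + ν k := by
  obtain ⟨A, ν, hν, hA⟩ := exists_obfuscation_decryptor hWE hO hB hI.1
  refine ⟨A, ⟨⟨ν, hν, fun k => ?_⟩, fun S => ⟨_, negligible_gain hWE S hI, fun k => ?_⟩⟩,
    fun π δ hπ => ⟨⟨ν, hν, fun k => ?_⟩, fun S => ?_⟩⟩
  · refine le_pr_bind fun s _ => ?_
    rw [auxRandom, PMF.bind_bind]
    refine le_pr_bind fun b _ => ?_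
    rw [PMF.bind_map]
    exact hA k s b
  · rw [prSim_auxRandom, ← avg_mul]
    gcongr
    refine avg_mono _ fun s => ?_
    have h1 := le_abs_self (gain Enc S (fun k => B.eval k) (fun k => (I k).toList) k (F.fn k s))
    have h2 := abs_nonneg (gain Enc S (fun k => B.eval k) (fun k => (I k).toList) k (F.fn k s))
    linarith
  · refine le_pr_bind fun s _ => ?_
    rw [auxPred, PMF.bind_map]
    exact hA k s (π k s)
  · obtain ⟨E, hE⟩ := exists_learner Enc S (fun k => B.eval k) (fun k => (I k).toList)
      F.poly_outLen (poly_encPlan B hI.1) false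
    obtain ⟨μ, hμ, hL⟩ := hπ E
    refine ⟨_, hμ.add (negligible_gain hWE S hI), fun k => ?_⟩
    have h1 := prSim_auxPred_le (B := B) (I := I) (Enc := Enc) S k (π k)
    have h2 := hL k
    simp only [hE] at h2
    linarith

/-- A simulator for the obfuscated circuit would have to predict the encrypted bit. Because the
auxiliary input of the definition is a function of `s`, the coins of the encryption are fixed in the
way that is best for the adversary in comparison with the simulator. -/
theorem SuperPolyPseudoEntropy.not_isAvgVBBDepAux
    (hWE : IsWitnessEncryption SmallCircuitRel Enc Dec) (hF : F.SuperPolyPseudoEntropy)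
    (Obf : F.Obf) : ¬ F.IsAvgVBBDepAux Obf := by
  rintro ⟨hO, hV⟩
  obtain ⟨p, hp⟩ := hO.2
  obtain ⟨q, hq⟩ := F.poly_size
  obtain ⟨I, hI⟩ := hF (p.comp q + Polynomial.X)
  simp only [Polynomial.eval_add, Polynomial.eval_X] at hI
  have hB : ∀ k s, ∀ C ∈ (Obf k (F.circ k s)).support, C.size ≤ (p.comp q).eval k :=
    fun k s C hC => (hp k s C hC).trans (by rw [Polynomial.eval_comp]; exact eval_mono p (hq k s))
  obtain ⟨A, ⟨⟨ν, hν, hA⟩, hS⟩, -⟩ := defeats_candidates hWE hO hB hI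
  obtain ⟨S, hVS⟩ := hV A
  obtain ⟨ν', hν', hS'⟩ := hS S
  choose z hz hle using fun k s => exists_le_pr_sub
    (F.auxRandom Enc k ((p.comp q).eval k) (I k) s)
    (fun z => (Obf k (F.circ k s)).bind fun C =>
      (A.exec k [C.encode, z.1]).map fun o => o == z.2)
    (fun z => (S.run k (F.fn k s) [z.1]).map fun o => o == z.2)
  obtain ⟨r, hr⟩ := Enc.rpt.length_le
  obtain ⟨t, ht⟩ := poly_encodeStmt (F := F) (p.comp q) hI.1
  have hlen : ∃ p : Polynomial ℕ, ∀ k s, (z k s).1.length ≤ p.eval k := by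
    refine ⟨r.comp (Polynomial.X + t + 1), fun k s => ?_⟩
    have h := hz k s
    rw [auxRandom, PMF.mem_support_bind_iff] at h
    obtain ⟨b, -, h⟩ := h
    rw [PMF.mem_support_map_iff] at h
    obtain ⟨c, hc, h⟩ := h
    rw [← h]
    refine (hr noOracle [_, _, _] rfl trivial c hc).trans ?_
    rw [Polynomial.eval_comp (p := r)]
    refine eval_mono r ?_
    have := ht k (F.fn k s)
    simp only [totalLen_cons, totalLen_nil, List.length_replicate, List.length_cons,
      List.length_nil, Polynomial.eval_add, Polynomial.eval_X, Polynomial.eval_one, stmt]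
    omega
  have hη := hVS (fun k s _ => (z k s).2) (fun k s => (z k s).1) hlen
  have hhalf : ∀ k, (1 / 2 : ℝ) ≤ |F.prAdv Obf A k (fun s => PMF.pure ((z k s).1, (z k s).2)) -
      F.prSim S k (fun s => PMF.pure ((z k s).1, (z k s).2))| + (ν k + ν' k) := by
    intro k
    have h1 := hA k
    have h2 := hS' k
    have h3 := avg_mono (unif k) (hle k)
    rw [avg_sub, avg_sub, ← pr_bind_avg, ← pr_bind_avg, ← pr_bind_avg, ← pr_bind_avg] at h3
    simp only [prAdv, prSim, PMF.pure_bind] at h1 h2 h3 ⊢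
    refine le_trans ?_ (add_le_add_left (le_abs_self _) _)
    linarith
  have := ge_of_tendsto' (hη.add (hν.add hν')).tendsto hhalf
  norm_num at this

end CircuitFamily

end VBBObf

theorem mainTheorem2
    (hWE : ∃ R : List Bool → List Bool → Prop, NPComplete R ∧
      ∃ (Enc : PPT 3) (Dec : PPT 2), IsWitnessEncryption R Enc Dec) :
    -- no pseudo-entropic family has an average-case obfuscator
    (∀ F : CircuitFamily, F.SuperPolyPseudoEntropy →
      ¬ ∃ Obf : F.Obf, F.IsAvgVBBDepAux Obf) ∧
    -- there is a witness encryption for statements "some small circuit matches `C` on `I`"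
    (∃ (Enc : PPT 3) (Dec : PPT 2), IsWitnessEncryption SmallCircuitRel Enc Dec) ∧
    -- every such scheme gives auxiliary inputs that defeat every candidate obfuscator
    (∀ (Enc : PPT 3) (Dec : PPT 2), IsWitnessEncryption SmallCircuitRel Enc Dec →
      ∀ (F : CircuitFamily) (Obf : F.Obf), F.IsCandidate Obf →
      ∀ B : Polynomial ℕ,
        (∀ k s, ∀ C ∈ (Obf k (F.circ k s)).support, C.size ≤ B.eval k) →
      ∀ I : (∀ k, Finset (Bits (F.inLen k))),
        F.HasPseudoEntropyOn I (fun k => B.eval k + k) →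
      ∃ A : NonuniformPPT 2,
        -- encryption of a random bit
        ((∃ ν, Negligible ν ∧ ∀ k,
            1 - ν k ≤ F.prAdv Obf A k (F.auxRandom Enc k (B.eval k) (I k))) ∧
          ∀ S : F.Alg 1, ∃ ν, Negligible ν ∧ ∀ k,
            F.prSim S k (F.auxRandom Enc k (B.eval k) (I k)) ≤ 1 / 2 + ν k) ∧
        -- encryption of a predicate that is not learnable from black-box access
        ∀ (π : ∀ k, Bits k → Bool) (δ : ℕ → ℝ), F.NotLearnable π δ →
          (∃ ν, Negligible ν ∧ ∀ k,
            1 - ν k ≤ F.prAdv Obf A k (F.auxPred Enc k (B.eval k) (I k) (π k))) ∧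
          ∀ S : F.Alg 1, ∃ ν, Negligible ν ∧ ∀ k,
            F.prSim S k (F.auxPred Enc k (B.eval k) (I k) (π k)) ≤ δ k + ν k) := by
  obtain ⟨R, hR, Enc₀, Dec₀, h₀⟩ := hWE
  obtain ⟨Enc, Dec, h⟩ := h₀.of_reduces (hR.2 _ isNPRelation_smallCircuitRel)
  exact ⟨fun F hF ⟨Obf, hO⟩ => hF.not_isAvgVBBDepAux h Obf hO, ⟨Enc, Dec, h⟩,
    fun Enc Dec h F Obf hO B hB I hI => CircuitFamily.defeats_candidates h hO hB hI⟩
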